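/- **Theorem.** Let $0<r_1<r_2$, $\Omega_2=\{x\in\mathbb{R}^2: r_1<|x|<r_2\}$, $\Gamma_1=\{|x|=r_1\}$, $\Gamma_2=\{|x|=r_2\}$, let $n$ be the outward unit normal of $\Omega_2$, and let $M_1,\dots,M_5>0$. For $g,q,b\in\mathbb{R}$ and $\alpha>0$ the problems $$S:\quad -\Delta u=g\ \text{in }\Omega_2,\qquad u=b\ \text{on }\Gamma_1,\qquad -\frac{\partial u}{\partial n}=q\ \text{on }\Gamma_2,$$ $$S_\alpha:\quad -\Delta u_\alpha=g\ \text{in }\Omega_2,\qquad -\frac{\partial u_\alpha}{\partial n}=\alpha(u_\alpha-b)\ \text{on }\Gamma_1,\qquad -\frac{\partial u_\alpha}{\partial n}=q\ \text{on }\Gamma_2$$ each have exactly one classical solution (of class $C^2$ in $\Omega_2$, continuous on $\overline{\Omega_2}$, with the one-sided normal derivatives prescribed on the boundary). For $z_d\in\mathbb{R}$, and with $H=L^2(\Omega_2)$, $Q=L^2(\Gamma_2)$, $B=L^2(\Gamma_1)$, put $$J_1(g)=\tfrac12\|u-z_d\|_H^2+\tfrac{M_1}{2}\|g\|_H^2,\qquad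 J_2(q)=\tfrac12\|u-z_d\|_H^2+\tfrac{M_2}{2}\|q\|_Q^2,$$ $$J_3(b)=\tfrac12\|u-z_d\|_H^2+\tfrac{M_3}{2}\|b\|_B^2,\qquad J_4(g,q)=\tfrac12\|u-z_d\|_H^2+\tfrac{M_4}{2}\|g\|_H^2+\tfrac{M_5}{2}\|q\|_Q^2,$$ where $u$ solves $S$, the displayed arguments are real variables (constant functions), and the other data are fixed. Let $J_{1\alpha},\dots,J_{4\alpha}$ be the same functionals with $u_\alpha$ in place of $u$. Each of them has exactly one minimizer over $\mathbb{R}$ (over $\mathbb{R}^2$ for $J_4,J_{4\alpha}$). Let \begin{align*} E_1&=\tfrac{1}{8} \left[-\tfrac{1}{12}+\tfrac{5}{8} \left(\tfrac{r_2}{r_1}\right)^2+\left(\tfrac{r_2}{r_1}\right)^4 \left(\log \left(\tfrac{r_2}{r_1}\right)-\tfrac{5}{4}\right)+\left(\tfrac{r_2}{r_1}\right)^6 \left(\log ^2\left(\tfrac{r_2}{r_1}\right)-\tfrac{3}{2} \log \left(\tfrac{r_2}{r_1}\right)+\tfrac{17}{24}\right)\right]\\ E_2&=\tfrac{1}{4}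 \left(-\left(\tfrac{r_2}{r_1}\right)^2+\left(\tfrac{r_2}{r_1}\right)^4 \left(2 \log ^2\left(\tfrac{r_2}{r_1}\right)-2 \log \left(\tfrac{r_2}{r_1}\right)+1\right)\right)\\ E_3&=\tfrac{1}{2} \left(-1+\left(\tfrac{r_2}{r_1}\right)^2\right)\\ E_4&=\tfrac{1}{4} \left[-\tfrac{3 }{8 }\left( \tfrac{r_2}{r_1}\right)+\left(\tfrac{r_2}{r_1}\right)^3 \left(\tfrac{3}{2}-\log \left(\tfrac{r_2}{r_1}\right)\right)+\left(\tfrac{r_2}{r_1}\right)^5 \left(-2 \log ^2\left(\tfrac{r_2}{r_1}\right)+\tfrac{5}{2} \log \left(\tfrac{r_2}{r_1}\right)-\tfrac{9}{8}\right)\right]\\ E_5&=\tfrac{1}{2} \left(-\tfrac{1}{4}+\left(\tfrac{r_2}{r_1}\right)^2+\left(\tfrac{r_2}{r_1}\right)^4 \left(\log \left(\tfrac{r_2}{r_1}\right)-\tfrac{3}{4}\right)\right)\\ E_6&=-\left(\tfrac{1}{2}\left(\tfrac{r_2}{r_1}\right)+\left(\tfrac{r_2}{r_1}\right)^3 \left(\log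 \left(\tfrac{r_2}{r_1}\right)-\tfrac{1}{2}\right)\right) \end{align*} and, for $\alpha>0$, \begin{align*} E_{1\alpha}&= \tfrac{1}{8} \left[ -\tfrac{1}{12}+\tfrac{1}{2\alpha r_1}-\tfrac{1}{\alpha^2 r_1^2}+\left(\tfrac{r_2}{r_1} \right)^2 \left( \tfrac{5}{8}-\tfrac{5}{2\alpha r_1}+\tfrac{3}{\alpha^2 r_1^2}\right)\right. \\ &+\left(\tfrac{r_2}{r_1} \right)^4 \left(\log\left(\tfrac{r_2}{r_1} \right)-\tfrac{5}{4}+\tfrac{1}{\alpha r_1}\left(\tfrac{7}{2}-2\log\left(\tfrac{r_2}{r_1} \right) \right)-\tfrac{3}{\alpha^2 r_1^2} \right)\\ &+\left. \left(\tfrac{r_2}{r_1} \right)^6 \left( \log^2\left(\tfrac{r_2}{r_1} \right)-\tfrac{3}{2}\log\left(\tfrac{r_2}{r_1} \right)+\tfrac{17}{24}-\tfrac{3}{2\alpha r_1}+\tfrac{2}{\alpha r_1}\log\left(\tfrac{r_2}{r_1} \right)+\tfrac{1}{\alpha^2 r_1^2}\right)\right]\\ E_{2\alpha} &=\tfrac{1}{4}\left[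 -\left(\tfrac{r_2}{r_1} \right)^2\left( 1+\tfrac{2}{\alpha^2 r_1^2}-\tfrac{2}{\alpha r_1}\right)\right.\\ &\left. + \left(\tfrac{r_2}{r_1} \right)^4 \left(2\log^2\left(\tfrac{r_2}{r_1} \right)-2\log\left(\tfrac{r_2}{r_1} \right)+1+\tfrac{2}{\alpha^2 r_1^2}+\tfrac{1}{\alpha r_1}\left( 4\log\left(\tfrac{r_2}{r_1} \right)-2\right) \right)\right]\\ E_{3\alpha}&= E_3=\tfrac{1}{2}\left( -1+\left(\tfrac{r_2}{r_1} \right)^2\right)\\ E_{4\alpha}&= \tfrac{1}{4}\left[\tfrac{r_2}{r_1} \left(-\tfrac{3}{8}+\tfrac{3}{2\alpha r_1}-\tfrac{2}{\alpha^2 r_1^2} \right) \right.\\ &+ \left(\tfrac{r_2}{r_1} \right)^3 \left( \tfrac{3}{2}-\log\left(\tfrac{r_2}{r_1} \right)+\tfrac{1}{\alpha r_1} \left( 2\log\left(\tfrac{r_2}{r_1} \right)-4\right)+\tfrac{4}{\alpha^2 r_1^2}\right)\\ &+\left. \left(\tfrac{r_2}{r_1} \right)^5 \left( -2\log^2\left(\tfrac{r_2}{r_1}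 \right)+\tfrac{5}{2}\log\left(\tfrac{r_2}{r_1} \right)-\tfrac{9}{8}-\tfrac{4}{\alpha r_1}\log\left(\tfrac{r_2}{r_1} \right)+\tfrac{5}{2\alpha r_1} -\tfrac{2}{\alpha^2 r_1^2}\right) \right]\\ E_{5\alpha} &= \tfrac{1}{2}\left[ -\tfrac{1}{4}+\tfrac{1}{\alpha r_1}+\left(\tfrac{r_2}{r_1} \right)^2\left( 1-\tfrac{2}{\alpha r_1}\right)+\left(\tfrac{r_2}{r_1} \right)^4 \left(\log\left(\tfrac{r_2}{r_1} \right)-\tfrac{3}{4}+\tfrac{1}{\alpha r_1} \right)\right]\\ E_{6\alpha} &= - \left( \tfrac{r_2}{r_1}\left(\tfrac{1}{2}-\tfrac{1}{\alpha r_1} \right)+\left(\tfrac{r_2}{r_1} \right)^3 \left( \log\left(\tfrac{r_2}{r_1} \right)-\tfrac{1}{2}+\tfrac{1}{\alpha r_1}\right) \right). \end{align*} i) For the distributed optimal control problems for $J_1$ and $J_{1\alpha}$, the optimal solutions are given by: $$ g_{op}=-\frac{E_4 q r_1+E_5 (b-z_d)}{2 r_1^2 \left(E_1+E_3\frac{ M_1}{r_1^4}\right)}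 $$ and $$ g_{\alpha_{op}}=-\frac{E_{4\alpha} q r_1+E_{5\alpha} (b-z_d)}{2 r_1^2 \left(E_{1\alpha}+E_{3\alpha}\frac{ M_1}{r_1^4}\right)} $$ and the optimal values can be expressed as: \begin{align*} J_1(g_{op})=\tfrac{\pi r_1^2 \left[4 \left(E_1+E_3\tfrac{ M_1}{r_1^4}\right) \left(E_2 q^2 r_1^2+ E_3 (b-z_d)^2+E_6 q r_1 (b-z_d)\right)-\left(E_4 q r_1+E_5 (b-z_d)\right)^2\right]}{4 \left(E_1+E_3\tfrac{ M_1}{r_1^4}\right)} \end{align*} and \begin{align*} J_{1\alpha}(g_{\alpha_{op}})=\tfrac{\pi r_1^2 \left[4 \left(E_{1\alpha}+E_{3\alpha}\tfrac{ M_1}{r_1^4}\right) \left(E_{2\alpha} q^2 r_1^2+E_{3\alpha} (b-z_d)^2+E_{6\alpha} q r_1 (b-z_d)\right)-\left(E_{4\alpha} q r_1+ E_{5\alpha} (b-z_d)\right)^2\right]}{4 \left(E_{1\alpha}+E_{3\alpha}\tfrac{ M_1}{r_1^4}\right)} \end{align*} ii) For the boundary optimal control problems for $J_2$ and $J_{2\alpha}$,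 the optimal solutions are given by: $$ q_{op}=-\frac{E_4 g r_1^2+ E_6 (b-z_d)}{2 r_1 \left(E_2+\tfrac{M_2 r_2}{r_1^4}\right)} $$ and $$ q_{\alpha_{op}}=-\frac{E_{4\alpha} g r_1^2+ E_{6\alpha} (b-z_d)}{2 r_1 \left(E_{2\alpha}+\tfrac{M_2 r_2}{r_1^4}\right)} $$ where the optimal values are given by: \begin{align*} J_2(q_{op})&=\tfrac{\pi r_1^2 \left[4 \left(E_2+\tfrac{M_2 r_2}{ r_1^4}\right) \left(E_1 g^2 r_1^4+E_3 (b-z_d)^2+E_5 g r_1^2 (b-z_d)\right)-\left(E_4 g r_1^2+E_6 (b-z_d)\right)^2\right]}{4 \left(E_2+\tfrac{M_2 r_2}{ r_1^4}\right)} \end{align*} and \begin{align*} J_{2\alpha}(q_{\alpha_{op}})&=\tfrac{\pi r_1^2 \left[4 \left(E_{2\alpha}+\tfrac{M_2 r_2}{ r_1^4}\right) \left(E_{1\alpha} g^2 r_1^4+ E_{3\alpha} (b-z_d)^2+E_{5\alpha} g r_1^2 (b-z_d)\right)-\left(E_{4\alpha} g r_1^2+E_{6\alpha} (b-z_d)\right)^2\right]}{4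 \left(E_{2\alpha}+\tfrac{M_2 r_2}{ r_1^4}\right)}. \end{align*} iii) For the boundary optimal control problems for $J_3$ and $J_{3\alpha}$, the optimal controls are given by $$ b_{op}=-\frac{E_5 g r_1^2+E_6 q r_1-2 E_3 z_d}{2 \left(E_3+\frac{M_3}{r_1}\right)} $$ and $$ b_{\alpha_{op}}=-\frac{E_{5\alpha} g r_1^2+E_{6\alpha} q r_1-2 E_{3\alpha} z_d}{2 \left(E_{3\alpha}+\frac{M_3}{r_1}\right)} $$ respectively. In addition, the optimal values are given by: \begin{align*} J_3(b_{op})&= \left[4 \left(E_3+\tfrac{M_3}{r_1}\right) \left(E_1 g^2 r_1^4+E_2 q^2 r_1^2+E_3 z_d^2+E_4 g q r_1^3-E_5 g r_1^2 z_d-E_6 q r_1 z_d\right)\right.\\ &\left.-\left(-2 E_3 z_d+E_5 g r_1^2+E_6 q r_1\right)^2\right]\tfrac{\pi r_1^2}{4 \left(E_3+\tfrac{M_3}{r_1}\right)} \end{align*} and \begin{align*} J_{3\alpha}(b_{\alpha_{op}})&= \left[4 \left(E_{3\alpha}+\tfrac{M_3}{r_1}\right) \left(E_{1\alpha} g^2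 r_1^4+E_{2\alpha} q^2 r_1^2+E_{3\alpha} z_d^2+E_{4\alpha} g q r_1^3-E_{5\alpha} g r_1^2 z_d-E_{6\alpha} q r_1 z_d\right)\right. \\ &\left.-\left(-2 E_{3\alpha} z_d+E_{5\alpha} g r_1^2+E_{6\alpha} q r_1\right)^2\right]\tfrac{\pi r_1^2}{4 \left(E_{3\alpha}+\frac{M_3}{r_1}\right)}. \end{align*} iv) For the distributed-boundary optimal control problems for $J_4$ and $J_{4\alpha}$, the optimal solutions are given by \begin{align*} (g,q)_{op}=(g^{op},q^{op})=& \left(\frac{(b-z_d)}{r_1^2} \Delta_2,\frac{(b-z_d)}{r_1}\Pi_2 \right) \end{align*} with $$\Delta_2=\tfrac{E_4 E_6-2 E_5 \left(E_2+\tfrac{M_5 r_2}{r_1^4}\right)}{4 \left(E_1+E_3\tfrac{ M_4}{r_1^4}\right) \left(E_2+\tfrac{M_5 r_2}{r_1^4}\right)-E_4^2},\qquad \Pi_2=\tfrac{E_4 E_5-2 E_6 \left(E_1+E_3\tfrac{ M_4}{r_1^4}\right)}{ 4 \left(E_1+E_3\tfrac{ M_4}{r_1^4}\right) \left(E_2+\frac{M_5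 r_2}{r_1^4}\right)-E_4^2}$$ and \begin{align*} (g,q)_{\alpha_{op}}=(g_{\alpha}^{op},q_{\alpha}^{op})=&\left(\frac{(b-z_d)}{r_1^2} \Delta_{2_\alpha} , \frac{(b-z_d)}{r_1} \Pi_{2_\alpha} \right) \end{align*} where $$\Delta_{2_\alpha}=\tfrac{E_{4\alpha} E_{6\alpha}-2 E_{5\alpha} \left(E_{2\alpha}+\tfrac{M_5 r_2}{r_1^4}\right)}{4 \left(E_{1\alpha}+E_{3\alpha}\tfrac{ M_4}{r_1^4}\right) \left(E_{2\alpha}+\tfrac{M_5 r_2}{r_1^4}\right)-E_{4\alpha}^2},\quad \Pi_{2_\alpha}=\tfrac{E_{4\alpha} E_{5\alpha}-2 E_{6\alpha} \left(E_{1\alpha}+E_{3\alpha}\tfrac{ M_4}{r_1^4}\right)}{4 \left(E_{1\alpha}+E_{3\alpha}\tfrac{ M_4}{r_1^4}\right) \left(E_{2\alpha}+\frac{M_5 r_2}{r_1^4}\right)-E_{4\alpha}^2}$$ Moreover, the optimal values are given by \begin{align*} J_4(g^{op},q^{op})&=\frac{\pi r_1^2 (b-z_d)^2}{\left(4 \left(E_1+E_3\tfrac{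 M_4}{r_1^4}\right) \left(E_2+\tfrac{M_5 r_2}{r_1^4}\right)-E_4^2\right)} \left[4 E_3 \left(E_1+E_3\tfrac{ M_4}{r_1^4}\right) \left(E_2+\tfrac{M_5 r_2}{r_1^4}\right)\right.\\ &\left.-E_6^2 \left(E_1+E_3\tfrac{ M_4}{r_1^4}\right)-E_5^2 \left(E_2+\tfrac{M_5 r_2}{r_1^4}\right)-E_3 E_4^2+E_4 E_5 E_6\right] \end{align*} and \begin{align*} J_{4\alpha}(g_{\alpha}^{op},q_{\alpha}^{op})&=\frac{\pi r_1^2 (b-z_d)^2}{\left(4 \left(E_{1\alpha}+E_{3\alpha}\tfrac{ M_4}{r_1^4}\right) \left(E_{2\alpha}+\tfrac{M_5 r_2}{r_1^4}\right)-E_{4\alpha}^2\right)} \left[4 E_{3\alpha} \left(E_{1\alpha}+E_{3\alpha}\tfrac{ M_4}{r_1^4}\right) \left(E_{2\alpha}+\tfrac{M_5 r_2}{r_1^4}\right)\right.\\ &\left.-E_{6\alpha}^2 \left(E_{1\alpha}+E_{3\alpha}\tfrac{ M_4}{r_1^4}\right)-E_{5\alpha}^2 \left(E_{2\alpha}+\tfrac{M_5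 r_2}{r_1^4}\right)-E_{3\alpha} E_{4\alpha}^2+E_{4\alpha} E_{5\alpha} E_{6\alpha}\right] \end{align*} v) As $\alpha\to\infty$, $g_{\alpha_{op}}\to g_{op}$, $q_{\alpha_{op}}\to q_{op}$, $b_{\alpha_{op}}\to b_{op}$, $(g,q)_{\alpha_{op}}\to(g,q)_{op}$, $J_{1\alpha}(g_{\alpha_{op}})\to J_1(g_{op})$, $J_{2\alpha}(q_{\alpha_{op}})\to J_2(q_{op})$, $J_{3\alpha}(b_{\alpha_{op}})\to J_3(b_{op})$ and $J_{4\alpha}((g,q)_{\alpha_{op}})\to J_4((g,q)_{op})$. In every case the absolute value of the difference (for $(g,q)_{\alpha_{op}}$, of the difference of each component) is $\mathcal{O}(1/\alpha)$, and $\alpha$ times it converges to an explicit constant, as follows; the formula for $b_{\alpha_{op}}$ is an equality for every $\alpha>0$. \textbf{Limit constant for $g_{\alpha_{op}}$} \begin{align*} \lim\limits_{\alpha \to \infty} & \alpha \vert g_{\alpha_{op}}-g_{op}\vert= \frac{12}{\mathcal{G}_2}\;\Bigl|4 r_2^3 \left(r_2^2-r_1^2\right) \log \left(\tfrac{r_2}{r_1}\right)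 \Big[ 36 r_2^3 (b-z_d) \left(r_1^2-r_2^2\right)-96 M_1 q \left(r_1^2-2 r_2^2\right)\\ & +q \left(4 r_1^6-13 r_1^4 r_2^2+14 r_1^2 r_2^4+7 r_2^6\right)\Big]\\ &-\left(r_1^2-r_2^2\right)^2 \Big[ 4 b \left(r_1^2-r_2^2\right) \left(-96 M_1+r_1^4-5 r_1^2 r_2^2+10 r_2^4\right) \\ &-96 M_1 \left(3 q r_1^2 r_2-5 q r_2^3-4 r_1^2 z_d+4 r_2^2 z_d\right)+3 q r_1^6 r_2-14 q r_1^4 r_2^3+19 q r_1^2 r_2^5+4 q r_2^7-4 r_1^6 z_d\\ & +24 r_1^4 r_2^2 z_d-60 r_1^2 r_2^4 z_d+40 r_2^6 z_d\Big]-24 r_2^5 \log ^2\left(\tfrac{r_2}{r_1}\right) \Big[ 4 r_2 (b-z_d) \left(r_1^4-r_2^4\right)\\ & +q \left(2 r_1^6-7 r_1^4 r_2^2+6 r_1^2 r_2^4+r_2^6\right)\Big]+96 q r_1^2 r_2^9 \log ^3\left(\tfrac{r_2}{r_1}\right)\Bigr| \end{align*} with \begin{align*} \mathcal{G}_2&=r_1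 \Big[ \left(r_1^2-r_2^2\right) \left(96 M_1+2 r_1^4-13 r_1^2 r_2^2+17 r_2^4\right)+\left(36 r_2^6-24 r_1^2 r_2^4\right) \log \left(\tfrac{r_2}{r_1}\right)-24 r_2^6 \log ^2\left(\tfrac{r_2}{r_1}\right)\Big]^2 \end{align*} \textbf{Limit constant for $q_{\alpha_{op}}$} \begin{align*} \lim\limits_{\alpha \to \infty} & \alpha \vert q_{\alpha_{op}}-q_{op}\vert=\frac{1}{\mathcal{Q}_2}\Bigl|(r_2^2 - r_1^2) \Big[ g (-24 M_2 r_1^2 + 3 r_1^4 r_2 + 40 M_2 r_2^2 - 4 r_1^2 r_2^3 + r_2^5) -64 M_2 (b-z_d)\Big] \\ & + 2 r_2^2 \Big[g (-3 r_1^4 r_2 + 2 r_1^2 r_2^3 + r_2^5 + 16 M_2 (r_1^2 - 2 r_2^2)) + 16 r_2 (r_1^2 - r_2^2) (b - z_d)\Big] \log \left(\tfrac{r_2}{r_1}\right) \\ & - 4 r_2^3 \Big[ g (-3 r_1^4 + 4 r_1^2 r_2^2 + r_2^4) - 8 (b-z_d) (r_1^2 + r_2^2) \Big]\log^2 \left(\tfrac{r_2}{r_1}\right)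 + 16 g r_1^2 r_2^5 \log^3 \left(\tfrac{r_2}{r_1}\right) \Bigr| \end{align*} with $$\mathcal{Q}_2=8 r_1 \Big[4 M_2-r_1^2 r_2+2 r_2^3 \log ^2\left(\tfrac{r_2}{r_1}\right)-2 r_2^3 \log \left(\tfrac{r_2}{r_1}\right)+r_2^3\Big]^2$$ \textbf{Limit constant for $b_{\alpha_{op}}$} \begin{align*} &\vert b_{\alpha_{op}}-b_{op}\vert=\frac{1}{\alpha}\Big|\frac{\left(r_1^2-r_2^2\right) \left(g \left(r_1^2-r_2^2\right)+2 q r_2\right)}{2 r_1 \left(-2 M_3 r_1+r_1^2-r_2^2\right) }\Big| \end{align*} \textbf{Limit constant for $g_{\alpha}^{op}$ and $q_{\alpha}^{op}$} \begin{align*} \lim\limits_{\alpha \to \infty} & \alpha \vert g_{\alpha}^{op}-g^{op}\vert=\frac{96 |b-z_d|}{\mathcal{P}_2} \; \Bigl|-4 r_2^3 \left(r_2^2-r_1^2\right)^2 \log \left(\tfrac{r_2}{r_1}\right) \Big[768 M_4 \Big(8 M_5 \left(r_1^2+6 r_2^2\right)-3 r_1^4 r_2+3 r_2^5\Big)\\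 & +18432 M_5^2 r_2^3+64 M_5 \Big(8 r_1^6-49 r_1^4 r_2^2-16 r_1^2 r_2^4+21 r_2^6\Big)\\ & -3 \Big(3 r_1^8 r_2-65 r_1^6 r_2^3+49 r_1^4 r_2^5+17 r_1^2 r_2^7-4 r_2^9\Big)\Big]\\ & -\left(r_1^2-r_2^2\right)^3 \Big[-3072 M_4 \Big(64 M_5^2-14 M_5 r_1^2 r_2-6 M_5 r_2^3+r_1^4 r_2^2-r_2^6\Big) \\ & +2048 M_5^2 \Big(r_1^4-5 r_1^2 r_2^2+10 r_2^4\Big)-32 M_5 \Big(5 r_1^6 r_2-25 r_1^4 r_2^3+119 r_1^2 r_2^5-75 r_2^7\Big)\\ & +r_2^2 \Big(5 r_1^8-10 r_1^6 r_2^2+156 r_1^4 r_2^4-182 r_1^2 r_2^6+31 r_2^8\Big)\Big]\\ & +16 r_2^3 \left(r_1^2-r_2^2\right) \log ^2\left(\tfrac{r_2}{r_1}\right) \Big[192 M_4 \left(32 M_5 \left(2 r_1^4-2 r_1^2 r_2^2-r_2^4\right)-r_2 \left(r_1^2-r_2^2\right)^2 \left(7 r_1^2+r_2^2\right)\right)\\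 & -3072 M_5^2 r_2^3 \left(r_1^2+r_2^2\right)-32 M_5 \Big(4 r_1^8-12 r_1^6 r_2^2-53 r_1^4 r_2^4+3 r_1^2 r_2^6+4 r_2^8\Big)+5 r_1^{10} r_2-81 r_1^8 r_2^3\\ & +25 r_1^6 r_2^5+46 r_1^4 r_2^7+6 r_1^2 r_2^9-r_2^{11}\Big]-256 r_1^4 r_2^6 \log ^4\left(\tfrac{r_2}{r_1}\right) \Big[-192 M_4 \left(r_1^2-r_2^2\right)+96 M_5 r_2^3+2 r_1^6+r_2^6\Big]\\ & -64 r_1^2 r_2^6 \log ^3\left(\tfrac{r_2}{r_1}\right) \Big[192 M_4 \left(r_1^4-r_2^4\right)-r_1^2 \left(288 M_5 r_2^3+7 r_2^6\right)-r_2^5 \left(96 M_5+r_2^3\right)+16 r_1^8-8 r_1^6 r_2^2\Big] \Bigr| \end{align*} and \begin{align*} \lim\limits_{\alpha \to \infty} & \alpha \vert q_{\alpha}^{op}-q^{op}\vert=\frac{64 |b-z_d|}{\mathcal{P}_2} \; \Bigl| 2 \left(r_1^2-r_2^2\right)^3 \Big[147456 M_4^2 M_5\\ &-24 M_4 \Big(64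 M_5 \left(5 r_1^4-13 r_1^2 r_2^2+2 r_2^4\right)-3 \left(9 r_1^6 r_2-31 r_1^4 r_2^3+7 r_1^2 r_2^5+15 r_2^7\right)\Big)\\ & -\left(r_1^2-r_2^2\right) \Big(8 M_5 \left(r_1^6-15 r_1^4 r_2^2+3 r_1^2 r_2^4+83 r_2^6\right)+6 r_1^6 r_2^3-3 r_1^4 r_2^5-48 r_1^2 r_2^7+9 r_2^9\Big)\Big]\\ & +r_2^2 \left(r_1^2-r_2^2\right)^2 \log \left(\tfrac{r_2}{r_1}\right) \Big[147456 M_4^2 r_2 \left(r_1^2-r_2^2\right)\\ & -384 M_4 \left(r_1^2-r_2^2\right) \Big(48 M_5 \left(3 r_1^2-4 r_2^2\right)-4 r_1^4 r_2+35 r_1^2 r_2^3+11 r_2^5\Big)\\ &+r_2 \Big(4 r_1^6 \left(672 M_5 r_2+151 r_2^4\right)-2 r_1^4 \left(3744 M_5 r_2^3+209 r_2^6\right)+26 r_2^7 \left(96 M_5+r_2^3\right)\\ &-23 r_1^{10}-56 r_1^8 r_2^2-133 r_1^2 r_2^8\Big)\Big]\\ & -4 r_2^3 \left(r_1^2-r_2^2\right)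 \log ^2\left(\tfrac{r_2}{r_1}\right) \Big[-36864 M_4^2 \left(r_1^4-r_2^4\right)\\ & +192 M_4 \Big(6 r_1^4 \left(16 M_5 r_2+3 r_2^4\right)-r_1^2 \left(96 M_5 r_2^3+13 r_2^6\right)+96 M_5 r_2^5+10 r_1^8-14 r_1^6 r_2^2-r_2^8\Big)\\ &-r_1^8 \left(192 M_5 r_2+209 r_2^4\right)-9 r_1^6 \left(128 M_5 r_2^3-3 r_2^6\right)+r_1^4 \left(3840 M_5 r_2^5+137 r_2^8\right)\\ & -2 r_2^9 \left(96 M_5+r_2^3\right)+2 r_1^{12}+25 r_1^{10} r_2^2+20 r_1^2 r_2^{10}\Big]\\ &+192 r_1^4 r_2^7 \log ^4\left(\tfrac{r_2}{r_1}\right) \Big[192 M_4 \left(r_2^2-r_1^2\right)+96 M_5 r_2^3+2 r_1^6+r_2^6\Big]\\ &-48 r_1^2 r_2^5 \log ^3\left(\tfrac{r_2}{r_1}\right) \Big[192 M_4 \left(r_1^2-r_2^2\right)^2 \left(3 r_1^2+r_2^2\right)\\ & +r_2^2 \left(-3 r_1^4 \left(96 M_5 r_2+r_2^4\right)+8 r_1^2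 \left(48 M_5 r_2^3+r_2^6\right)+96 M_5 r_2^5-14 r_1^8+8 r_1^6 r_2^2+r_2^8\right)\Big]\Bigr| \end{align*} with \begin{align*} \mathcal{P}_2&=r_1 \Big[-16 r_2^3 \log ^2\left(\tfrac{r_2}{r_1}\right) \Big(-192 M_4 \left(r_1^2-r_2^2\right)+96 M_5 r_2^3-4 r_1^6+r_2^6\Big)\\ & -8 r_2^3 \log \left(\tfrac{r_2}{r_1}\right) \Big(384 M_4 \left(r_1^2-r_2^2\right)+6 r_1^2 \left(32 M_5 r_2+r_2^4\right)-288 M_5 r_2^3-10 r_1^6+9 r_1^4 r_2^2-5 r_2^6\Big)\\ &+\left(r_1^2-r_2^2\right) \Big(1536 M_4 \left(4 M_5-r_1^2 r_2+r_2^3\right)+64 M_5 \left(2 r_1^4-13 r_1^2 r_2^2+17 r_2^4\right)-5 r_1^6 r_2+51 r_1^4 r_2^3 \\ &-75 r_1^2 r_2^5+29 r_2^7\Big)\Big]^2 \end{align*} \textbf{Limit constant for $J_{1{\alpha}}(g_{\alpha_{op}})$} \begin{align*} &\lim\limits_{\alpha \to \infty} \alpha\; \Bigl| J_{1\alpha}(g_{\alpha_{op}})-J_1(g_{op})\Bigr|=\frac{\pi}{\mathcal{J}_{12}}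 \Bigl| \Big[ 12 b r_1^6-60 b r_1^4 r_2^2+84 b r_1^2 r_2^4-48 b r_1^2 r_2^4 \log \left(\tfrac{r_2}{r_1}\right) \\ &\quad +48 b r_2^6 \log \left(\tfrac{r_2}{r_1}\right)-36 b r_2^6-192 M_1 q r_1^2 r_2+192 M_1 q r_2^3+5 q r_1^6 r_2-15 q r_1^4 r_2^3+24 q r_1^4 r_2^3 \log \left(\tfrac{r_2}{r_1}\right)\\ &\quad+3 q r_1^2 r_2^5+48 q r_1^2 r_2^5 \log ^2\left(\tfrac{r_2}{r_1}\right)-36 q r_1^2 r_2^5 \log \left(\tfrac{r_2}{r_1}\right)-12 q r_2^7 \log \left(\tfrac{r_2}{r_1}\right)+7 q r_2^7-12 r_1^6 z_d+60 r_1^4 r_2^2 z_d\\ &\quad -84 r_1^2 r_2^4 z_d+48 r_1^2 r_2^4 z_d \log \left(\tfrac{r_2}{r_1}\right)-48 r_2^6 z_d \log \left(\tfrac{r_2}{r_1}\right)+36 r_2^6 z_d\Big] \Big[-768 M_1 q r_2^5 \log \left(\tfrac{r_2}{r_1}\right)-1536 b M_1 r_1^2 r_2^2 \\ &\quad + 768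 b M_1 r_2^4+4 b r_1^8-40 b r_1^6 r_2^2+96 b r_1^4 r_2^4-96 b r_1^4 r_2^4 \log \left(\tfrac{r_2}{r_1}\right)-88 b r_1^2 r_2^6-192 b r_1^2 r_2^6 \log ^2\left(\tfrac{r_2}{r_1}\right)\\ &\quad +96 b r_1^2 r_2^6 \log \left(\tfrac{r_2}{r_1}\right)+28 b r_2^8+384 M_1 q r_1^4 r_2-768 M_1 q r_1^2 r_2^3+768 M_1 q r_1^2 r_2^3 \log \left(\tfrac{r_2}{r_1}\right)+768 b M_1 r_1^4\\ &\quad +384 M_1 q r_2^5-768 M_1 r_1^4 z_d+1536 M_1 r_1^2 r_2^2 z_d-768 M_1 r_2^4 z_d-q r_1^8 r_2+4 q r_1^6 r_2^3-8 q r_1^6 r_2^3 \log \left(\tfrac{r_2}{r_1}\right)\\ &\quad -18 q r_1^4 r_2^5-48 q r_1^4 r_2^5 \log ^2\left(\tfrac{r_2}{r_1}\right)-24 q r_1^4 r_2^5 \log \left(\tfrac{r_2}{r_1}\right)+28 q r_1^2 r_2^7+24 q r_1^2 r_2^7 \log \left(\tfrac{r_2}{r_1}\right)+8 q r_2^9 \log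 \left(\tfrac{r_2}{r_1}\right)\\ &\quad -13 q r_2^9-4 r_1^8 z_d+40 r_1^6 r_2^2 z_d-96 r_1^4 r_2^4 z_d+96 r_1^4 r_2^4 z_d \log \left(\tfrac{r_2}{r_1}\right)+88 r_1^2 r_2^6 z_d+192 r_1^2 r_2^6 z_d \log ^2\left(\tfrac{r_2}{r_1}\right)\\ &\quad -96 r_1^2 r_2^6 z_d \log \left(\tfrac{r_2}{r_1}\right)-28 r_2^8 z_d \Big] \Bigr| \end{align*} with \begin{align*} &\mathcal{J}_{12}=16 r_1 \left[\left(r_1^2-r_2^2\right) \left(96 M_1+2 r_1^4-13 r_1^2 r_2^2+17 r_2^4\right)+\left(36 r_2^6-24 r_1^2 r_2^4\right) \log \left(\tfrac{r_2}{r_1}\right)-24 r_2^6 \log ^2\left(\tfrac{r_2}{r_1}\right)\right]^2 \end{align*} \textbf{Limit constant for $J_{2{\alpha}}(q_{\alpha_{op}})$} \begin{align*} &\lim\limits_{\alpha \to \infty} \alpha\; \Bigl| J_{2\alpha}(q_{\alpha_{op}})-J_2(q_{op})\Bigr|=\frac{\pi}{\mathcal{J}_{22}} \Bigl|\Big[ 16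 b r_1^2 r_2+32 b r_2^3 \log \left(\tfrac{r_2}{r_1}\right)-16 b r_2^3+32 g M_2 r_1^2-32 g M_2 r_2^2 \\ &\quad -5 g r_1^4 r_2+4 g r_1^2 r_2^3+16 g r_1^2 r_2^3 \log ^2\left(\tfrac{r_2}{r_1}\right)-8 g r_1^2 r_2^3 \log \left(\tfrac{r_2}{r_1}\right)-4 g r_2^5 \log \left(\tfrac{r_2}{r_1}\right)+g r_2^5-16 r_1^2 r_2 z_d\\ &\quad -32 r_2^3 z_d \log \left(\tfrac{r_2}{r_1}\right)+16 r_2^3 z_d \Big] \Big[ 128 b M_2 r_1^2-128 b M_2 r_2^2-16 b r_1^4 r_2+32 b r_1^2 r_2^3+64 b r_1^2 r_2^3 \log ^2\left(\tfrac{r_2}{r_1}\right)\\ &\quad -16 b r_2^5+16 g M_2 r_1^4-64 g M_2 r_1^2 r_2^2-64 g M_2 r_2^4 \log \left(\tfrac{r_2}{r_1}\right)+48 g M_2 r_2^4-g r_1^6 r_2+5 g r_1^4 r_2^3\\ &\quad +8 g r_1^4 r_2^3 \log ^2\left(\tfrac{r_2}{r_1}\right)+6 g r_1^4 r_2^3 \log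 \left(\tfrac{r_2}{r_1}\right)-7 g r_1^2 r_2^5-4 g r_1^2 r_2^5 \log \left(\tfrac{r_2}{r_1}\right)-2 g r_2^7 \log \left(\tfrac{r_2}{r_1}\right)+3 g r_2^7\\ &\quad -128 M_2 r_1^2 z_d+128 M_2 r_2^2 z_d+16 r_1^4 r_2 z_d-32 r_1^2 r_2^3 z_d-64 r_1^2 r_2^3 z_d \log ^2\left(\tfrac{r_2}{r_1}\right)+16 r_2^5 z_d \Big]\Bigr| \end{align*} with \begin{align*} &\mathcal{J}_{22}=512 r_1 \left[4 M_2-r_1^2 r_2+2 r_2^3 \log ^2\left(\tfrac{r_2}{r_1}\right)-2 r_2^3 \log \left(\tfrac{r_2}{r_1}\right)+r_2^3\right]^2 \end{align*} \textbf{Limit constant for $J_{3{\alpha}}(b_{\alpha_{op}})$} \begin{align*} \lim\limits_{\alpha \to \infty} &\alpha\; \Bigl| J_{3\alpha}(b_{\alpha_{op}})-J_3(b_{op})\Bigr|=\frac{ \pi\Bigl| M_3 \left(g \left(r_1^2-r_2^2\right)+2 q r_2\right)\Bigr|}{\Bigl| 8 r_1 \left(-2 M_3 r_1+r_1^2-r_2^2\right)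 \Bigr| } \Bigl| g r_1^3 (r_1^2 - r_2^2) + 4 q r_1 r_2 (r_1^2 - r_2^2) \\ &- 3 g r_1 r_2^2 (r_1^2 - r_2^2) - 8 r_1 (r_1^2 - r_2^2) z_d - 4 r_1 r_2^3 (-2 q + g r_2) \log\left(\tfrac{r_2}{r_1}\right)\Bigr| \end{align*} \textbf{Limit constant for $J_{4{\alpha}}( g_{\alpha}^{op}, q_{\alpha}^{op})$} \begin{align*} &\lim\limits_{\alpha \to \infty} \alpha\; \Bigl| J_{4\alpha}(g_{\alpha}^{op},q_{\alpha}^{op})-J_4(g^{op},q^{op})\Bigr|=\frac{4 \pi (b - z_d)^2 }{\mathcal{J}_{42}} \Bigl| \Big[ -384 M_4 r_1^4 r_2+768 M_4 r_1^2 r_2^3-768 M_4 r_1^2 r_2^3 \log \left(\tfrac{r_2}{r_1}\right) \\ &\quad +768 M_4 r_2^5 \log \left(\tfrac{r_2}{r_1}\right)-384 M_4 r_2^5+96 M_5 r_1^6-480 M_5 r_1^4 r_2^2+672 M_5 r_1^2 r_2^4-384 M_5 r_1^2 r_2^4 \log \left(\tfrac{r_2}{r_1}\right) \\ &\quad +384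 M_5 r_2^6 \log \left(\tfrac{r_2}{r_1}\right)-288 M_5 r_2^6-5 r_1^8 r_2+32 r_1^6 r_2^3+48 r_1^6 r_2^3 \log ^2\left(\tfrac{r_2}{r_1}\right)+44 r_1^6 r_2^3 \log \left(\tfrac{r_2}{r_1}\right)\\ &\quad -54 r_1^4 r_2^5-36 r_1^4 r_2^5 \log \left(\tfrac{r_2}{r_1}\right)+32 r_1^2 r_2^7-12 r_1^2 r_2^7 \log \left(\tfrac{r_2}{r_1}\right)+4 r_2^9 \log \left(\tfrac{r_2}{r_1}\right)-5 r_2^9\Big] \Big[6144 M_4 M_5 r_1^4 \\ & \quad -12288 M_4 M_5 r_1^2 r_2^2+6144 M_4 M_5 r_2^4-768 M_4 r_1^6 r_2+2304 M_4 r_1^4 r_2^3+3072 M_4 r_1^4 r_2^3 \log ^2\left(\tfrac{r_2}{r_1}\right)\\ &\quad -2304 M_4 r_1^2 r_2^5-3072 M_4 r_1^2 r_2^5 \log ^2\left(\tfrac{r_2}{r_1}\right)+768 M_4 r_2^7+32 M_5 r_1^8-320 M_5 r_1^6 r_2^2+768 M_5 r_1^4 r_2^4\\ &\quad -768 M_5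 r_1^4 r_2^4 \log \left(\tfrac{r_2}{r_1}\right)-704 M_5 r_1^2 r_2^6-1536 M_5 r_1^2 r_2^6 \log ^2\left(\tfrac{r_2}{r_1}\right)+768 M_5 r_1^2 r_2^6 \log \left(\tfrac{r_2}{r_1}\right)+224 M_5 r_2^8\\ &\quad -r_1^{10} r_2+17 r_1^8 r_2^3+16 r_1^8 r_2^3 \log ^2\left(\tfrac{r_2}{r_1}\right)+24 r_1^8 r_2^3 \log \left(\tfrac{r_2}{r_1}\right)-46 r_1^6 r_2^5-24 r_1^6 r_2^5 \log \left(\tfrac{r_2}{r_1}\right)+46 r_1^4 r_2^7\\ &\quad -24 r_1^4 r_2^7 \log \left(\tfrac{r_2}{r_1}\right)-17 r_1^2 r_2^9-16 r_1^2 r_2^9 \log ^2\left(\tfrac{r_2}{r_1}\right)+24 r_1^2 r_2^9 \log \left(\tfrac{r_2}{r_1}\right)+r_2^{11} \Big]\Bigr| \end{align*} with \begin{align*} &\mathcal{J}_{42}= r_1 \left[6144 M_4 M_5 r_1^2-6144 M_4 M_5 r_2^2-1536 M_4 r_1^4 r_2+3072 M_4 r_1^2 r_2^3 +3072 M_4 r_1^2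 r_2^3 \log ^2\left(\tfrac{r_2}{r_1}\right)\right.\\ &\quad -3072 M_4 r_1^2 r_2^3 \log \left(\tfrac{r_2}{r_1}\right)-3072 M_4 r_2^5 \log ^2\left(\tfrac{r_2}{r_1}\right)+3072 M_4 r_2^5 \log \left(\tfrac{r_2}{r_1}\right)-1536 M_4 r_2^5+128 M_5 r_1^6\\ &\quad -960 M_5 r_1^4 r_2^2+1920 M_5 r_1^2 r_2^4-1536 M_5 r_1^2 r_2^4 \log \left(\tfrac{r_2}{r_1}\right)-1536 M_5 r_2^6 \log ^2\left(\tfrac{r_2}{r_1}\right)+2304 M_5 r_2^6 \log \left(\tfrac{r_2}{r_1}\right)\\ &\quad -1088 M_5 r_2^6-5 r_1^8 r_2+56 r_1^6 r_2^3+64 r_1^6 r_2^3 \log ^2\left(\tfrac{r_2}{r_1}\right)+80 r_1^6 r_2^3 \log \left(\tfrac{r_2}{r_1}\right)-126 r_1^4 r_2^5-72 r_1^4 r_2^5 \log \left(\tfrac{r_2}{r_1}\right)\\ &\quad \left. +104 r_1^2 r_2^7-48 r_1^2 r_2^7 \log \left(\tfrac{r_2}{r_1}\right)-16 r_2^9 \log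 ^2\left(\tfrac{r_2}{r_1}\right)+40 r_2^9 \log \left(\tfrac{r_2}{r_1}\right)-29 r_2^9\right]^2 \end{align*} -/

import Mathlib

open Filter Topology Asymptotics

noncomputable section

namespace AnnulusControl

/-! ## The annulus, the two boundary value problems and their states -/

/-- The Euclidean plane. -/
abbrev Plane : Type := EuclideanSpace ℝ (Fin 2)

/-- The open annulus `r₁ < |x| < r₂`. -/
def annulus (r₁ r₂ : ℝ) : Set Plane := {x | r₁ < ‖x‖ ∧ ‖x‖ < r₂}

/-- The closed annulus `r₁ ≤ |x| ≤ r₂`. -/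
def closedAnnulus (r₁ r₂ : ℝ) : Set Plane := {x | r₁ ≤ ‖x‖ ∧ ‖x‖ ≤ r₂}

/-- `u` has derivative `d` at the boundary point `x` in the direction of the outward unit normal
`ν`. The derivative is one-sided: only the values of `u` at the points `x + s ν` with `s ≤ 0`,
which lie in the closed domain for small `s`, are used. -/
def HasNormalDeriv (u : Plane → ℝ) (x ν : Plane) (d : ℝ) : Prop :=
  HasDerivWithinAt (fun s : ℝ => u (x + s • ν)) d (Set.Iic 0) 0

/-- `u` is a (classical) solution of problem `S` on the annulus:
`-Δu = g` in `Ω`, `u = b` on `Γ₁ = {|x| = r₁}`, `-∂u/∂n = q` on `Γ₂ = {|x| = r₂}`.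
The outward unit normal at `x ∈ Γ₂` is `x / r₂`. -/
structure IsStateS (r₁ r₂ g q b : ℝ) (u : Plane → ℝ) : Prop where
  contDiffOn : ContDiffOn ℝ 2 u (annulus r₁ r₂)
  continuousOn : ContinuousOn u (closedAnnulus r₁ r₂)
  poisson : ∀ x ∈ annulus r₁ r₂, -(Laplacian.laplacian u x) = g
  dirichlet : ∀ x : Plane, ‖x‖ = r₁ → u x = b
  flux : ∀ x : Plane, ‖x‖ = r₂ → HasNormalDeriv u x (r₂⁻¹ • x) (-q)

/-- `u` is a (classical) solution of problem `S_α` on the annulus: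
`-Δu = g` in `Ω`, `-∂u/∂n = α (u - b)` on `Γ₁ = {|x| = r₁}`, `-∂u/∂n = q` on `Γ₂ = {|x| = r₂}`.
The outward unit normal at `x ∈ Γ₁` is `-x / r₁`. -/
structure IsStateSα (r₁ r₂ α g q b : ℝ) (u : Plane → ℝ) : Prop where
  contDiffOn : ContDiffOn ℝ 2 u (annulus r₁ r₂)
  continuousOn : ContinuousOn u (closedAnnulus r₁ r₂)
  poisson : ∀ x ∈ annulus r₁ r₂, -(Laplacian.laplacian u x) = g
  robin : ∀ x : Plane, ‖x‖ = r₁ → HasNormalDeriv u x (-(r₁⁻¹ • x)) (-(α * (u x - b)))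
  flux : ∀ x : Plane, ‖x‖ = r₂ → HasNormalDeriv u x (r₂⁻¹ • x) (-q)

/-- The state of `S`: a chosen solution. (Existence, and uniqueness on the closed annulus, are part
of the theorem.) -/
def stateS (r₁ r₂ g q b : ℝ) : Plane → ℝ := Classical.epsilon (IsStateS r₁ r₂ g q b)

/-- The state of `S_α`: a chosen solution. (Existence, and uniqueness on the closed annulus, are
part of the theorem.) -/
def stateSα (r₁ r₂ α g q b : ℝ) : Plane → ℝ := Classical.epsilon (IsStateSα r₁ r₂ α g q b)

/-! ## Norms and cost functionals -/

/-- `‖f‖²` in `H = L²(Ω)`. -/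
def normSqH (r₁ r₂ : ℝ) (f : Plane → ℝ) : ℝ := ∫ x in annulus r₁ r₂, f x ^ 2

/-- `‖f‖²` in `L²` of the circle `|x| = ρ` with arc length measure `ρ dθ`. -/
def normSqCircle (ρ : ℝ) (f : Plane → ℝ) : ℝ :=
  ∫ θ in (0 : ℝ)..(2 * Real.pi), f !₂[ρ * Real.cos θ, ρ * Real.sin θ] ^ 2 * ρ

def J₁ (r₁ r₂ q b zd M₁ : ℝ) (g : ℝ) : ℝ :=
  1 / 2 * normSqH r₁ r₂ (fun x => stateS r₁ r₂ g q b x - zd) +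
    M₁ / 2 * normSqH r₁ r₂ (fun _ => g)

def J₁α (r₁ r₂ q b zd M₁ α : ℝ) (g : ℝ) : ℝ :=
  1 / 2 * normSqH r₁ r₂ (fun x => stateSα r₁ r₂ α g q b x - zd) +
    M₁ / 2 * normSqH r₁ r₂ (fun _ => g)

def J₂ (r₁ r₂ g b zd M₂ : ℝ) (q : ℝ) : ℝ :=
  1 / 2 * normSqH r₁ r₂ (fun x => stateS r₁ r₂ g q b x - zd) +
    M₂ / 2 * normSqCircle r₂ (fun _ => q)

def J₂α (r₁ r₂ g b zd M₂ α : ℝ) (q : ℝ) : ℝ :=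
  1 / 2 * normSqH r₁ r₂ (fun x => stateSα r₁ r₂ α g q b x - zd) +
    M₂ / 2 * normSqCircle r₂ (fun _ => q)

def J₃ (r₁ r₂ g q zd M₃ : ℝ) (b : ℝ) : ℝ :=
  1 / 2 * normSqH r₁ r₂ (fun x => stateS r₁ r₂ g q b x - zd) +
    M₃ / 2 * normSqCircle r₁ (fun _ => b)

def J₃α (r₁ r₂ g q zd M₃ α : ℝ) (b : ℝ) : ℝ :=
  1 / 2 * normSqH r₁ r₂ (fun x => stateSα r₁ r₂ α g q b x - zd) +
    M₃ / 2 * normSqCircle r₁ (fun _ => b)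

def J₄ (r₁ r₂ b zd M₄ M₅ : ℝ) (c : ℝ × ℝ) : ℝ :=
  1 / 2 * normSqH r₁ r₂ (fun x => stateS r₁ r₂ c.1 c.2 b x - zd) +
    M₄ / 2 * normSqH r₁ r₂ (fun _ => c.1) + M₅ / 2 * normSqCircle r₂ (fun _ => c.2)

def J₄α (r₁ r₂ b zd M₄ M₅ α : ℝ) (c : ℝ × ℝ) : ℝ :=
  1 / 2 * normSqH r₁ r₂ (fun x => stateSα r₁ r₂ α c.1 c.2 b x - zd) +
    M₄ / 2 * normSqH r₁ r₂ (fun _ => c.1) + M₅ / 2 * normSqCircle r₂ (fun _ => c.2)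

/-- `x` is the one and only solution of the problem `J(x) = min J`. -/
def IsUniqueMin {X : Type*} (J : X → ℝ) (x : X) : Prop :=
  IsMinOn J Set.univ x ∧ ∀ y, IsMinOn J Set.univ y → y = x

/-- `x α → l` as `α → ∞`, with `|x α - l| = O(1/α)`, and `α |x α - l| → c`. -/
def ConvergesWithRate (x : ℝ → ℝ) (l c : ℝ) : Prop :=
  Tendsto x atTop (𝓝 l) ∧
  (fun α => |x α - l|) =O[atTop] (fun α : ℝ => 1 / α) ∧
  Tendsto (fun α => α * |x α - l|) atTop (𝓝 c)

/-! ## The coefficients -/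

/-- Six coefficients of a quadratic form in `g`, `q` and `b - zd`. -/
structure Coeffs where
  E₁ : ℝ
  E₂ : ℝ
  E₃ : ℝ
  E₄ : ℝ
  E₅ : ℝ
  E₆ : ℝ

/-- The constants `E₁, …, E₆` for problem `S`. -/
def E (r₁ r₂ : ℝ) : Coeffs :=
  let t := r₂ / r₁
  let L := Real.log (r₂ / r₁)
  { E₁ := 1 / 8 * (-(1 / 12) + 5 / 8 * t ^ 2 + t ^ 4 * (L - 5 / 4) +
        t ^ 6 * (L ^ 2 - 3 / 2 * L + 17 / 24))
    E₂ := 1 / 4 * (-t ^ 2 + t ^ 4 * (2 * L ^ 2 - 2 * L + 1))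
    E₃ := 1 / 2 * (-1 + t ^ 2)
    E₄ := 1 / 4 * (-(3 / 8) * t + t ^ 3 * (3 / 2 - L) +
        t ^ 5 * (-2 * L ^ 2 + 5 / 2 * L - 9 / 8))
    E₅ := 1 / 2 * (-(1 / 4) + t ^ 2 + t ^ 4 * (L - 3 / 4))
    E₆ := -(1 / 2 * t + t ^ 3 * (L - 1 / 2)) }

/-- The constants `E₁α, …, E₆α` for problem `S_α`. -/
def Eα (r₁ r₂ α : ℝ) : Coeffs :=
  let t := r₂ / r₁
  let L := Real.log (r₂ / r₁)
  { E₁ := 1 / 8 * (-(1 / 12) + 1 / (2 * α * r₁) - 1 / (α ^ 2 * r₁ ^ 2) +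
        t ^ 2 * (5 / 8 - 5 / (2 * α * r₁) + 3 / (α ^ 2 * r₁ ^ 2)) +
        t ^ 4 * (L - 5 / 4 + 1 / (α * r₁) * (7 / 2 - 2 * L) - 3 / (α ^ 2 * r₁ ^ 2)) +
        t ^ 6 * (L ^ 2 - 3 / 2 * L + 17 / 24 - 3 / (2 * α * r₁) + 2 / (α * r₁) * L +
          1 / (α ^ 2 * r₁ ^ 2)))
    E₂ := 1 / 4 * (-t ^ 2 * (1 + 2 / (α ^ 2 * r₁ ^ 2) - 2 / (α * r₁)) +
        t ^ 4 * (2 * L ^ 2 - 2 * L + 1 + 2 / (α ^ 2 * r₁ ^ 2) + 1 / (α * r₁) * (4 * L - 2)))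
    E₃ := 1 / 2 * (-1 + t ^ 2)
    E₄ := 1 / 4 * (t * (-(3 / 8) + 3 / (2 * α * r₁) - 2 / (α ^ 2 * r₁ ^ 2)) +
        t ^ 3 * (3 / 2 - L + 1 / (α * r₁) * (2 * L - 4) + 4 / (α ^ 2 * r₁ ^ 2)) +
        t ^ 5 * (-2 * L ^ 2 + 5 / 2 * L - 9 / 8 - 4 / (α * r₁) * L + 5 / (2 * α * r₁) -
          2 / (α ^ 2 * r₁ ^ 2)))
    E₅ := 1 / 2 * (-(1 / 4) + 1 / (α * r₁) + t ^ 2 * (1 - 2 / (α * r₁)) +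
        t ^ 4 * (L - 3 / 4 + 1 / (α * r₁)))
    E₆ := -(t * (1 / 2 - 1 / (α * r₁)) + t ^ 3 * (L - 1 / 2 + 1 / (α * r₁))) }

/-! ## The closed formulas

Each formula is used twice: with the coefficients `E r₁ r₂` for the problems posed through `S`, and
with `Eα r₁ r₂ α` for those posed through `S_α`. -/

def gOp (c : Coeffs) (r₁ q b zd M₁ : ℝ) : ℝ :=
  -((c.E₄ * q * r₁ + c.E₅ * (b - zd)) / (2 * r₁ ^ 2 * (c.E₁ + c.E₃ * (M₁ / r₁ ^ 4))))

def J₁Op (c : Coeffs) (r₁ q b zd M₁ : ℝ) : ℝ :=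
  Real.pi * r₁ ^ 2 *
    (4 * (c.E₁ + c.E₃ * (M₁ / r₁ ^ 4)) *
        (c.E₂ * q ^ 2 * r₁ ^ 2 + c.E₃ * (b - zd) ^ 2 + c.E₆ * q * r₁ * (b - zd)) -
      (c.E₄ * q * r₁ + c.E₅ * (b - zd)) ^ 2) /
    (4 * (c.E₁ + c.E₃ * (M₁ / r₁ ^ 4)))

def qOp (c : Coeffs) (r₁ r₂ g b zd M₂ : ℝ) : ℝ :=
  -((c.E₄ * g * r₁ ^ 2 + c.E₆ * (b - zd)) / (2 * r₁ * (c.E₂ + M₂ * r₂ / r₁ ^ 4)))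

def J₂Op (c : Coeffs) (r₁ r₂ g b zd M₂ : ℝ) : ℝ :=
  Real.pi * r₁ ^ 2 *
    (4 * (c.E₂ + M₂ * r₂ / r₁ ^ 4) *
        (c.E₁ * g ^ 2 * r₁ ^ 4 + c.E₃ * (b - zd) ^ 2 + c.E₅ * g * r₁ ^ 2 * (b - zd)) -
      (c.E₄ * g * r₁ ^ 2 + c.E₆ * (b - zd)) ^ 2) /
    (4 * (c.E₂ + M₂ * r₂ / r₁ ^ 4))

def bOp (c : Coeffs) (r₁ g q zd M₃ : ℝ) : ℝ :=
  -((c.E₅ * g * r₁ ^ 2 + c.E₆ * q * r₁ - 2 * c.E₃ * zd) / (2 * (c.E₃ + M₃ / r₁)))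

def J₃Op (c : Coeffs) (r₁ g q zd M₃ : ℝ) : ℝ :=
  (4 * (c.E₃ + M₃ / r₁) *
      (c.E₁ * g ^ 2 * r₁ ^ 4 + c.E₂ * q ^ 2 * r₁ ^ 2 + c.E₃ * zd ^ 2 + c.E₄ * g * q * r₁ ^ 3 -
        c.E₅ * g * r₁ ^ 2 * zd - c.E₆ * q * r₁ * zd) -
    (-2 * c.E₃ * zd + c.E₅ * g * r₁ ^ 2 + c.E₆ * q * r₁) ^ 2) *
  (Real.pi * r₁ ^ 2 / (4 * (c.E₃ + M₃ / r₁)))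

/-- The common denominator of the simultaneous problem. -/
def den₄ (c : Coeffs) (r₁ r₂ M₄ M₅ : ℝ) : ℝ :=
  4 * (c.E₁ + c.E₃ * (M₄ / r₁ ^ 4)) * (c.E₂ + M₅ * r₂ / r₁ ^ 4) - c.E₄ ^ 2

/-- `Δ₂`. -/
def delta₂ (c : Coeffs) (r₁ r₂ M₄ M₅ : ℝ) : ℝ :=
  (c.E₄ * c.E₆ - 2 * c.E₅ * (c.E₂ + M₅ * r₂ / r₁ ^ 4)) / den₄ c r₁ r₂ M₄ M₅

/-- `Π₂`. -/
def pi₂ (c : Coeffs) (r₁ r₂ M₄ M₅ : ℝ) : ℝ :=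
  (c.E₄ * c.E₅ - 2 * c.E₆ * (c.E₁ + c.E₃ * (M₄ / r₁ ^ 4))) / den₄ c r₁ r₂ M₄ M₅

def gqOp (c : Coeffs) (r₁ r₂ b zd M₄ M₅ : ℝ) : ℝ × ℝ :=
  ((b - zd) / r₁ ^ 2 * delta₂ c r₁ r₂ M₄ M₅, (b - zd) / r₁ * pi₂ c r₁ r₂ M₄ M₅)

def J₄Op (c : Coeffs) (r₁ r₂ b zd M₄ M₅ : ℝ) : ℝ :=
  Real.pi * r₁ ^ 2 * (b - zd) ^ 2 / den₄ c r₁ r₂ M₄ M₅ *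
    (4 * c.E₃ * (c.E₁ + c.E₃ * (M₄ / r₁ ^ 4)) * (c.E₂ + M₅ * r₂ / r₁ ^ 4) -
      c.E₆ ^ 2 * (c.E₁ + c.E₃ * (M₄ / r₁ ^ 4)) - c.E₅ ^ 2 * (c.E₂ + M₅ * r₂ / r₁ ^ 4) -
      c.E₃ * c.E₄ ^ 2 + c.E₄ * c.E₅ * c.E₆)

/-! ## The limit constants -/

/-- Squared denominator in the limit constants of the distributed problem. -/
def denG (r₁ r₂ M₁ : ℝ) : ℝ :=
  let L := Real.log (r₂ / r₁)
  r₁ * ((r₁^2 - r₂^2) * (96 * M₁ + 2 * r₁^4 - 13 * r₁^2 * r₂^2 + 17 * r₂^4) + (36 * r₂^6 -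
  24 * r₁^2 * r₂^4) * L - 24 * r₂^6 * L^2)^2

/-- Squared denominator in the limit constants of the flux problem. -/
def denQ (r₁ r₂ M₂ : ℝ) : ℝ :=
  let L := Real.log (r₂ / r₁)
  8 * r₁ * (4 * M₂ - r₁^2 * r₂ + 2 * r₂^3 * L^2 - 2 * r₂^3 * L + r₂^3)^2

/-- Squared denominator in the limit constants of the simultaneous controls. -/
def denP (r₁ r₂ M₄ M₅ : ℝ) : ℝ :=
  let L := Real.log (r₂ / r₁)
  r₁ * (-16 * r₂^3 * L^2 * (-192 * M₄ * (r₁^2 - r₂^2) + 96 * M₅ * r₂^3 - 4 * r₁^6 + r₂^6) -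
  8 * r₂^3 * L * (384 * M₄ * (r₁^2 - r₂^2) + 6 * r₁^2 * (32 * M₅ * r₂ + r₂^4) - 288 * M₅ * r₂^3 -
  10 * r₁^6 + 9 * r₁^4 * r₂^2 - 5 * r₂^6) + (r₁^2 - r₂^2) * (1536 * M₄ * (4 * M₅ - r₁^2 * r₂ +
  r₂^3) + 64 * M₅ * (2 * r₁^4 - 13 * r₁^2 * r₂^2 + 17 * r₂^4) - 5 * r₁^6 * r₂ + 51 * r₁^4 * r₂^3 -
  75 * r₁^2 * r₂^5 + 29 * r₂^7))^2

/-- `lim α |g_{α op} - g_op|`. -/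
def limG (r₁ r₂ q b zd M₁ : ℝ) : ℝ :=
  let L := Real.log (r₂ / r₁)
  12 / denG r₁ r₂ M₁ *
   |4 * r₂^3 * (r₂^2 - r₁^2) * L * (36 * r₂^3 * (b - zd) * (r₁^2 - r₂^2) - 96 * M₁ * q * (r₁^2 -
    2 * r₂^2) + q * (4 * r₁^6 - 13 * r₁^4 * r₂^2 + 14 * r₁^2 * r₂^4 + 7 * r₂^6)) - (r₁^2 -
    r₂^2)^2 * (4 * b * (r₁^2 - r₂^2) * (-96 * M₁ + r₁^4 - 5 * r₁^2 * r₂^2 + 10 * r₂^4) -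
    96 * M₁ * (3 * q * r₁^2 * r₂ - 5 * q * r₂^3 - 4 * r₁^2 * zd + 4 * r₂^2 * zd) +
    3 * q * r₁^6 * r₂ - 14 * q * r₁^4 * r₂^3 + 19 * q * r₁^2 * r₂^5 + 4 * q * r₂^7 -
    4 * r₁^6 * zd + 24 * r₁^4 * r₂^2 * zd - 60 * r₁^2 * r₂^4 * zd + 40 * r₂^6 * zd) -
    24 * r₂^5 * L^2 * (4 * r₂ * (b - zd) * (r₁^4 - r₂^4) + q * (2 * r₁^6 - 7 * r₁^4 * r₂^2 +
    6 * r₁^2 * r₂^4 + r₂^6)) + 96 * q * r₁^2 * r₂^9 * L^3|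

/-- `lim α |q_{α op} - q_op|`. -/
def limQ (r₁ r₂ g b zd M₂ : ℝ) : ℝ :=
  let L := Real.log (r₂ / r₁)
  1 / denQ r₁ r₂ M₂ *
   |(r₂^2 - r₁^2) * (g * (-24 * M₂ * r₁^2 + 3 * r₁^4 * r₂ + 40 * M₂ * r₂^2 - 4 * r₁^2 * r₂^3 +
    r₂^5) - 64 * M₂ * (b - zd)) + 2 * r₂^2 * (g * (-3 * r₁^4 * r₂ + 2 * r₁^2 * r₂^3 + r₂^5 +
    16 * M₂ * (r₁^2 - 2 * r₂^2)) + 16 * r₂ * (r₁^2 - r₂^2) * (b - zd)) * L -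
    4 * r₂^3 * (g * (-3 * r₁^4 + 4 * r₁^2 * r₂^2 + r₂^4) - 8 * (b - zd) * (r₁^2 + r₂^2)) * L^2 +
    16 * g * r₁^2 * r₂^5 * L^3|

/-- `α |b_{α op} - b_op|`, a constant. -/
def limB (r₁ r₂ g q M₃ : ℝ) : ℝ :=
  |(r₁^2 - r₂^2) * (g * (r₁^2 - r₂^2) + 2 * q * r₂) / (2 * r₁ * (-2 * M₃ * r₁ + r₁^2 - r₂^2))|

/-- `lim α |g_α^op - g^op|` for the simultaneous problem. -/
def limG4 (r₁ r₂ b zd M₄ M₅ : ℝ) : ℝ :=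
  let L := Real.log (r₂ / r₁)
  96 * |b - zd| / denP r₁ r₂ M₄ M₅ *
   |-4 * r₂^3 * (r₂^2 - r₁^2)^2 * L * (768 * M₄ * (8 * M₅ * (r₁^2 + 6 * r₂^2) - 3 * r₁^4 * r₂ +
    3 * r₂^5) + 18432 * M₅^2 * r₂^3 + 64 * M₅ * (8 * r₁^6 - 49 * r₁^4 * r₂^2 - 16 * r₁^2 * r₂^4 +
    21 * r₂^6) - 3 * (3 * r₁^8 * r₂ - 65 * r₁^6 * r₂^3 + 49 * r₁^4 * r₂^5 + 17 * r₁^2 * r₂^7 -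
    4 * r₂^9)) - (r₁^2 - r₂^2)^3 * (-3072 * M₄ * (64 * M₅^2 - 14 * M₅ * r₁^2 * r₂ -
    6 * M₅ * r₂^3 + r₁^4 * r₂^2 - r₂^6) + 2048 * M₅^2 * (r₁^4 - 5 * r₁^2 * r₂^2 + 10 * r₂^4) -
    32 * M₅ * (5 * r₁^6 * r₂ - 25 * r₁^4 * r₂^3 + 119 * r₁^2 * r₂^5 - 75 * r₂^7) +
    r₂^2 * (5 * r₁^8 - 10 * r₁^6 * r₂^2 + 156 * r₁^4 * r₂^4 - 182 * r₁^2 * r₂^6 + 31 * r₂^8)) +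
    16 * r₂^3 * (r₁^2 - r₂^2) * L^2 * (192 * M₄ * (32 * M₅ * (2 * r₁^4 - 2 * r₁^2 * r₂^2 - r₂^4) -
    r₂ * (r₁^2 - r₂^2)^2 * (7 * r₁^2 + r₂^2)) - 3072 * M₅^2 * r₂^3 * (r₁^2 + r₂^2) -
    32 * M₅ * (4 * r₁^8 - 12 * r₁^6 * r₂^2 - 53 * r₁^4 * r₂^4 + 3 * r₁^2 * r₂^6 + 4 * r₂^8) +
    5 * r₁^10 * r₂ - 81 * r₁^8 * r₂^3 + 25 * r₁^6 * r₂^5 + 46 * r₁^4 * r₂^7 + 6 * r₁^2 * r₂^9 -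
    r₂^11) - 256 * r₁^4 * r₂^6 * L^4 * (-192 * M₄ * (r₁^2 - r₂^2) + 96 * M₅ * r₂^3 + 2 * r₁^6 +
    r₂^6) - 64 * r₁^2 * r₂^6 * L^3 * (192 * M₄ * (r₁^4 - r₂^4) - r₁^2 * (288 * M₅ * r₂^3 +
    7 * r₂^6) - r₂^5 * (96 * M₅ + r₂^3) + 16 * r₁^8 - 8 * r₁^6 * r₂^2)|

/-- `lim α |q_α^op - q^op|` for the simultaneous problem. -/
def limQ4 (r₁ r₂ b zd M₄ M₅ : ℝ) : ℝ :=
  let L := Real.log (r₂ / r₁)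
  64 * |b - zd| / denP r₁ r₂ M₄ M₅ *
   |2 * (r₁^2 - r₂^2)^3 * (147456 * M₄^2 * M₅ - 24 * M₄ * (64 * M₅ * (5 * r₁^4 - 13 * r₁^2 * r₂^2 +
    2 * r₂^4) - 3 * (9 * r₁^6 * r₂ - 31 * r₁^4 * r₂^3 + 7 * r₁^2 * r₂^5 + 15 * r₂^7)) - (r₁^2 -
    r₂^2) * (8 * M₅ * (r₁^6 - 15 * r₁^4 * r₂^2 + 3 * r₁^2 * r₂^4 + 83 * r₂^6) + 6 * r₁^6 * r₂^3 -
    3 * r₁^4 * r₂^5 - 48 * r₁^2 * r₂^7 + 9 * r₂^9)) + r₂^2 * (r₁^2 -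
    r₂^2)^2 * L * (147456 * M₄^2 * r₂ * (r₁^2 - r₂^2) - 384 * M₄ * (r₁^2 -
    r₂^2) * (48 * M₅ * (3 * r₁^2 - 4 * r₂^2) - 4 * r₁^4 * r₂ + 35 * r₁^2 * r₂^3 + 11 * r₂^5) +
    r₂ * (4 * r₁^6 * (672 * M₅ * r₂ + 151 * r₂^4) - 2 * r₁^4 * (3744 * M₅ * r₂^3 + 209 * r₂^6) +
    26 * r₂^7 * (96 * M₅ + r₂^3) - 23 * r₁^10 - 56 * r₁^8 * r₂^2 - 133 * r₁^2 * r₂^8)) -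
    4 * r₂^3 * (r₁^2 - r₂^2) * L^2 * (-36864 * M₄^2 * (r₁^4 - r₂^4) +
    192 * M₄ * (6 * r₁^4 * (16 * M₅ * r₂ + 3 * r₂^4) - r₁^2 * (96 * M₅ * r₂^3 + 13 * r₂^6) +
    96 * M₅ * r₂^5 + 10 * r₁^8 - 14 * r₁^6 * r₂^2 - r₂^8) - r₁^8 * (192 * M₅ * r₂ + 209 * r₂^4) -
    9 * r₁^6 * (128 * M₅ * r₂^3 - 3 * r₂^6) + r₁^4 * (3840 * M₅ * r₂^5 + 137 * r₂^8) -
    2 * r₂^9 * (96 * M₅ + r₂^3) + 2 * r₁^12 + 25 * r₁^10 * r₂^2 + 20 * r₁^2 * r₂^10) +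
    192 * r₁^4 * r₂^7 * L^4 * (192 * M₄ * (r₂^2 - r₁^2) + 96 * M₅ * r₂^3 + 2 * r₁^6 + r₂^6) -
    48 * r₁^2 * r₂^5 * L^3 * (192 * M₄ * (r₁^2 - r₂^2)^2 * (3 * r₁^2 + r₂^2) +
    r₂^2 * (-3 * r₁^4 * (96 * M₅ * r₂ + r₂^4) + 8 * r₁^2 * (48 * M₅ * r₂^3 + r₂^6) +
    96 * M₅ * r₂^5 - 14 * r₁^8 + 8 * r₁^6 * r₂^2 + r₂^8))|

/-- `lim α |J_{1α}(g_{α op}) - J₁(g_op)|`. -/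
def limJ1 (r₁ r₂ q b zd M₁ : ℝ) : ℝ :=
  let L := Real.log (r₂ / r₁)
  Real.pi / (16 * denG r₁ r₂ M₁) *
   |(12 * b * r₁^6 - 60 * b * r₁^4 * r₂^2 + 84 * b * r₁^2 * r₂^4 - 48 * b * r₁^2 * r₂^4 * L +
    48 * b * r₂^6 * L - 36 * b * r₂^6 - 192 * M₁ * q * r₁^2 * r₂ + 192 * M₁ * q * r₂^3 +
    5 * q * r₁^6 * r₂ - 15 * q * r₁^4 * r₂^3 + 24 * q * r₁^4 * r₂^3 * L + 3 * q * r₁^2 * r₂^5 +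
    48 * q * r₁^2 * r₂^5 * L^2 - 36 * q * r₁^2 * r₂^5 * L - 12 * q * r₂^7 * L + 7 * q * r₂^7 -
    12 * r₁^6 * zd + 60 * r₁^4 * r₂^2 * zd - 84 * r₁^2 * r₂^4 * zd + 48 * r₁^2 * r₂^4 * zd * L -
    48 * r₂^6 * zd * L + 36 * r₂^6 * zd) *
    (-768 * M₁ * q * r₂^5 * L - 1536 * b * M₁ * r₁^2 * r₂^2 + 768 * b * M₁ * r₂^4 + 4 * b * r₁^8 -
    40 * b * r₁^6 * r₂^2 + 96 * b * r₁^4 * r₂^4 - 96 * b * r₁^4 * r₂^4 * L -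
    88 * b * r₁^2 * r₂^6 - 192 * b * r₁^2 * r₂^6 * L^2 + 96 * b * r₁^2 * r₂^6 * L +
    28 * b * r₂^8 + 384 * M₁ * q * r₁^4 * r₂ - 768 * M₁ * q * r₁^2 * r₂^3 +
    768 * M₁ * q * r₁^2 * r₂^3 * L + 768 * b * M₁ * r₁^4 + 384 * M₁ * q * r₂^5 -
    768 * M₁ * r₁^4 * zd + 1536 * M₁ * r₁^2 * r₂^2 * zd - 768 * M₁ * r₂^4 * zd - q * r₁^8 * r₂ +
    4 * q * r₁^6 * r₂^3 - 8 * q * r₁^6 * r₂^3 * L - 18 * q * r₁^4 * r₂^5 -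
    48 * q * r₁^4 * r₂^5 * L^2 - 24 * q * r₁^4 * r₂^5 * L + 28 * q * r₁^2 * r₂^7 +
    24 * q * r₁^2 * r₂^7 * L + 8 * q * r₂^9 * L - 13 * q * r₂^9 - 4 * r₁^8 * zd +
    40 * r₁^6 * r₂^2 * zd - 96 * r₁^4 * r₂^4 * zd + 96 * r₁^4 * r₂^4 * zd * L +
    88 * r₁^2 * r₂^6 * zd + 192 * r₁^2 * r₂^6 * zd * L^2 - 96 * r₁^2 * r₂^6 * zd * L -
    28 * r₂^8 * zd)|

/-- `lim α |J_{2α}(q_{α op}) - J₂(q_op)|`. -/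
def limJ2 (r₁ r₂ g b zd M₂ : ℝ) : ℝ :=
  let L := Real.log (r₂ / r₁)
  Real.pi / (512 * r₁ * (4 * M₂ - r₁^2 * r₂ + 2 * r₂^3 * L^2 - 2 * r₂^3 * L + r₂^3)^2) *
   |(16 * b * r₁^2 * r₂ + 32 * b * r₂^3 * L - 16 * b * r₂^3 + 32 * g * M₂ * r₁^2 -
    32 * g * M₂ * r₂^2 - 5 * g * r₁^4 * r₂ + 4 * g * r₁^2 * r₂^3 + 16 * g * r₁^2 * r₂^3 * L^2 -
    8 * g * r₁^2 * r₂^3 * L - 4 * g * r₂^5 * L + g * r₂^5 - 16 * r₁^2 * r₂ * zd -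
    32 * r₂^3 * zd * L + 16 * r₂^3 * zd) *
    (128 * b * M₂ * r₁^2 - 128 * b * M₂ * r₂^2 - 16 * b * r₁^4 * r₂ + 32 * b * r₁^2 * r₂^3 +
    64 * b * r₁^2 * r₂^3 * L^2 - 16 * b * r₂^5 + 16 * g * M₂ * r₁^4 - 64 * g * M₂ * r₁^2 * r₂^2 -
    64 * g * M₂ * r₂^4 * L + 48 * g * M₂ * r₂^4 - g * r₁^6 * r₂ + 5 * g * r₁^4 * r₂^3 +
    8 * g * r₁^4 * r₂^3 * L^2 + 6 * g * r₁^4 * r₂^3 * L - 7 * g * r₁^2 * r₂^5 -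
    4 * g * r₁^2 * r₂^5 * L - 2 * g * r₂^7 * L + 3 * g * r₂^7 - 128 * M₂ * r₁^2 * zd +
    128 * M₂ * r₂^2 * zd + 16 * r₁^4 * r₂ * zd - 32 * r₁^2 * r₂^3 * zd -
    64 * r₁^2 * r₂^3 * zd * L^2 + 16 * r₂^5 * zd)|

/-- `lim α |J_{3α}(b_{α op}) - J₃(b_op)|`. -/
def limJ3 (r₁ r₂ g q zd M₃ : ℝ) : ℝ :=
  let L := Real.log (r₂ / r₁)
  Real.pi * |M₃ * (g * (r₁^2 - r₂^2) + 2 * q * r₂)| /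
    |8 * r₁ * (-2 * M₃ * r₁ + r₁^2 - r₂^2)| *
    |g * r₁^3 * (r₁^2 - r₂^2) + 4 * q * r₁ * r₂ * (r₁^2 - r₂^2) - 3 * g * r₁ * r₂^2 * (r₁^2 - r₂^2) -
    8 * r₁ * (r₁^2 - r₂^2) * zd - 4 * r₁ * r₂^3 * (-2 * q + g * r₂) * L|

/-- Squared denominator in the limit constant of the simultaneous optimal value. -/
def denJ4 (r₁ r₂ M₄ M₅ : ℝ) : ℝ :=
  let L := Real.log (r₂ / r₁)
  r₁ * (6144 * M₄ * M₅ * r₁^2 - 6144 * M₄ * M₅ * r₂^2 - 1536 * M₄ * r₁^4 * r₂ +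
  3072 * M₄ * r₁^2 * r₂^3 + 3072 * M₄ * r₁^2 * r₂^3 * L^2 - 3072 * M₄ * r₁^2 * r₂^3 * L -
  3072 * M₄ * r₂^5 * L^2 + 3072 * M₄ * r₂^5 * L - 1536 * M₄ * r₂^5 + 128 * M₅ * r₁^6 -
  960 * M₅ * r₁^4 * r₂^2 + 1920 * M₅ * r₁^2 * r₂^4 - 1536 * M₅ * r₁^2 * r₂^4 * L -
  1536 * M₅ * r₂^6 * L^2 + 2304 * M₅ * r₂^6 * L - 1088 * M₅ * r₂^6 - 5 * r₁^8 * r₂ +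
  56 * r₁^6 * r₂^3 + 64 * r₁^6 * r₂^3 * L^2 + 80 * r₁^6 * r₂^3 * L - 126 * r₁^4 * r₂^5 -
  72 * r₁^4 * r₂^5 * L + 104 * r₁^2 * r₂^7 - 48 * r₁^2 * r₂^7 * L - 16 * r₂^9 * L^2 +
  40 * r₂^9 * L - 29 * r₂^9)^2

/-- `lim α |J_{4α}((g,q)_{α op}) - J₄((g,q)_op)|`. -/
def limJ4 (r₁ r₂ b zd M₄ M₅ : ℝ) : ℝ :=
  let L := Real.log (r₂ / r₁)
  4 * Real.pi * (b - zd) ^ 2 / denJ4 r₁ r₂ M₄ M₅ *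
   |(-384 * M₄ * r₁^4 * r₂ + 768 * M₄ * r₁^2 * r₂^3 - 768 * M₄ * r₁^2 * r₂^3 * L +
    768 * M₄ * r₂^5 * L - 384 * M₄ * r₂^5 + 96 * M₅ * r₁^6 - 480 * M₅ * r₁^4 * r₂^2 +
    672 * M₅ * r₁^2 * r₂^4 - 384 * M₅ * r₁^2 * r₂^4 * L + 384 * M₅ * r₂^6 * L - 288 * M₅ * r₂^6 -
    5 * r₁^8 * r₂ + 32 * r₁^6 * r₂^3 + 48 * r₁^6 * r₂^3 * L^2 + 44 * r₁^6 * r₂^3 * L -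
    54 * r₁^4 * r₂^5 - 36 * r₁^4 * r₂^5 * L + 32 * r₁^2 * r₂^7 - 12 * r₁^2 * r₂^7 * L +
    4 * r₂^9 * L - 5 * r₂^9) *
    (6144 * M₄ * M₅ * r₁^4 - 12288 * M₄ * M₅ * r₁^2 * r₂^2 + 6144 * M₄ * M₅ * r₂^4 -
    768 * M₄ * r₁^6 * r₂ + 2304 * M₄ * r₁^4 * r₂^3 + 3072 * M₄ * r₁^4 * r₂^3 * L^2 -
    2304 * M₄ * r₁^2 * r₂^5 - 3072 * M₄ * r₁^2 * r₂^5 * L^2 + 768 * M₄ * r₂^7 + 32 * M₅ * r₁^8 -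
    320 * M₅ * r₁^6 * r₂^2 + 768 * M₅ * r₁^4 * r₂^4 - 768 * M₅ * r₁^4 * r₂^4 * L -
    704 * M₅ * r₁^2 * r₂^6 - 1536 * M₅ * r₁^2 * r₂^6 * L^2 + 768 * M₅ * r₁^2 * r₂^6 * L +
    224 * M₅ * r₂^8 - r₁^10 * r₂ + 17 * r₁^8 * r₂^3 + 16 * r₁^8 * r₂^3 * L^2 +
    24 * r₁^8 * r₂^3 * L - 46 * r₁^6 * r₂^5 - 24 * r₁^6 * r₂^5 * L + 46 * r₁^4 * r₂^7 -
    24 * r₁^4 * r₂^7 * L - 17 * r₁^2 * r₂^9 - 16 * r₁^2 * r₂^9 * L^2 + 24 * r₁^2 * r₂^9 * L +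
    r₂^11)|

end AnnulusControl

end

open AnnulusControl

namespace AnnulusControl

/-! ## Second derivatives along lines -/

/-! The data are constant and the annulus is rotation invariant, so each problem has a radial
solution `c + B log(|x|/r₁) + k(|x|² - r₁²)`. The Poisson equation fixes `k`, the outer flux fixes
`B`, and the condition on the inner circle fixes `c`. Problems `S` and `S_α` differ only in `c`,
which is affine in `ε = 1/α`, with `ε = 0` for `S`; the two families are therefore treated together
(`radialState`, `coeffs`). Uniqueness is a maximum principle for the difference of two solutions:
adding a small strictly subharmonic function with negative outer flux forces the maximum onto the
inner circle (`exists_isMaxOn_inner`), where the Dirichlet or Robin condition bounds it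
(`le_of_inner_bound`).

In polar coordinates the state cost becomes an elementary integral, a quadratic form in `g`, `q`, `b
- zd` whose coefficients are polynomials in `ε` of degree at most two (`half_normSqH_radialState`).
Each functional is then a quadratic polynomial in its control, minimized by completing the square.
The required positivity is not read off the formulas with logarithms: the form is a squared norm,
hence nonnegative, and the control costs make it definite.

The optimal controls and values are rational in `ε` with denominators that do not vanish at `0`. So
`α |x_α - l|` is the absolute value of a difference quotient at `0` and tends to the absolute value
of the derivative (`convergesWithRate_of_hasDerivAt`). The limit constants are thus derivatives at
`ε = 0`, compared with the stated formulas by polynomial identities in which the logarithm is an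
indeterminate. For the simultaneous problem two facts keep the algebra small. By optimality the
derivative of the optimal value is that of the form alone, with the control frozen. Moreover `∂u/∂ε`
is a constant function, so the derivative of `½‖u - z_d‖²` is this constant times `∫ (u - z_d)`, a
product of two linear forms (`coeffsDeriv_form_eq`). -/

theorem deriv_deriv_comp_line {E : Type*} [NormedAddCommGroup E] [NormedSpace ℝ E]
    {f : E → ℝ} {x : E} (hf : ContDiffAt ℝ 2 f x) (v : E) :
    deriv (deriv fun t : ℝ => f (x + t • v)) 0 = iteratedFDeriv ℝ 2 f x ![v, v] := by
  have hline (t : ℝ) : HasDerivAt (fun t : ℝ => x + t • v) v t := by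
    simpa using ((hasDerivAt_id t).smul_const v).const_add x
  have hx : x + (0 : ℝ) • v = x := by simp
  have hcont : Tendsto (fun t : ℝ => x + t • v) (𝓝 0) (𝓝 x) := by
    have := (hline 0).continuousAt.tendsto
    rwa [hx] at this
  -- The first derivative is needed on a whole neighbourhood of `0`, since it is differentiated
  -- again.
  have hev : (deriv fun t : ℝ => f (x + t • v)) =ᶠ[𝓝 0]
      fun t : ℝ => fderiv ℝ f (x + t • v) v := by
    have h1 : ∀ᶠ y in 𝓝 x, ContDiffAt ℝ 2 f y := hf.eventually (by simp)
    filter_upwards [hcont.eventually h1] with t ht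
    exact ((ht.differentiableAt (by simp)).hasFDerivAt.comp_hasDerivAt t (hline t)).deriv
  rw [hev.deriv_eq, iteratedFDeriv_two_apply]
  have h2 : DifferentiableAt ℝ (fderiv ℝ f) (x + (0 : ℝ) • v) := by
    rw [hx]
    exact (hf.fderiv_right (m := 1) (by norm_num)).differentiableAt (by simp)
  have h3 := h2.hasFDerivAt.comp_hasDerivAt (0 : ℝ) (hline 0)
  have h4 := (h3.clm_apply (hasDerivAt_const (0 : ℝ) v)).deriv
  rw [hx] at h4
  simpa using h4

/-- A positive second derivative would make `t` a local minimum as well, so `φ` would be constant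
near `t` and its second derivative zero. No differentiability is assumed: `deriv` is `0` where no
derivative exists. -/
theorem deriv_deriv_nonpos_of_isLocalMax {φ : ℝ → ℝ} {t : ℝ} (hφ : IsLocalMax φ t)
    (hc : ContinuousAt φ t) : deriv (deriv φ) t ≤ 0 := by
  by_contra! h
  have hmin := isLocalMin_of_deriv_deriv_pos h hφ.deriv_eq_zero hc
  have hconst : φ =ᶠ[𝓝 t] fun _ => φ t := by
    filter_upwards [hφ, hmin] with s h1 h2 using le_antisymm h1 h2
  have : deriv (deriv φ) t = 0 := by
    rw [hconst.deriv.deriv_eq]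
    simp
  linarith

theorem laplacian_nonpos_of_isLocalMax {f : Plane → ℝ} {x : Plane} (hf : ContDiffAt ℝ 2 f x)
    (hmax : IsLocalMax f x) : Laplacian.laplacian f x ≤ 0 := by
  rw [InnerProductSpace.laplacian_eq_iteratedFDeriv_stdOrthonormalBasis]
  refine Finset.sum_nonpos fun i _ => ?_
  rw [← deriv_deriv_comp_line hf]
  set v := stdOrthonormalBasis ℝ Plane i
  have hc : ContinuousAt (fun t : ℝ => x + t • v) 0 := by fun_prop
  refine deriv_deriv_nonpos_of_isLocalMax ?_ ?_
  · have hc' := hc.tendsto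
    simp only [zero_smul, add_zero] at hc'
    have := hc'.eventually hmax
    simpa [IsLocalMax, IsMaxFilter] using this
  · exact ContinuousAt.comp (g := f) (by simpa using hf.continuousAt) hc

/-! ## Radial functions -/

/-- The radial function `c + B log (|x| / ρ) + k (|x|² - ρ²)`. -/
noncomputable def radial (ρ c B k : ℝ) (x : Plane) : ℝ :=
  c + B * Real.log (‖x‖ / ρ) + k * (‖x‖ ^ 2 - ρ ^ 2)

theorem contDiffAt_radial {ρ : ℝ} (hρ : ρ ≠ 0) (c B k : ℝ) {x : Plane} (hx : x ≠ 0) :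
    ContDiffAt ℝ 2 (radial ρ c B k) x := by
  have h1 : ContDiffAt ℝ 2 (fun x : Plane => ‖x‖) x := contDiffAt_norm ℝ hx
  have h2 : ‖x‖ / ρ ≠ 0 := div_ne_zero (norm_ne_zero_iff.2 hx) hρ
  exact (contDiffAt_const.add (contDiffAt_const.mul ((h1.div_const ρ).log h2))).add
    (contDiffAt_const.mul ((h1.pow 2).sub contDiffAt_const))

/-- With `S = |x|²` and `y` a coordinate of `x`, the quadratic is `|x + t e|²` for the corresponding
basis vector `e`. The factor `B / 2` appears because `log |x| = ½ log |x|²`. -/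
theorem deriv_deriv_log_quadratic (a B k S y : ℝ) (hS : 0 < S) :
    deriv (deriv fun t : ℝ => a + B / 2 * Real.log (S + 2 * t * y + t ^ 2) +
      k * (S + 2 * t * y + t ^ 2)) 0 = B * (1 / S - 2 * y ^ 2 / S ^ 2) + 2 * k := by
  have hq (t : ℝ) : HasDerivAt (fun t : ℝ => S + 2 * t * y + t ^ 2) (2 * y + 2 * t) t := by
    refine (((((hasDerivAt_id t).const_mul 2).mul_const y).const_add S).add
      ((hasDerivAt_id t).pow 2)).congr_deriv ?_
    simp
  have hpos : ∀ᶠ t in 𝓝 (0 : ℝ), 0 < S + 2 * t * y + t ^ 2 := by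
    have : Tendsto (fun t : ℝ => S + 2 * t * y + t ^ 2) (𝓝 0) (𝓝 S) := by
      simpa using (hq 0).continuousAt.tendsto
    exact this.eventually (lt_mem_nhds hS)
  have hev : (deriv fun t : ℝ => a + B / 2 * Real.log (S + 2 * t * y + t ^ 2) +
      k * (S + 2 * t * y + t ^ 2)) =ᶠ[𝓝 0]
      fun t => B / 2 * ((2 * y + 2 * t) / (S + 2 * t * y + t ^ 2)) + k * (2 * y + 2 * t) := by
    filter_upwards [hpos] with t ht
    exact (((((hq t).log ht.ne').const_mul (B / 2)).const_add a).add ((hq t).const_mul k)).deriv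
  have hl : HasDerivAt (fun t : ℝ => 2 * y + 2 * t) 2 0 := by
    simpa using ((hasDerivAt_id (0 : ℝ)).const_mul 2).const_add (2 * y)
  have hne : S + 2 * (0 : ℝ) * y + 0 ^ 2 ≠ 0 := by simpa using hS.ne'
  rw [hev.deriv_eq]
  refine (((hl.div (hq 0) hne).const_mul (B / 2)).add (hl.const_mul k)).deriv.trans ?_
  simp
  field_simp

/-- Summed over the two coordinates, the logarithmic terms give `B (2/|x|² - 2|x|²/|x|⁴) = 0`: the
logarithm is harmonic in the plane, and only the quadratic part contributes. -/
theorem laplacian_radial {ρ : ℝ} (hρ : 0 < ρ) (c B k : ℝ) {x : Plane} (hx : x ≠ 0) :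
    Laplacian.laplacian (radial ρ c B k) x = 4 * k := by
  have hcd := contDiffAt_radial hρ.ne' c B k hx
  have hS : 0 < ‖x‖ ^ 2 := by positivity
  rw [InnerProductSpace.laplacian_eq_iteratedFDeriv_orthonormalBasis _
    (EuclideanSpace.basisFun (Fin 2) ℝ)]
  have key (i : Fin 2) : iteratedFDeriv ℝ 2 (radial ρ c B k) x
      ![EuclideanSpace.basisFun (Fin 2) ℝ i, EuclideanSpace.basisFun (Fin 2) ℝ i] =
      B * (1 / ‖x‖ ^ 2 - 2 * (x i) ^ 2 / (‖x‖ ^ 2) ^ 2) + 2 * k := by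
    -- The additive constant collects the normalizations `-B log ρ` and `-k ρ²` of `radial`.
    rw [← deriv_deriv_comp_line hcd, ← deriv_deriv_log_quadratic
      (c - B * Real.log ρ - k * ρ ^ 2) B k (‖x‖ ^ 2) (x i) hS]
    have hn (t : ℝ) : ‖x + t • EuclideanSpace.basisFun (Fin 2) ℝ i‖ ^ 2 =
        ‖x‖ ^ 2 + 2 * t * x i + t ^ 2 := by
      rw [norm_add_sq_real, inner_smul_right, norm_smul, real_inner_comm,
        OrthonormalBasis.norm_eq_one]
      simp [EuclideanSpace.inner_single_left]
      ring
    have hev : (fun t : ℝ => radial ρ c B k (x + t • EuclideanSpace.basisFun (Fin 2) ℝ i))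
        =ᶠ[𝓝 0] fun t : ℝ => c - B * Real.log ρ - k * ρ ^ 2 +
          B / 2 * Real.log (‖x‖ ^ 2 + 2 * t * x i + t ^ 2) +
          k * (‖x‖ ^ 2 + 2 * t * x i + t ^ 2) := by
      have hc : Tendsto (fun t : ℝ => x + t • EuclideanSpace.basisFun (Fin 2) ℝ i) (𝓝 0)
          (𝓝 x) := by
        have : ContinuousAt (fun t : ℝ => x + t • EuclideanSpace.basisFun (Fin 2) ℝ i) 0 := by
          fun_prop
        simpa using this.tendsto
      filter_upwards [hc.eventually (isOpen_ne.mem_nhds hx)] with t ht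
      rw [← hn, Real.log_pow, radial, Real.log_div (norm_ne_zero_iff.2 ht) hρ.ne']
      push_cast
      ring
    exact hev.deriv.deriv_eq
  simp only [key, Fin.sum_univ_two]
  have hx2 : ‖x‖ ^ 2 = x 0 ^ 2 + x 1 ^ 2 := by
    simp [EuclideanSpace.norm_sq_eq, Fin.sum_univ_two]
  rw [hx2] at hS ⊢
  field_simp
  ring

/-- The point is the multiple `(r + sσ)/r` of `x`. The sign `σ = 1` gives the outward normal on the
outer circle, `σ = -1` that on the inner one. -/
theorem norm_add_smul_normal {r σ s : ℝ} (hr : 0 < r) {x : Plane} (hx : ‖x‖ = r)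
    (hs : 0 ≤ r + s * σ) : ‖x + s • (σ • (r⁻¹ • x))‖ = r + s * σ := by
  have h1 : x + s • (σ • (r⁻¹ • x)) = ((r + s * σ) / r) • x := by
    rw [smul_smul, smul_smul, ← one_smul ℝ x, smul_smul, smul_smul, ← add_smul]
    congr 1
    field_simp
  rw [h1, norm_smul, hx, Real.norm_of_nonneg (by positivity)]
  field_simp

/-- The derivative of `radial` in the radial direction `σ x / |x|`. -/
theorem hasNormalDeriv_radial {ρ : ℝ} (hρ : 0 < ρ) (c B k σ : ℝ) {r : ℝ} (hr : 0 < r) {x : Plane}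
    (hx : ‖x‖ = r) :
    HasNormalDeriv (radial ρ c B k) x (σ • (r⁻¹ • x)) (σ * (B / r + 2 * k * r)) := by
  have hev : (fun s : ℝ => radial ρ c B k (x + s • (σ • (r⁻¹ • x)))) =ᶠ[𝓝 0]
      fun s => c + B * Real.log ((r + s * σ) / ρ) + k * ((r + s * σ) ^ 2 - ρ ^ 2) := by
    have : Tendsto (fun s : ℝ => r + s * σ) (𝓝 0) (𝓝 r) := by
      have h : ContinuousAt (fun s : ℝ => r + s * σ) 0 := by fun_prop
      simpa using h.tendsto
    filter_upwards [this.eventually (lt_mem_nhds hr)] with s hs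
    rw [radial, norm_add_smul_normal hr hx hs.le]
  have hl : HasDerivAt (fun s : ℝ => r + s * σ) σ 0 := by
    simpa using ((hasDerivAt_id (0 : ℝ)).mul_const σ).const_add r
  have hne : (r + 0 * σ) / ρ ≠ 0 := by
    rw [zero_mul, add_zero]; positivity
  have hd := ((((hl.div_const ρ).log hne).const_mul B).const_add c).add
    (((hl.pow 2).sub_const (ρ ^ 2)).const_mul k)
  refine ((hd.congr_of_eventuallyEq hev).congr_deriv ?_).hasDerivWithinAt
  simp
  field_simp

/-! ## The maximum principle and uniqueness of the states -/

/-- To the left of `0` both the increment of `φ` and that of its argument are nonpositive, so the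
slopes are nonnegative. -/
theorem nonneg_of_hasDerivWithinAt_Iic {φ : ℝ → ℝ} {d : ℝ}
    (h : HasDerivWithinAt φ d (Set.Iic 0) 0) (hmax : ∀ᶠ s in 𝓝[<] (0 : ℝ), φ s ≤ φ 0) :
    0 ≤ d := by
  have h1 := h.Iio_of_Iic
  rw [hasDerivWithinAt_iff_tendsto_slope' (by simp)] at h1
  refine ge_of_tendsto h1 ?_
  filter_upwards [hmax, self_mem_nhdsWithin] with s hs hs0
  rw [slope_def_field]
  exact div_nonneg_of_nonpos (by linarith) (by simpa using le_of_lt hs0)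

theorem HasNormalDeriv.add {u v : Plane → ℝ} {x ν : Plane} {d e : ℝ}
    (hu : HasNormalDeriv u x ν d) (hv : HasNormalDeriv v x ν e) :
    HasNormalDeriv (u + v) x ν (d + e) :=
  HasDerivWithinAt.add hu hv

theorem HasNormalDeriv.sub {u v : Plane → ℝ} {x ν : Plane} {d e : ℝ}
    (hu : HasNormalDeriv u x ν d) (hv : HasNormalDeriv v x ν e) :
    HasNormalDeriv (u - v) x ν (d - e) :=
  HasDerivWithinAt.sub hu hv

theorem isOpen_annulus (r₁ r₂ : ℝ) : IsOpen (annulus r₁ r₂) :=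
  (isOpen_lt continuous_const continuous_norm).inter (isOpen_lt continuous_norm continuous_const)

theorem isCompact_closedAnnulus (r₁ r₂ : ℝ) : IsCompact (closedAnnulus r₁ r₂) := by
  refine (isCompact_closedBall (0 : Plane) r₂).of_isClosed_subset
    ((isClosed_le continuous_const continuous_norm).inter
      (isClosed_le continuous_norm continuous_const)) fun x hx => ?_
  simpa using hx.2

theorem annulus_subset_closedAnnulus (r₁ r₂ : ℝ) : annulus r₁ r₂ ⊆ closedAnnulus r₁ r₂ :=
  fun _ hx => ⟨hx.1.le, hx.2.le⟩

theorem ne_zero_of_mem_closedAnnulus {r₁ r₂ : ℝ} (hr₁ : 0 < r₁) {x : Plane}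
    (hx : x ∈ closedAnnulus r₁ r₂) : x ≠ 0 :=
  norm_pos_iff.1 (hr₁.trans_le hx.1)

theorem closedAnnulus_nonempty {r₁ r₂ : ℝ} (hr₁ : 0 < r₁) (hr₂ : r₁ < r₂) :
    (closedAnnulus r₁ r₂).Nonempty := by
  refine ⟨EuclideanSpace.single 0 r₁, ?_⟩
  simp [closedAnnulus, abs_of_pos hr₁, hr₂.le]

/-- First-order condition at a boundary maximum. The hypothesis `hmem` says that the segment going
inwards from `x` stays in the closed annulus. -/
theorem nonneg_of_hasNormalDeriv_of_max {r₁ r₂ r σ d : ℝ} (hr : 0 < r)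
    {z : Plane → ℝ} {x : Plane} (hx : ‖x‖ = r)
    (hmem : ∀ᶠ s in 𝓝[<] (0 : ℝ), r₁ ≤ r + s * σ ∧ r + s * σ ≤ r₂)
    (hmax : IsMaxOn z (closedAnnulus r₁ r₂) x)
    (hd : HasNormalDeriv z x (σ • (r⁻¹ • x)) d) : 0 ≤ d := by
  refine nonneg_of_hasDerivWithinAt_Iic hd ?_
  have hpos : ∀ᶠ s in 𝓝[<] (0 : ℝ), 0 ≤ r + s * σ := by
    have : Tendsto (fun s : ℝ => r + s * σ) (𝓝 0) (𝓝 r) := by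
      have h : ContinuousAt (fun s : ℝ => r + s * σ) 0 := by fun_prop
      simpa using h.tendsto
    filter_upwards [nhdsWithin_le_nhds (this.eventually (lt_mem_nhds hr))] with s hs using hs.le
  filter_upwards [hmem, hpos] with s hs hs'
  have : x + s • (σ • (r⁻¹ • x)) ∈ closedAnnulus r₁ r₂ := by
    simpa [closedAnnulus, norm_add_smul_normal hr hx hs'] using hs
  simpa using hmax this

theorem eventually_mem_Icc_of_pos {a b : ℝ} (hab : a < b) :
    ∀ᶠ s in 𝓝[<] (0 : ℝ), a ≤ b + s * 1 ∧ b + s * 1 ≤ b := by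
  have h : Set.Ioo (a - b) 0 ∈ 𝓝[<] (0 : ℝ) := Ioo_mem_nhdsLT (by linarith)
  filter_upwards [h] with s hs
  constructor <;> linarith [hs.1, hs.2]

theorem eventually_mem_Icc_of_neg {a b : ℝ} (hab : a < b) :
    ∀ᶠ s in 𝓝[<] (0 : ℝ), a ≤ a + s * (-1) ∧ a + s * (-1) ≤ b := by
  have h : Set.Ioo (a - b) 0 ∈ 𝓝[<] (0 : ℝ) := Ioo_mem_nhdsLT (by linarith)
  filter_upwards [h] with s hs
  constructor <;> linarith [hs.1, hs.2]

/-- A harmonic function whose flux through the outer circle vanishes attains its maximum,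
after a small strictly subharmonic correction, on the inner circle. -/
theorem exists_isMaxOn_inner {r₁ r₂ : ℝ} (hr₁ : 0 < r₁) (hr₂ : r₁ < r₂) {w : Plane → ℝ}
    (hC : ContDiffOn ℝ 2 w (annulus r₁ r₂)) (hc : ContinuousOn w (closedAnnulus r₁ r₂))
    (hΔ : ∀ x ∈ annulus r₁ r₂, Laplacian.laplacian w x = 0)
    (hflux : ∀ x : Plane, ‖x‖ = r₂ → HasNormalDeriv w x (r₂⁻¹ • x) 0) {ε : ℝ} (hε : 0 < ε) :
    ∃ x, ‖x‖ = r₁ ∧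
      IsMaxOn (w + radial r₁ 0 (-(4 * r₂ ^ 2 * ε)) ε) (closedAnnulus r₁ r₂) x := by
  -- The correction vanishes on the inner circle and has Laplacian `4ε > 0`, which excludes an
  -- interior maximum. The coefficient `-4 r₂² ε` of the logarithm makes its outward derivative on
  -- the outer circle `-4 r₂ ε + 2 r₂ ε = -2 r₂ ε < 0`, which excludes a maximum there.
  set k := radial r₁ 0 (-(4 * r₂ ^ 2 * ε)) ε
  have hkC : ContinuousOn k (closedAnnulus r₁ r₂) := fun x hx =>
    (contDiffAt_radial hr₁.ne' _ _ _
      (ne_zero_of_mem_closedAnnulus hr₁ hx)).continuousAt.continuousWithinAt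
  obtain ⟨x, hx, hmax⟩ := (isCompact_closedAnnulus r₁ r₂).exists_isMaxOn
    (closedAnnulus_nonempty hr₁ hr₂) (hc.add hkC)
  refine ⟨x, ?_, hmax⟩
  have hx0 := ne_zero_of_mem_closedAnnulus hr₁ hx
  by_contra h1
  by_cases h2 : ‖x‖ = r₂
  · have hr₂' := hr₁.trans hr₂
    have hd := (hflux x h2).add (by
      simpa using hasNormalDeriv_radial hr₁ 0 (-(4 * r₂ ^ 2 * ε)) ε 1 hr₂' h2 :
        HasNormalDeriv k x (r₂⁻¹ • x) (-(4 * r₂ ^ 2 * ε) / r₂ + 2 * ε * r₂))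
    have := nonneg_of_hasNormalDeriv_of_max (σ := 1) hr₂' h2 (eventually_mem_Icc_of_pos hr₂) hmax
      (by simpa only [one_smul] using hd)
    rw [zero_add] at this
    have h3 : -(4 * r₂ ^ 2 * ε) / r₂ + 2 * ε * r₂ = -(2 * ε * r₂) := by
      field_simp
      ring
    have h4 : 0 < 2 * ε * r₂ := by positivity
    linarith
  · have hxa : x ∈ annulus r₁ r₂ :=
      ⟨lt_of_le_of_ne hx.1 (Ne.symm h1), lt_of_le_of_ne hx.2 h2⟩
    have hnhds := (isOpen_annulus r₁ r₂).mem_nhds hxa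
    have hw := hC.contDiffAt hnhds
    have hk : ContDiffAt ℝ 2 k x := contDiffAt_radial hr₁.ne' _ _ _ hx0
    have hle := laplacian_nonpos_of_isLocalMax (f := w + k) (hw.add hk)
      (hmax.isLocalMax (mem_of_superset hnhds (annulus_subset_closedAnnulus r₁ r₂)))
    rw [hw.laplacian_add hk, hΔ x hxa, laplacian_radial hr₁ _ _ _ hx0] at hle
    linarith

theorem nonpos_of_forall_le_mul {a C : ℝ} (h : ∀ ε > 0, a ≤ ε * C) : a ≤ 0 := by
  have h1 : Tendsto (fun ε : ℝ => ε * C) (𝓝[>] 0) (𝓝 0) := by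
    have : ContinuousAt (fun ε : ℝ => ε * C) 0 := by fun_prop
    simpa using this.tendsto.mono_left nhdsWithin_le_nhds
  refine ge_of_tendsto h1 ?_
  filter_upwards [self_mem_nhdsWithin] with ε hε using h ε hε

theorem radial_smul (ρ B k ε : ℝ) (x : Plane) :
    radial ρ 0 (B * ε) (k * ε) x = ε * radial ρ 0 B k x := by
  simp only [radial]
  ring

theorem radial_of_norm_eq {ρ : ℝ} (hρ : 0 < ρ) (c B k : ℝ) {x : Plane} (hx : ‖x‖ = ρ) :
    radial ρ c B k x = c := by
  simp [radial, hx, hρ.ne']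

/-- Comparison of two functions with the same Laplacian and the same flux through the outer circle:
it suffices that at a maximum point of the corrected difference on the inner circle the difference
is at most `ε * K`. -/
theorem le_of_inner_bound {r₁ r₂ : ℝ} (hr₁ : 0 < r₁) (hr₂ : r₁ < r₂) {g q : ℝ} {u v : Plane → ℝ}
    (hu : ContDiffOn ℝ 2 u (annulus r₁ r₂)) (hv : ContDiffOn ℝ 2 v (annulus r₁ r₂))
    (huc : ContinuousOn u (closedAnnulus r₁ r₂)) (hvc : ContinuousOn v (closedAnnulus r₁ r₂))
    (huΔ : ∀ x ∈ annulus r₁ r₂, -(Laplacian.laplacian u x) = g)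
    (hvΔ : ∀ x ∈ annulus r₁ r₂, -(Laplacian.laplacian v x) = g)
    (huf : ∀ x : Plane, ‖x‖ = r₂ → HasNormalDeriv u x (r₂⁻¹ • x) (-q))
    (hvf : ∀ x : Plane, ‖x‖ = r₂ → HasNormalDeriv v x (r₂⁻¹ • x) (-q)) (K : ℝ)
    (hK : ∀ ε > 0, ∀ x : Plane, ‖x‖ = r₁ →
      IsMaxOn ((v - u) + radial r₁ 0 (-(4 * r₂ ^ 2 * ε)) ε) (closedAnnulus r₁ r₂) x →
      v x - u x ≤ ε * K) {x : Plane} (hx : x ∈ closedAnnulus r₁ r₂) : v x ≤ u x := by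
  have key : v x - u x ≤ 0 := by
    -- The correction is `ε` times a fixed function and is zero at the inner maximum point, so
    -- comparing `x` with that point gives `v x - u x + ε radial ≤ ε K`; then `ε → 0`.
    refine nonpos_of_forall_le_mul (C := K - radial r₁ 0 (-(4 * r₂ ^ 2)) 1 x) fun ε hε => ?_
    obtain ⟨y, hy, hmax⟩ := exists_isMaxOn_inner hr₁ hr₂ (w := v - u) (hv.sub hu) (hvc.sub huc)
      (fun z hz => by
        have hnhds := (isOpen_annulus r₁ r₂).mem_nhds hz
        rw [(hv.contDiffAt hnhds).laplacian_sub (hu.contDiffAt hnhds)]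
        linarith [huΔ z hz, hvΔ z hz])
      (fun z hz => by simpa only [sub_self] using (hvf z hz).sub (huf z hz)) hε
    have h1 := hK ε hε y hy hmax
    have h2 := hmax hx
    have h3 := radial_smul r₁ (-(4 * r₂ ^ 2)) 1 ε x
    rw [one_mul, neg_mul] at h3
    simp only [Set.mem_ofPred_eq, Pi.add_apply, Pi.sub_apply, radial_of_norm_eq hr₁ _ _ _ hy,
      h3] at h2
    linarith
  linarith

/-- On the inner circle the difference is zero, so `K = 0` suffices. Only one inequality is needed,
because the roles of `u` and `v` can be exchanged. -/
theorem IsStateS.le {r₁ r₂ g q b : ℝ} (hr₁ : 0 < r₁) (hr₂ : r₁ < r₂) {u v : Plane → ℝ}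
    (hu : IsStateS r₁ r₂ g q b u) (hv : IsStateS r₁ r₂ g q b v) {x : Plane}
    (hx : x ∈ closedAnnulus r₁ r₂) : v x ≤ u x :=
  le_of_inner_bound hr₁ hr₂ hu.contDiffOn hv.contDiffOn hu.continuousOn hv.continuousOn
    hu.poisson hv.poisson hu.flux hv.flux 0
    (fun ε _ y hy _ => by rw [hu.dirichlet y hy, hv.dirichlet y hy]; simp) hx

theorem IsStateSα.le {r₁ r₂ α g q b : ℝ} (hr₁ : 0 < r₁) (hr₂ : r₁ < r₂) (hα : 0 < α)
    {u v : Plane → ℝ} (hu : IsStateSα r₁ r₂ α g q b u) (hv : IsStateSα r₁ r₂ α g q b v)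
    {x : Plane} (hx : x ∈ closedAnnulus r₁ r₂) : v x ≤ u x := by
  refine le_of_inner_bound hr₁ hr₂ hu.contDiffOn hv.contDiffOn hu.continuousOn hv.continuousOn
    -- At an inner maximum the outward derivative of the corrected difference is nonnegative: `-α (v
    -- - u) + ε (4 r₂²/r₁ - 2 r₁) ≥ 0`. Dividing by `α` gives the constant `K`.
    hu.poisson hv.poisson hu.flux hv.flux ((4 * r₂ ^ 2 / r₁ - 2 * r₁) / α)
    (fun ε _ y hy hmax => ?_) hx
  have hd := ((hv.robin y hy).sub (hu.robin y hy)).add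
    (by simpa using hasNormalDeriv_radial hr₁ 0 (-(4 * r₂ ^ 2 * ε)) ε (-1) hr₁ hy :
      HasNormalDeriv (radial r₁ 0 (-(4 * r₂ ^ 2 * ε)) ε) y (-(r₁⁻¹ • y))
        (-(-(4 * r₂ ^ 2 * ε) / r₁ + 2 * ε * r₁) ))
  have h := nonneg_of_hasNormalDeriv_of_max (σ := -1) hr₁ hy (eventually_mem_Icc_of_neg hr₂) hmax
    (by simpa only [neg_one_smul] using hd)
  have h1 : -(-(4 * r₂ ^ 2 * ε) / r₁ + 2 * ε * r₁) = ε * (4 * r₂ ^ 2 / r₁ - 2 * r₁) := by ring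
  rw [h1] at h
  rw [← mul_div_assoc, le_div_iff₀ hα]
  linarith

/-! ## The states -/

/-- The radial solution of `S_α` for `ε = 1 / α`, and of `S` for `ε = 0`. -/
noncomputable def radialState (r₁ r₂ ε g q b : ℝ) : Plane → ℝ :=
  -- The coefficients solve `4k = -g`, `B/r₂ + 2k r₂ = -q` and, on the inner circle, `u - b = ε
  -- (B/r₁ + 2k r₁)`.
  radial r₁ (b + ε * ((g * r₂ ^ 2 / 2 - q * r₂) / r₁ - g * r₁ / 2)) (g * r₂ ^ 2 / 2 - q * r₂)
    (-(g / 4))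

section

variable {r₁ r₂ : ℝ} (hr₁ : 0 < r₁) (hr₂ : r₁ < r₂) (ε g q b : ℝ)
include hr₁

theorem contDiffAt_radialState {x : Plane} (hx : x ∈ closedAnnulus r₁ r₂) :
    ContDiffAt ℝ 2 (radialState r₁ r₂ ε g q b) x :=
  contDiffAt_radial hr₁.ne' _ _ _ (ne_zero_of_mem_closedAnnulus hr₁ hx)

theorem laplacian_radialState {x : Plane} (hx : x ∈ annulus r₁ r₂) :
    -(Laplacian.laplacian (radialState r₁ r₂ ε g q b) x) = g := by
  rw [radialState, laplacian_radial hr₁ _ _ _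
    (ne_zero_of_mem_closedAnnulus hr₁ (annulus_subset_closedAnnulus _ _ hx))]
  ring

include hr₂ in
theorem flux_radialState {x : Plane} (hx : ‖x‖ = r₂) :
    HasNormalDeriv (radialState r₁ r₂ ε g q b) x (r₂⁻¹ • x) (-q) := by
  have hr₂' := hr₁.trans hr₂
  have h := hasNormalDeriv_radial hr₁ (b + ε * ((g * r₂ ^ 2 / 2 - q * r₂) / r₁ - g * r₁ / 2))
    (g * r₂ ^ 2 / 2 - q * r₂) (-(g / 4)) 1 hr₂' hx
  rw [one_smul] at h
  convert h using 1
  · rfl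
  · field_simp
    ring

include hr₂ in
theorem isStateS_radialState : IsStateS r₁ r₂ g q b (radialState r₁ r₂ 0 g q b) where
  contDiffOn x hx := (contDiffAt_radialState hr₁ 0 g q b
    (annulus_subset_closedAnnulus _ _ hx)).contDiffWithinAt
  continuousOn x hx := (contDiffAt_radialState hr₁ 0 g q b hx).continuousAt.continuousWithinAt
  poisson x hx := laplacian_radialState hr₁ 0 g q b hx
  dirichlet x hx := by rw [radialState, radial_of_norm_eq hr₁ _ _ _ hx]; ring
  flux x hx := flux_radialState hr₁ hr₂ 0 g q b hx

include hr₂ in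
theorem isStateSα_radialState {α : ℝ} (hα : 0 < α) :
    IsStateSα r₁ r₂ α g q b (radialState r₁ r₂ (1 / α) g q b) where
  contDiffOn x hx := (contDiffAt_radialState hr₁ _ g q b
    (annulus_subset_closedAnnulus _ _ hx)).contDiffWithinAt
  continuousOn x hx := (contDiffAt_radialState hr₁ _ g q b hx).continuousAt.continuousWithinAt
  poisson x hx := laplacian_radialState hr₁ _ g q b hx
  robin x hx := by
    have h := hasNormalDeriv_radial hr₁
      (b + 1 / α * ((g * r₂ ^ 2 / 2 - q * r₂) / r₁ - g * r₁ / 2))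
      (g * r₂ ^ 2 / 2 - q * r₂) (-(g / 4)) (-1) hr₁ hx
    rw [neg_one_smul] at h
    convert h using 1
    · rfl
    · rw [radialState, radial_of_norm_eq hr₁ _ _ _ hx]
      field_simp
      ring
  flux x hx := flux_radialState hr₁ hr₂ _ g q b hx

include hr₂ in
theorem eqOn_radialState_of_isStateS {v : Plane → ℝ} (hv : IsStateS r₁ r₂ g q b v) :
    Set.EqOn v (radialState r₁ r₂ 0 g q b) (closedAnnulus r₁ r₂) := fun _ hx =>
  le_antisymm ((isStateS_radialState hr₁ hr₂ g q b).le hr₁ hr₂ hv hx)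
    (hv.le hr₁ hr₂ (isStateS_radialState hr₁ hr₂ g q b) hx)

include hr₂ in
theorem eqOn_radialState_of_isStateSα {α : ℝ} (hα : 0 < α) {v : Plane → ℝ}
    (hv : IsStateSα r₁ r₂ α g q b v) :
    Set.EqOn v (radialState r₁ r₂ (1 / α) g q b) (closedAnnulus r₁ r₂) := fun _ hx =>
  le_antisymm ((isStateSα_radialState hr₁ hr₂ g q b hα).le hr₁ hr₂ hα hv hx)
    (hv.le hr₁ hr₂ hα (isStateSα_radialState hr₁ hr₂ g q b hα) hx)

include hr₂ in
-- Since a solution exists, the chosen state is one, and uniqueness identifies it. Off the closed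
-- annulus its values are arbitrary, but the functionals do not see them.
theorem eqOn_stateS :
    Set.EqOn (stateS r₁ r₂ g q b) (radialState r₁ r₂ 0 g q b) (closedAnnulus r₁ r₂) :=
  eqOn_radialState_of_isStateS hr₁ hr₂ g q b
    (Classical.epsilon_spec ⟨_, isStateS_radialState hr₁ hr₂ g q b⟩)

include hr₂ in
theorem eqOn_stateSα {α : ℝ} (hα : 0 < α) :
    Set.EqOn (stateSα r₁ r₂ α g q b) (radialState r₁ r₂ (1 / α) g q b) (closedAnnulus r₁ r₂) :=
  eqOn_radialState_of_isStateSα hr₁ hr₂ g q b hα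
    (Classical.epsilon_spec ⟨_, isStateSα_radialState hr₁ hr₂ g q b hα⟩)

end

/-! ## Integrals of radial functions -/

open MeasureTheory in
-- Polar coordinates: the factor `2π` arises as the dimension `2` times the area `π` of the unit
-- disc.
theorem setIntegral_annulus_comp_norm {r₁ r₂ : ℝ} (hr₁ : 0 < r₁) (hr₂ : r₁ < r₂) (f : ℝ → ℝ) :
    ∫ x in annulus r₁ r₂, f ‖x‖ = 2 * Real.pi * ∫ r in r₁..r₂, r * f r := by
  rw [← integral_indicator (isOpen_annulus r₁ r₂).measurableSet]
  have h1 : (annulus r₁ r₂).indicator (fun x => f ‖x‖) =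
      fun x : Plane => (Set.Ioo r₁ r₂).indicator f ‖x‖ := by
    ext x
    by_cases hx : x ∈ annulus r₁ r₂
    · rw [Set.indicator_of_mem hx, Set.indicator_of_mem (show ‖x‖ ∈ Set.Ioo r₁ r₂ from hx)]
    · rw [Set.indicator_of_notMem hx,
        Set.indicator_of_notMem (show ‖x‖ ∉ Set.Ioo r₁ r₂ from hx)]
  have hball : volume.real (Metric.ball (0 : Plane) 1) = Real.pi := by
    rw [measureReal_def, EuclideanSpace.volume_ball_fin_two]
    simp [Real.pi_nonneg]
  rw [h1, integral_fun_norm_addHaar, finrank_euclideanSpace_fin, hball,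
    intervalIntegral.integral_of_le hr₂.le, integral_Ioc_eq_integral_Ioo]
  have h2 : (fun y : ℝ => y ^ (2 - 1) • (Set.Ioo r₁ r₂).indicator f y) =
      (Set.Ioo r₁ r₂).indicator fun y => y * f y := by
    ext y
    by_cases hy : y ∈ Set.Ioo r₁ r₂ <;> simp [hy]
  have h3 : Set.Ioi 0 ∩ Set.Ioo r₁ r₂ = Set.Ioo r₁ r₂ :=
    Set.inter_eq_right.2 fun y hy => hr₁.trans hy.1
  rw [h2, setIntegral_indicator measurableSet_Ioo, h3]
  simp
  ring

theorem integral_mul_log_quadratic_sq {r₁ r₂ : ℝ} (hr₁ : 0 < r₁) (hr₂ : r₁ < r₂) (a B k : ℝ) :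
    ∫ r in r₁..r₂, r * (a + B * Real.log (r / r₁) + k * r ^ 2) ^ 2 =
      a ^ 2 * (r₂ ^ 2 - r₁ ^ 2) / 2 +
      B ^ 2 * (r₂ ^ 2 * Real.log (r₂ / r₁) ^ 2 / 2 - r₂ ^ 2 * Real.log (r₂ / r₁) / 2 +
        (r₂ ^ 2 - r₁ ^ 2) / 4) +
      k ^ 2 * (r₂ ^ 6 - r₁ ^ 6) / 6 +
      2 * a * B * (r₂ ^ 2 * Real.log (r₂ / r₁) / 2 - (r₂ ^ 2 - r₁ ^ 2) / 4) +
      a * k * (r₂ ^ 4 - r₁ ^ 4) / 2 +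
      2 * B * k * (r₂ ^ 4 * Real.log (r₂ / r₁) / 4 - (r₂ ^ 4 - r₁ ^ 4) / 16) := by
  have hpos {r : ℝ} (hr : r ∈ Set.uIcc r₁ r₂) : 0 < r := by
    rw [Set.uIcc_of_le hr₂.le] at hr
    exact hr₁.trans_le hr.1
  -- An antiderivative found by integration by parts. Every logarithm in it vanishes at `r₁`, so the
  -- lower endpoint contributes only powers of `r₁`.
  have hd : ∀ r ∈ Set.uIcc r₁ r₂, HasDerivAt (fun r : ℝ => a ^ 2 / 2 * r ^ 2 +
      B ^ 2 * (r ^ 2 * (Real.log (r / r₁) ^ 2 / 2 - Real.log (r / r₁) / 2 + 1 / 4)) +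
      k ^ 2 / 6 * r ^ 6 + 2 * a * B * (r ^ 2 * (Real.log (r / r₁) / 2 - 1 / 4)) +
      a * k / 2 * r ^ 4 + 2 * B * k * (r ^ 4 * (Real.log (r / r₁) / 4 - 1 / 16)))
      (r * (a + B * Real.log (r / r₁) + k * r ^ 2) ^ 2) r := by
    intro r hr
    have hr0 := hpos hr
    have hl : HasDerivAt (fun r : ℝ => Real.log (r / r₁)) (1 / r) r := by
      refine (((hasDerivAt_id' r).div_const r₁).log (by positivity)).congr_deriv ?_
      field_simp
    have h2 : HasDerivAt (fun r : ℝ => r ^ 2) (2 * r) r := by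
      simpa using hasDerivAt_pow 2 r
    have h4 : HasDerivAt (fun r : ℝ => r ^ 4) (4 * r ^ 3) r := by
      simpa using hasDerivAt_pow 4 r
    have h6 : HasDerivAt (fun r : ℝ => r ^ 6) (6 * r ^ 5) r := by
      simpa using hasDerivAt_pow 6 r
    refine ((((((h2.const_mul (a ^ 2 / 2)).add ((h2.mul
      ((((hl.pow 2).div_const 2).sub (hl.div_const 2)).add_const (1 / 4))).const_mul (B ^ 2))).add
      (h6.const_mul (k ^ 2 / 6))).add
      ((h2.mul ((hl.div_const 2).sub_const (1 / 4))).const_mul (2 * a * B))).add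
      (h4.const_mul (a * k / 2))).add
      ((h4.mul ((hl.div_const 4).sub_const (1 / 16))).const_mul (2 * B * k))).congr_deriv ?_
    simp
    field_simp
    ring
  have hint : IntervalIntegrable
      (fun r => r * (a + B * Real.log (r / r₁) + k * r ^ 2) ^ 2) MeasureTheory.volume r₁ r₂ := by
    refine ContinuousOn.intervalIntegrable fun r hr => ContinuousAt.continuousWithinAt ?_
    have h : r / r₁ ≠ 0 := (div_pos (hpos hr) hr₁).ne'
    have hl : ContinuousAt (fun r : ℝ => Real.log (r / r₁)) r :=
      ContinuousAt.log (by fun_prop) h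
    fun_prop
  rw [intervalIntegral.integral_eq_sub_of_hasDerivAt hd hint, div_self hr₁.ne', Real.log_one]
  ring

theorem normSqH_congr {r₁ r₂ : ℝ} {u v : Plane → ℝ} (h : Set.EqOn u v (closedAnnulus r₁ r₂))
    (z : ℝ) : normSqH r₁ r₂ (fun x => u x - z) = normSqH r₁ r₂ fun x => v x - z := by
  refine MeasureTheory.setIntegral_congr_fun (isOpen_annulus r₁ r₂).measurableSet fun x hx => ?_
  simp only [h (annulus_subset_closedAnnulus r₁ r₂ hx)]

theorem normSqH_nonneg (r₁ r₂ : ℝ) (u : Plane → ℝ) : 0 ≤ normSqH r₁ r₂ u :=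
  MeasureTheory.integral_nonneg fun _ => sq_nonneg _

theorem normSqH_radial {r₁ r₂ : ℝ} (hr₁ : 0 < r₁) (hr₂ : r₁ < r₂) (c B k z : ℝ) :
    normSqH r₁ r₂ (fun x => radial r₁ c B k x - z) = 2 * Real.pi *
      ∫ r in r₁..r₂, r * ((c - z - k * r₁ ^ 2) + B * Real.log (r / r₁) + k * r ^ 2) ^ 2 := by
  rw [← setIntegral_annulus_comp_norm hr₁ hr₂
    (fun r => ((c - z - k * r₁ ^ 2) + B * Real.log (r / r₁) + k * r ^ 2) ^ 2), normSqH]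
  congr 1
  ext x
  rw [radial]
  ring

theorem normSqH_const {r₁ r₂ : ℝ} (hr₁ : 0 < r₁) (hr₂ : r₁ < r₂) (g : ℝ) :
    normSqH r₁ r₂ (fun _ => g) = Real.pi * (r₂ ^ 2 - r₁ ^ 2) * g ^ 2 := by
  have h := normSqH_radial hr₁ hr₂ g 0 0 0
  rw [integral_mul_log_quadratic_sq hr₁ hr₂] at h
  simp only [radial, zero_mul, add_zero, sub_zero] at h
  rw [h]
  ring

theorem normSqCircle_const (ρ q : ℝ) :
    normSqCircle ρ (fun _ => q) = 2 * Real.pi * ρ * q ^ 2 := by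
  simp [normSqCircle]
  ring

/-! ## The cost of the states as a quadratic form -/

/-- The coefficients as functions of `ε = 1 / α`; the value `ε = 0` belongs to problem `S`. -/
noncomputable def coeffs (r₁ r₂ ε : ℝ) : Coeffs :=
  let t := r₂ / r₁
  let L := Real.log (r₂ / r₁)
  let e := ε / r₁
  { E₁ := 1 / 8 * (-(1 / 12) + e / 2 - e ^ 2 + t ^ 2 * (5 / 8 - 5 / 2 * e + 3 * e ^ 2) +
        t ^ 4 * (L - 5 / 4 + e * (7 / 2 - 2 * L) - 3 * e ^ 2) +
        t ^ 6 * (L ^ 2 - 3 / 2 * L + 17 / 24 - 3 / 2 * e + 2 * e * L + e ^ 2))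
    E₂ := 1 / 4 * (-t ^ 2 * (1 + 2 * e ^ 2 - 2 * e) +
        t ^ 4 * (2 * L ^ 2 - 2 * L + 1 + 2 * e ^ 2 + e * (4 * L - 2)))
    E₃ := 1 / 2 * (-1 + t ^ 2)
    E₄ := 1 / 4 * (t * (-(3 / 8) + 3 / 2 * e - 2 * e ^ 2) +
        t ^ 3 * (3 / 2 - L + e * (2 * L - 4) + 4 * e ^ 2) +
        t ^ 5 * (-2 * L ^ 2 + 5 / 2 * L - 9 / 8 - 4 * e * L + 5 / 2 * e - 2 * e ^ 2))
    E₅ := 1 / 2 * (-(1 / 4) + e + t ^ 2 * (1 - 2 * e) + t ^ 4 * (L - 3 / 4 + e))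
    E₆ := -(t * (1 / 2 - e) + t ^ 3 * (L - 1 / 2 + e)) }

theorem E_eq_coeffs (r₁ r₂ : ℝ) : E r₁ r₂ = coeffs r₁ r₂ 0 := by
  simp only [E, coeffs, Coeffs.mk.injEq]
  refine ⟨?_, ?_, trivial, ?_, ?_, ?_⟩ <;> ring

theorem Eα_eq_coeffs (r₁ r₂ α : ℝ) : Eα r₁ r₂ α = coeffs r₁ r₂ (1 / α) := by
  simp only [Eα, coeffs, Coeffs.mk.injEq, div_eq_mul_inv, mul_inv]
  refine ⟨?_, ?_, trivial, ?_, ?_, ?_⟩ <;> ring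

/-- The quadratic form with the given coefficients. -/
def Coeffs.form (c : Coeffs) (r₁ g q d : ℝ) : ℝ :=
  c.E₁ * g ^ 2 * r₁ ^ 4 + c.E₂ * q ^ 2 * r₁ ^ 2 + c.E₃ * d ^ 2 + c.E₄ * g * q * r₁ ^ 3 +
    c.E₅ * g * r₁ ^ 2 * d + c.E₆ * q * r₁ * d

/-- The state is affine in the data and the norm is quadratic. The powers of `r₁` in `Coeffs.form`
leave coefficients depending only on `r₂/r₁` and `ε/r₁`. The identity holds for every real `ε`. -/
theorem half_normSqH_radialState {r₁ r₂ : ℝ} (hr₁ : 0 < r₁) (hr₂ : r₁ < r₂) (ε g q b z : ℝ) :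
    1 / 2 * normSqH r₁ r₂ (fun x => radialState r₁ r₂ ε g q b x - z) =
      Real.pi * r₁ ^ 2 * (coeffs r₁ r₂ ε).form r₁ g q (b - z) := by
  simp only [radialState]
  rw [normSqH_radial hr₁ hr₂, integral_mul_log_quadratic_sq hr₁ hr₂]
  simp only [coeffs, Coeffs.form]
  -- No property of the logarithm is used from here on: the identity is polynomial in `L`.
  generalize Real.log (r₂ / r₁) = L
  field_simp
  ring

/-! ## Minimization of quadratic functions -/

theorem isUniqueMin_of_lt {X : Type*} {J : X → ℝ} {x : X} (h : ∀ y, y ≠ x → J x < J y) :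
    IsUniqueMin J x := by
  refine ⟨fun y _ => ?_, fun y hy => ?_⟩
  · rcases eq_or_ne y x with rfl | hne
    · exact le_refl (J y)
    · exact (h y hne).le
  · by_contra hne
    exact absurd (hy (Set.mem_univ x)) (not_le.2 (h y hne))

theorem isUniqueMin_quadratic {J : ℝ → ℝ} {A B C : ℝ} (hA : 0 < A)
    (hJ : ∀ x, J x = A * x ^ 2 + B * x + C) :
    IsUniqueMin J (-(B / (2 * A))) ∧ J (-(B / (2 * A))) = C - B ^ 2 / (4 * A) := by
  have hval : J (-(B / (2 * A))) = C - B ^ 2 / (4 * A) := by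
    rw [hJ]
    field_simp
    ring
  refine ⟨isUniqueMin_of_lt fun y hy => ?_, hval⟩
  have h1 : J y = A * (y - -(B / (2 * A))) ^ 2 + (C - B ^ 2 / (4 * A)) := by
    rw [hJ]
    field_simp
    ring
  have h2 : 0 < (y - -(B / (2 * A))) ^ 2 := by
    have := sub_ne_zero.2 hy
    positivity
  rw [hval, h1]
  linarith [mul_pos hA h2]

/-- Completing the square in the first variable leaves `(4AK - H²)/(4A)` as the coefficient of the
second square, which is why the determinant condition is the right one. -/
theorem isUniqueMin_quadratic_prod {J : ℝ × ℝ → ℝ} {A H K M N C : ℝ} (hA : 0 < A)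
    (hdet : 0 < 4 * A * K - H ^ 2)
    (hJ : ∀ x, J x = A * x.1 ^ 2 + H * x.1 * x.2 + K * x.2 ^ 2 + M * x.1 + N * x.2 + C) :
    IsUniqueMin J ((H * N - 2 * K * M) / (4 * A * K - H ^ 2),
      (H * M - 2 * A * N) / (4 * A * K - H ^ 2)) ∧
    J ((H * N - 2 * K * M) / (4 * A * K - H ^ 2), (H * M - 2 * A * N) / (4 * A * K - H ^ 2)) =
      C - (K * M ^ 2 + A * N ^ 2 - H * M * N) / (4 * A * K - H ^ 2) := by
  have hne := hdet.ne'
  have h1 (y : ℝ × ℝ) : J y = A * (y.1 - (H * N - 2 * K * M) / (4 * A * K - H ^ 2) +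
      H / (2 * A) * (y.2 - (H * M - 2 * A * N) / (4 * A * K - H ^ 2))) ^ 2 +
      (4 * A * K - H ^ 2) / (4 * A) * (y.2 - (H * M - 2 * A * N) / (4 * A * K - H ^ 2)) ^ 2 +
      (C - (K * M ^ 2 + A * N ^ 2 - H * M * N) / (4 * A * K - H ^ 2)) := by
    rw [hJ]
    set D := 4 * A * K - H ^ 2 with hD
    field_simp
    -- Eliminating `K` in favour of the determinant `D` leaves an identity whose only denominators
    -- are `A` and `D`.
    have hK : K = (D + H ^ 2) / (4 * A) := by
      rw [hD]
      field_simp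
      ring
    rw [hK]
    field_simp
    ring
  refine ⟨isUniqueMin_of_lt fun y hy => ?_, ?_⟩
  · set X := (H * N - 2 * K * M) / (4 * A * K - H ^ 2)
    set Y := (H * M - 2 * A * N) / (4 * A * K - H ^ 2)
    rw [h1, h1 y]
    simp only [sub_self, mul_zero, add_zero, ne_eq, OfNat.ofNat_ne_zero, not_false_eq_true,
      zero_pow, zero_add]
    have hK : 0 < (4 * A * K - H ^ 2) / (4 * A) := by positivity
    -- If the second coordinates agree, the first square is strictly positive; otherwise the second
    -- one is.
    by_cases h2 : y.2 = Y
    · have h3 : y.1 - X ≠ 0 := fun h => hy (Prod.ext (sub_eq_zero.1 h) h2)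
      have : 0 < A * (y.1 - X) ^ 2 := by positivity
      rw [h2]
      simpa using this
    · have h3 : y.2 - Y ≠ 0 := sub_ne_zero.2 h2
      have : 0 < (4 * A * K - H ^ 2) / (4 * A) * (y.2 - Y) ^ 2 := by positivity
      have : 0 ≤ A * (y.1 - X + H / (2 * A) * (y.2 - Y)) ^ 2 := by positivity
      linarith
  · rw [h1]
    simp

/-! ## Positivity of the quadratic form -/

theorem coeffs_E₃ {r₁ : ℝ} (hr₁ : 0 < r₁) (r₂ ε : ℝ) :
    (coeffs r₁ r₂ ε).E₃ = (r₂ ^ 2 - r₁ ^ 2) / (2 * r₁ ^ 2) := by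
  simp only [coeffs]
  field_simp
  ring

theorem coeffs_E₃_pos {r₁ r₂ : ℝ} (hr₁ : 0 < r₁) (hr₂ : r₁ < r₂) (ε : ℝ) :
    0 < (coeffs r₁ r₂ ε).E₃ := by
  rw [coeffs_E₃ hr₁]
  have : 0 < r₂ ^ 2 - r₁ ^ 2 := by nlinarith
  positivity

/-- Up to the positive factor `π r₁²` the form is half a squared norm. This is the only source of
positivity for `E₁`, `E₂` and the discriminant below, so no inequality for logarithms has to be
proved. -/
theorem form_coeffs_nonneg {r₁ r₂ : ℝ} (hr₁ : 0 < r₁) (hr₂ : r₁ < r₂) (ε g q d : ℝ) :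
    0 ≤ (coeffs r₁ r₂ ε).form r₁ g q d := by
  have h := half_normSqH_radialState hr₁ hr₂ ε g q d 0
  have h1 := normSqH_nonneg r₁ r₂ (fun x => radialState r₁ r₂ ε g q d x - 0)
  rw [sub_zero d] at h
  have h2 : 0 < Real.pi * r₁ ^ 2 := by positivity
  exact nonneg_of_mul_nonneg_right (h ▸ by positivity) h2

theorem coeffs_E₁_nonneg {r₁ r₂ : ℝ} (hr₁ : 0 < r₁) (hr₂ : r₁ < r₂) (ε : ℝ) :
    0 ≤ (coeffs r₁ r₂ ε).E₁ := by
  -- These data cancel the power of `r₁` and isolate `E₁`.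
  have h := form_coeffs_nonneg hr₁ hr₂ ε (1 / r₁ ^ 2) 0 0
  simp only [Coeffs.form] at h
  field_simp at h
  linarith

theorem coeffs_E₂_nonneg {r₁ r₂ : ℝ} (hr₁ : 0 < r₁) (hr₂ : r₁ < r₂) (ε : ℝ) :
    0 ≤ (coeffs r₁ r₂ ε).E₂ := by
  have h := form_coeffs_nonneg hr₁ hr₂ ε 0 (1 / r₁) 0
  simp only [Coeffs.form] at h
  field_simp at h
  linarith

/-- The form restricted to `d = 0` is a nonnegative quadratic polynomial in the rescaled `g`, so its
discriminant is nonpositive. -/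
theorem coeffs_E₄_sq_le {r₁ r₂ : ℝ} (hr₁ : 0 < r₁) (hr₂ : r₁ < r₂) (ε : ℝ) :
    (coeffs r₁ r₂ ε).E₄ ^ 2 ≤ 4 * (coeffs r₁ r₂ ε).E₁ * (coeffs r₁ r₂ ε).E₂ := by
  have h (x : ℝ) : 0 ≤ (coeffs r₁ r₂ ε).E₁ * (x * x) + (coeffs r₁ r₂ ε).E₄ * x +
      (coeffs r₁ r₂ ε).E₂ := by
    have h := form_coeffs_nonneg hr₁ hr₂ ε (x / r₁ ^ 2) (1 / r₁) 0
    simp only [Coeffs.form] at h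
    field_simp at h
    linarith
  have := discrim_le_zero h
  rw [discrim] at this
  linarith

theorem coeffs_E₁_add_pos {r₁ r₂ : ℝ} (hr₁ : 0 < r₁) (hr₂ : r₁ < r₂) (ε : ℝ) {M : ℝ}
    (hM : 0 < M) : 0 < (coeffs r₁ r₂ ε).E₁ + (coeffs r₁ r₂ ε).E₃ * (M / r₁ ^ 4) := by
  have h1 := coeffs_E₁_nonneg hr₁ hr₂ ε
  have h3 := coeffs_E₃_pos hr₁ hr₂ ε
  positivity

theorem coeffs_E₂_add_pos {r₁ r₂ : ℝ} (hr₁ : 0 < r₁) (hr₂ : r₁ < r₂) (ε : ℝ) {M : ℝ}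
    (hM : 0 < M) : 0 < (coeffs r₁ r₂ ε).E₂ + M * r₂ / r₁ ^ 4 := by
  have h1 := coeffs_E₂_nonneg hr₁ hr₂ ε
  have h3 := hr₁.trans hr₂
  positivity

theorem coeffs_E₃_add_pos {r₁ r₂ : ℝ} (hr₁ : 0 < r₁) (hr₂ : r₁ < r₂) (ε : ℝ) {M : ℝ}
    (hM : 0 < M) : 0 < (coeffs r₁ r₂ ε).E₃ + M / r₁ := by
  have h3 := coeffs_E₃_pos hr₁ hr₂ ε
  positivity

/-- With `a`, `b` the positive shifts of `E₁`, `E₂`, the discriminant bound gives `den₄ ≥ 4 (E₁ b +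
E₂ a + a b)`, and `a b > 0`. -/
theorem den₄_coeffs_pos {r₁ r₂ : ℝ} (hr₁ : 0 < r₁) (hr₂ : r₁ < r₂) (ε : ℝ) {M₄ M₅ : ℝ}
    (hM₄ : 0 < M₄) (hM₅ : 0 < M₅) : 0 < den₄ (coeffs r₁ r₂ ε) r₁ r₂ M₄ M₅ := by
  have h1 := coeffs_E₁_nonneg hr₁ hr₂ ε
  have h2 := coeffs_E₂_nonneg hr₁ hr₂ ε
  have h3 := coeffs_E₃_pos hr₁ hr₂ ε
  have h4 := coeffs_E₄_sq_le hr₁ hr₂ ε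
  have hr := hr₁.trans hr₂
  have ha : 0 < (coeffs r₁ r₂ ε).E₃ * (M₄ / r₁ ^ 4) := by positivity
  have hb : 0 < M₅ * r₂ / r₁ ^ 4 := by positivity
  rw [den₄]
  nlinarith [mul_nonneg h1 hb.le, mul_nonneg h2 ha.le, mul_pos ha hb]

/-! ## The optimal controls -/

section

variable {r₁ r₂ : ℝ} (hr₁ : 0 < r₁) (hr₂ : r₁ < r₂) (ε : ℝ)
include hr₁ hr₂

/-- Because `r₂² - r₁² = 2 r₁² E₃`, the control cost is `π r₁⁶ · E₃ M₁/r₁⁴ · g²`: it merely shifts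
`E₁`. The functional `J` is kept abstract so that `ε = 0` and `ε = 1/α` share one proof. -/
theorem isUniqueMin_gOp {q b zd M₁ : ℝ} (hM₁ : 0 < M₁) {J : ℝ → ℝ}
    (hJ : ∀ g, J g = Real.pi * r₁ ^ 2 * (coeffs r₁ r₂ ε).form r₁ g q (b - zd) +
      M₁ / 2 * (Real.pi * (r₂ ^ 2 - r₁ ^ 2) * g ^ 2)) :
    IsUniqueMin J (gOp (coeffs r₁ r₂ ε) r₁ q b zd M₁) ∧
      J (gOp (coeffs r₁ r₂ ε) r₁ q b zd M₁) = J₁Op (coeffs r₁ r₂ ε) r₁ q b zd M₁ := by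
  have hD := coeffs_E₁_add_pos hr₁ hr₂ ε hM₁
  have h3 : r₂ ^ 2 - r₁ ^ 2 = 2 * r₁ ^ 2 * (coeffs r₁ r₂ ε).E₃ := by
    rw [coeffs_E₃ hr₁]
    field_simp
  generalize coeffs r₁ r₂ ε = c at *
  set D := c.E₁ + c.E₃ * (M₁ / r₁ ^ 4) with hDdef
  -- Solving for `E₁` keeps the positive quantity `D` as a single symbol in the denominators.
  have hE₁ : c.E₁ = D - c.E₃ * (M₁ / r₁ ^ 4) := by rw [hDdef]; ring
  have h := isUniqueMin_quadratic (J := J) (A := Real.pi * r₁ ^ 6 * D)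
    (B := Real.pi * r₁ ^ 4 * (c.E₄ * q * r₁ + c.E₅ * (b - zd)))
    (C := Real.pi * r₁ ^ 2 *
      (c.E₂ * q ^ 2 * r₁ ^ 2 + c.E₃ * (b - zd) ^ 2 + c.E₆ * q * r₁ * (b - zd)))
    (by positivity) (fun g => by
      rw [hJ, h3, Coeffs.form, hE₁]
      field_simp
      ring)
  have hop : gOp c r₁ q b zd M₁ = -(Real.pi * r₁ ^ 4 * (c.E₄ * q * r₁ + c.E₅ * (b - zd)) /
      (2 * (Real.pi * r₁ ^ 6 * D))) := by
    rw [gOp, ← hDdef]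
    field_simp
  rw [hop]
  refine ⟨h.1, h.2.trans ?_⟩
  rw [J₁Op, ← hDdef]
  field_simp

theorem isUniqueMin_qOp {g b zd M₂ : ℝ} (hM₂ : 0 < M₂) {J : ℝ → ℝ}
    (hJ : ∀ q, J q = Real.pi * r₁ ^ 2 * (coeffs r₁ r₂ ε).form r₁ g q (b - zd) +
      M₂ / 2 * (2 * Real.pi * r₂ * q ^ 2)) :
    IsUniqueMin J (qOp (coeffs r₁ r₂ ε) r₁ r₂ g b zd M₂) ∧
      J (qOp (coeffs r₁ r₂ ε) r₁ r₂ g b zd M₂) = J₂Op (coeffs r₁ r₂ ε) r₁ r₂ g b zd M₂ := by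
  have hD := coeffs_E₂_add_pos hr₁ hr₂ ε hM₂
  generalize coeffs r₁ r₂ ε = c at *
  set D := c.E₂ + M₂ * r₂ / r₁ ^ 4 with hDdef
  have hE₂ : c.E₂ = D - M₂ * r₂ / r₁ ^ 4 := by rw [hDdef]; ring
  have h := isUniqueMin_quadratic (J := J) (A := Real.pi * r₁ ^ 4 * D)
    (B := Real.pi * r₁ ^ 3 * (c.E₄ * g * r₁ ^ 2 + c.E₆ * (b - zd)))
    (C := Real.pi * r₁ ^ 2 *
      (c.E₁ * g ^ 2 * r₁ ^ 4 + c.E₃ * (b - zd) ^ 2 + c.E₅ * g * r₁ ^ 2 * (b - zd)))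
    (by positivity) (fun g => by
      rw [hJ, Coeffs.form, hE₂]
      field_simp
      ring)
  have hop : qOp c r₁ r₂ g b zd M₂ = -(Real.pi * r₁ ^ 3 * (c.E₄ * g * r₁ ^ 2 + c.E₆ * (b - zd)) /
      (2 * (Real.pi * r₁ ^ 4 * D))) := by
    rw [qOp, ← hDdef]
    field_simp
  rw [hop]
  refine ⟨h.1, h.2.trans ?_⟩
  rw [J₂Op, ← hDdef]
  field_simp

theorem isUniqueMin_bOp {g q zd M₃ : ℝ} (hM₃ : 0 < M₃) {J : ℝ → ℝ}
    (hJ : ∀ b, J b = Real.pi * r₁ ^ 2 * (coeffs r₁ r₂ ε).form r₁ g q (b - zd) +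
      M₃ / 2 * (2 * Real.pi * r₁ * b ^ 2)) :
    IsUniqueMin J (bOp (coeffs r₁ r₂ ε) r₁ g q zd M₃) ∧
      J (bOp (coeffs r₁ r₂ ε) r₁ g q zd M₃) = J₃Op (coeffs r₁ r₂ ε) r₁ g q zd M₃ := by
  have hD := coeffs_E₃_add_pos hr₁ hr₂ ε hM₃
  generalize coeffs r₁ r₂ ε = c at *
  set D := c.E₃ + M₃ / r₁ with hDdef
  have hM : M₃ = r₁ * (D - c.E₃) := by rw [hDdef]; field_simp; ring
  have h := isUniqueMin_quadratic (J := J) (A := Real.pi * r₁ ^ 2 * D)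
    -- The control enters the form through `b - zd`; expanding the square moves `-2 E₃ zd` into the
    -- linear coefficient.
    (B := Real.pi * r₁ ^ 2 * (c.E₅ * g * r₁ ^ 2 + c.E₆ * q * r₁ - 2 * c.E₃ * zd))
    (C := Real.pi * r₁ ^ 2 *
      (c.E₁ * g ^ 2 * r₁ ^ 4 + c.E₂ * q ^ 2 * r₁ ^ 2 + c.E₃ * zd ^ 2 + c.E₄ * g * q * r₁ ^ 3 -
        c.E₅ * g * r₁ ^ 2 * zd - c.E₆ * q * r₁ * zd))
    (by positivity) (fun g => by
      rw [hJ, Coeffs.form, hM]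
      ring)
  have hop : bOp c r₁ g q zd M₃ =
      -(Real.pi * r₁ ^ 2 * (c.E₅ * g * r₁ ^ 2 + c.E₆ * q * r₁ - 2 * c.E₃ * zd) /
        (2 * (Real.pi * r₁ ^ 2 * D))) := by
    rw [bOp, ← hDdef]
    field_simp
  rw [hop]
  refine ⟨h.1, h.2.trans ?_⟩
  rw [J₃Op, ← hDdef]
  field_simp
  ring

theorem isUniqueMin_gqOp {b zd M₄ M₅ : ℝ} (hM₄ : 0 < M₄) (hM₅ : 0 < M₅) {J : ℝ × ℝ → ℝ}
    (hJ : ∀ x, J x = Real.pi * r₁ ^ 2 * (coeffs r₁ r₂ ε).form r₁ x.1 x.2 (b - zd) +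
      M₄ / 2 * (Real.pi * (r₂ ^ 2 - r₁ ^ 2) * x.1 ^ 2) +
      M₅ / 2 * (2 * Real.pi * r₂ * x.2 ^ 2)) :
    IsUniqueMin J (gqOp (coeffs r₁ r₂ ε) r₁ r₂ b zd M₄ M₅) ∧
      J (gqOp (coeffs r₁ r₂ ε) r₁ r₂ b zd M₄ M₅) =
        J₄Op (coeffs r₁ r₂ ε) r₁ r₂ b zd M₄ M₅ := by
  have hD₁ := coeffs_E₁_add_pos hr₁ hr₂ ε hM₄
  have hden := den₄_coeffs_pos hr₁ hr₂ ε hM₄ hM₅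
  have h3 : r₂ ^ 2 - r₁ ^ 2 = 2 * r₁ ^ 2 * (coeffs r₁ r₂ ε).E₃ := by
    rw [coeffs_E₃ hr₁]
    field_simp
  generalize coeffs r₁ r₂ ε = c at *
  set D₁ := c.E₁ + c.E₃ * (M₄ / r₁ ^ 4) with hD₁def
  set D₂ := c.E₂ + M₅ * r₂ / r₁ ^ 4 with hD₂def
  have hE₁ : c.E₁ = D₁ - c.E₃ * (M₄ / r₁ ^ 4) := by rw [hD₁def]; ring
  have hE₂ : c.E₂ = D₂ - M₅ * r₂ / r₁ ^ 4 := by rw [hD₂def]; ring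
  have hdet : 4 * (Real.pi * r₁ ^ 6 * D₁) * (Real.pi * r₁ ^ 4 * D₂) -
      (Real.pi * r₁ ^ 5 * c.E₄) ^ 2 = Real.pi ^ 2 * r₁ ^ 10 * den₄ c r₁ r₂ M₄ M₅ := by
    rw [den₄, ← hD₁def, ← hD₂def]
    ring
  have h := isUniqueMin_quadratic_prod (J := J) (A := Real.pi * r₁ ^ 6 * D₁)
    (H := Real.pi * r₁ ^ 5 * c.E₄) (K := Real.pi * r₁ ^ 4 * D₂)
    (M := Real.pi * r₁ ^ 4 * (c.E₅ * (b - zd))) (N := Real.pi * r₁ ^ 3 * (c.E₆ * (b - zd)))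
    (C := Real.pi * r₁ ^ 2 * (c.E₃ * (b - zd) ^ 2))
    (by positivity) (by rw [hdet]; positivity) (fun x => by
      rw [hJ, h3, Coeffs.form, hE₁, hE₂]
      field_simp
      ring)
  rw [hdet] at h
  have hop : gqOp c r₁ r₂ b zd M₄ M₅ =
      ((Real.pi * r₁ ^ 5 * c.E₄ * (Real.pi * r₁ ^ 3 * (c.E₆ * (b - zd))) -
        2 * (Real.pi * r₁ ^ 4 * D₂) * (Real.pi * r₁ ^ 4 * (c.E₅ * (b - zd)))) /
        (Real.pi ^ 2 * r₁ ^ 10 * den₄ c r₁ r₂ M₄ M₅),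
      (Real.pi * r₁ ^ 5 * c.E₄ * (Real.pi * r₁ ^ 4 * (c.E₅ * (b - zd))) -
        2 * (Real.pi * r₁ ^ 6 * D₁) * (Real.pi * r₁ ^ 3 * (c.E₆ * (b - zd)))) /
        (Real.pi ^ 2 * r₁ ^ 10 * den₄ c r₁ r₂ M₄ M₅)) := by
    rw [gqOp, delta₂, pi₂, ← hD₁def, ← hD₂def]
    ext <;> field_simp
  rw [hop]
  refine ⟨h.1, h.2.trans ?_⟩
  -- Replacing `E₄²` makes the determinant the only denominator of the optimal value.
  have hE₄ : c.E₄ ^ 2 = 4 * D₁ * D₂ - den₄ c r₁ r₂ M₄ M₅ := by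
    rw [den₄, ← hD₁def, ← hD₂def]
    ring
  rw [J₄Op, ← hD₁def, ← hD₂def, hE₄]
  field_simp
  ring

end

/-! ## Rates of convergence from derivatives -/

/-- With `ε = 1/α`, `α |x α - l|` is the absolute value of the slope of `f` between `0` and `ε`.
Agreement for `α > 0` is enough for a limit at infinity. -/
theorem convergesWithRate_of_hasDerivAt {f x : ℝ → ℝ} {d l c : ℝ} (hf : HasDerivAt f d 0)
    (hx : ∀ α > 0, x α = f (1 / α)) (hl : l = f 0) (hc : |d| = c) : ConvergesWithRate x l c := by
  subst hl hc
  have hx' : ∀ᶠ α in atTop, x α = f (1 / α) := (eventually_gt_atTop 0).mono hx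
  have h0 : Tendsto (fun α : ℝ => 1 / α) atTop (𝓝 0) := by
    simpa using tendsto_inv_atTop_zero (𝕜 := ℝ)
  have hne : Tendsto (fun α : ℝ => 1 / α) atTop (𝓝[≠] 0) := by
    refine tendsto_nhdsWithin_iff.2 ⟨h0, ?_⟩
    filter_upwards [eventually_gt_atTop 0] with α hα
    simpa using hα.ne'
  refine ⟨?_, ?_, ?_⟩
  · exact (hf.continuousAt.tendsto.comp h0).congr' (hx'.mono fun α h => h.symm)
  · have h1 := (hf.isBigO_sub.comp_tendsto h0).norm_left
    refine h1.congr' ?_ ?_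
    · filter_upwards [hx'] with α h
      simp [h]
    · exact Eventually.of_forall fun α => by simp
  · have h1 := (hasDerivAt_iff_tendsto_slope.1 hf).comp hne
    refine h1.abs.congr' ?_
    filter_upwards [hx', eventually_gt_atTop 0] with α h hα
    simp only [Function.comp, slope_def_field, h, sub_zero]
    rw [abs_div, abs_of_pos (one_div_pos.2 hα)]
    field_simp

theorem hasDerivAt_quadratic_zero (a b c : ℝ) :
    HasDerivAt (fun ε : ℝ => a + b * ε + c * ε ^ 2) b 0 := by
  refine ((((hasDerivAt_id' (0 : ℝ)).const_mul b).const_add a).add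
    (((hasDerivAt_id' (0 : ℝ)).pow 2).const_mul c)).congr_deriv ?_
  simp

/-- Matches a derivative `w / D²` with a displayed constant whose denominator is the square of a
multiple `p D`. Under absolute values the numerators need to agree only up to sign. -/
theorem abs_div_sq_eq {w D x r p k : ℝ} (hD : D ≠ 0) (hr : 0 < r) (hp : p ≠ 0) (hk : 0 ≤ k)
    (h : w * r * p ^ 2 = k * x ∨ w * r * p ^ 2 = -(k * x)) :
    |w / D ^ 2| = k / (r * (p * D) ^ 2) * |x| := by
  have h1 : |w| * (r * p ^ 2) = k * |x| := by
    rw [← abs_of_pos (show 0 < r * p ^ 2 by positivity), ← abs_mul, ← mul_assoc]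
    rcases h with h | h <;> rw [h] <;> simp [abs_mul, abs_of_nonneg hk]
  rw [abs_div, abs_of_nonneg (sq_nonneg D), div_mul_eq_mul_div, ← h1]
  field_simp

theorem abs_mul_div_sq_eq {m a n D x r p k : ℝ} (hD : D ≠ 0) (hr : 0 < r) (hp : p ≠ 0)
    (hk : 0 ≤ k) (h : n / a * r * p ^ 2 = k * x ∨ n / a * r * p ^ 2 = -(k * x)) :
    |m / a * (n / D ^ 2)| = k * |m| / (r * (p * D) ^ 2) * |x| := by
  have h1 : m / a * (n / D ^ 2) = m * (n / a / D ^ 2) := by ring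
  rw [h1, abs_mul, abs_div_sq_eq hD hr hp hk h]
  ring

/-- Two long factors can be checked separately, each up to its own scale, without expanding their
product. -/
theorem eq_neg_mul_of_factors {A k F₁ F₂ a₁ a₂ κ₁ κ₂ : ℝ} (h₁ : F₁ = κ₁ * a₁)
    (h₂ : F₂ = κ₂ * a₂) (h : A = -(k * (κ₁ * κ₂) * (a₁ * a₂))) : A = -(k * (F₁ * F₂)) := by
  rw [h, h₁, h₂]
  ring

/-! ## Derivatives of the coefficients -/

/-- The derivatives of `coeffs r₁ r₂` at `ε = 0`. -/
noncomputable def coeffsDeriv (r₁ r₂ : ℝ) : Coeffs :=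
  let t := r₂ / r₁
  let L := Real.log (r₂ / r₁)
  { E₁ := 1 / (8 * r₁) * (1 / 2 - 5 / 2 * t ^ 2 + t ^ 4 * (7 / 2 - 2 * L) +
        t ^ 6 * (-(3 / 2) + 2 * L))
    E₂ := 1 / (4 * r₁) * (2 * t ^ 2 + t ^ 4 * (4 * L - 2))
    E₃ := 0
    E₄ := 1 / (4 * r₁) * (3 / 2 * t + t ^ 3 * (2 * L - 4) + t ^ 5 * (-4 * L + 5 / 2))
    E₅ := 1 / (2 * r₁) * (1 - 2 * t ^ 2 + t ^ 4)
    E₆ := 1 / r₁ * (t - t ^ 3) }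

/-- Componentwise derivative at `0` of a curve of coefficients with constant `E₃`. -/
structure HasCoeffsDeriv (c : ℝ → Coeffs) (c' : Coeffs) : Prop where
  E₁ : HasDerivAt (fun ε => (c ε).E₁) c'.E₁ 0
  E₂ : HasDerivAt (fun ε => (c ε).E₂) c'.E₂ 0
  E₃ : ∀ ε, (c ε).E₃ = (c 0).E₃
  E₄ : HasDerivAt (fun ε => (c ε).E₄) c'.E₄ 0
  E₅ : HasDerivAt (fun ε => (c ε).E₅) c'.E₅ 0
  E₆ : HasDerivAt (fun ε => (c ε).E₆) c'.E₆ 0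

theorem hasCoeffsDeriv_coeffs (r₁ r₂ : ℝ) :
    HasCoeffsDeriv (coeffs r₁ r₂) (coeffsDeriv r₁ r₂) := by
  -- Each coefficient is a quadratic polynomial in `ε`. Its value at `0` and its `ε²` coefficient
  -- are supplied, and the derivative is the linear coefficient.
  have key {f : ℝ → ℝ} {d : ℝ} (a c : ℝ) (hf : ∀ ε, f ε = a + d * ε + c * ε ^ 2) :
      HasDerivAt f d 0 := by
    rw [funext hf]
    exact hasDerivAt_quadratic_zero a d c
  constructor
  · refine key (coeffs r₁ r₂ 0).E₁
      (1 / 8 / r₁ ^ 2 * (-1 + 3 * (r₂ / r₁) ^ 2 - 3 * (r₂ / r₁) ^ 4 + (r₂ / r₁) ^ 6)) fun ε => ?_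
    simp only [coeffs, coeffsDeriv]
    ring
  · refine key (coeffs r₁ r₂ 0).E₂
      (1 / 4 / r₁ ^ 2 * (-2 * (r₂ / r₁) ^ 2 + 2 * (r₂ / r₁) ^ 4)) fun ε => ?_
    simp only [coeffs, coeffsDeriv]
    ring
  · intro ε
    rfl
  · refine key (coeffs r₁ r₂ 0).E₄
      (1 / 4 / r₁ ^ 2 * (-2 * (r₂ / r₁) + 4 * (r₂ / r₁) ^ 3 - 2 * (r₂ / r₁) ^ 5)) fun ε => ?_
    simp only [coeffs, coeffsDeriv]
    ring
  · refine key (coeffs r₁ r₂ 0).E₅ 0 fun ε => ?_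
    simp only [coeffs, coeffsDeriv]
    ring
  · refine key (coeffs r₁ r₂ 0).E₆ 0 fun ε => ?_
    simp only [coeffs, coeffsDeriv]
    ring

/-! ## Derivatives of the optimal controls and values -/

section

variable {c : ℝ → Coeffs} {c' : Coeffs} (h : HasCoeffsDeriv c c')
include h

/-- Quotient rule, arranged with `D²` as the outer denominator to fit `abs_div_sq_eq`. Only `E₁`
varies in `D`, since `E₃` is constant in `ε`. -/
theorem hasDerivAt_gOp {r₁ q b zd M₁ : ℝ} (hr₁ : r₁ ≠ 0)
    (hD : (c 0).E₁ + (c 0).E₃ * (M₁ / r₁ ^ 4) ≠ 0) :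
    HasDerivAt (fun ε => gOp (c ε) r₁ q b zd M₁)
      (-((c'.E₄ * q * r₁ + c'.E₅ * (b - zd)) * ((c 0).E₁ + (c 0).E₃ * (M₁ / r₁ ^ 4)) -
        ((c 0).E₄ * q * r₁ + (c 0).E₅ * (b - zd)) * c'.E₁) / (2 * r₁ ^ 2) /
        ((c 0).E₁ + (c 0).E₃ * (M₁ / r₁ ^ 4)) ^ 2) 0 := by
  simp only [gOp, h.E₃]
  refine ((((h.E₄.mul_const q).mul_const r₁).add (h.E₅.mul_const (b - zd))).div
    ((h.E₁.add_const ((c 0).E₃ * (M₁ / r₁ ^ 4))).const_mul (2 * r₁ ^ 2))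
    (by positivity)).neg.congr_deriv ?_
  simp only [Pi.add_apply]
  field_simp

theorem hasDerivAt_qOp {r₁ r₂ g b zd M₂ : ℝ} (hr₁ : r₁ ≠ 0)
    (hD : (c 0).E₂ + M₂ * r₂ / r₁ ^ 4 ≠ 0) :
    HasDerivAt (fun ε => qOp (c ε) r₁ r₂ g b zd M₂)
      (-((c'.E₄ * g * r₁ ^ 2 + c'.E₆ * (b - zd)) * ((c 0).E₂ + M₂ * r₂ / r₁ ^ 4) -
        ((c 0).E₄ * g * r₁ ^ 2 + (c 0).E₆ * (b - zd)) * c'.E₂) / (2 * r₁) /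
        ((c 0).E₂ + M₂ * r₂ / r₁ ^ 4) ^ 2) 0 := by
  simp only [qOp]
  refine ((((h.E₄.mul_const g).mul_const (r₁ ^ 2)).add (h.E₆.mul_const (b - zd))).div
    ((h.E₂.add_const (M₂ * r₂ / r₁ ^ 4)).const_mul (2 * r₁))
    (by positivity)).neg.congr_deriv ?_
  simp only [Pi.add_apply]
  generalize (c 0).E₂ + M₂ * r₂ / r₁ ^ 4 = D at *
  field_simp

theorem hasDerivAt_J₁Op {r₁ q b zd M₁ : ℝ}
    (hD : (c 0).E₁ + (c 0).E₃ * (M₁ / r₁ ^ 4) ≠ 0) :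
    HasDerivAt (fun ε => J₁Op (c ε) r₁ q b zd M₁)
      (Real.pi * r₁ ^ 2 / 4 * (4 * ((c 0).E₁ + (c 0).E₃ * (M₁ / r₁ ^ 4)) ^ 2 *
          (c'.E₂ * q ^ 2 * r₁ ^ 2 + c'.E₆ * q * r₁ * (b - zd)) -
        2 * ((c 0).E₄ * q * r₁ + (c 0).E₅ * (b - zd)) * (c'.E₄ * q * r₁ + c'.E₅ * (b - zd)) *
          ((c 0).E₁ + (c 0).E₃ * (M₁ / r₁ ^ 4)) +
        ((c 0).E₄ * q * r₁ + (c 0).E₅ * (b - zd)) ^ 2 * c'.E₁) /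
        ((c 0).E₁ + (c 0).E₃ * (M₁ / r₁ ^ 4)) ^ 2) 0 := by
  simp only [J₁Op, h.E₃]
  have hN := ((h.E₄.mul_const q).mul_const r₁).add (h.E₅.mul_const (b - zd))
  have hDd := (h.E₁.add_const ((c 0).E₃ * (M₁ / r₁ ^ 4))).const_mul 4
  have hF := (((h.E₂.mul_const (q ^ 2)).mul_const (r₁ ^ 2)).add_const
    ((c 0).E₃ * (b - zd) ^ 2)).add (((h.E₆.mul_const q).mul_const r₁).mul_const (b - zd))
  refine ((((hDd.mul hF).sub (hN.pow 2)).const_mul (Real.pi * r₁ ^ 2)).div hDd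
    (by positivity)).congr_deriv ?_
  simp only [Pi.add_apply, Pi.sub_apply, Pi.mul_apply, Pi.pow_apply]
  generalize (c 0).E₁ + (c 0).E₃ * (M₁ / r₁ ^ 4) = D at *
  field_simp
  ring

theorem hasDerivAt_J₂Op {r₁ r₂ g b zd M₂ : ℝ}
    (hD : (c 0).E₂ + M₂ * r₂ / r₁ ^ 4 ≠ 0) :
    HasDerivAt (fun ε => J₂Op (c ε) r₁ r₂ g b zd M₂)
      (Real.pi * r₁ ^ 2 / 4 * (4 * ((c 0).E₂ + M₂ * r₂ / r₁ ^ 4) ^ 2 *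
          (c'.E₁ * g ^ 2 * r₁ ^ 4 + c'.E₅ * g * r₁ ^ 2 * (b - zd)) -
        2 * ((c 0).E₄ * g * r₁ ^ 2 + (c 0).E₆ * (b - zd)) *
          (c'.E₄ * g * r₁ ^ 2 + c'.E₆ * (b - zd)) * ((c 0).E₂ + M₂ * r₂ / r₁ ^ 4) +
        ((c 0).E₄ * g * r₁ ^ 2 + (c 0).E₆ * (b - zd)) ^ 2 * c'.E₂) /
        ((c 0).E₂ + M₂ * r₂ / r₁ ^ 4) ^ 2) 0 := by
  simp only [J₂Op, h.E₃]
  have hN := ((h.E₄.mul_const g).mul_const (r₁ ^ 2)).add (h.E₆.mul_const (b - zd))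
  have hDd := (h.E₂.add_const (M₂ * r₂ / r₁ ^ 4)).const_mul 4
  have hF := (((h.E₁.mul_const (g ^ 2)).mul_const (r₁ ^ 4)).add_const
    ((c 0).E₃ * (b - zd) ^ 2)).add (((h.E₅.mul_const g).mul_const (r₁ ^ 2)).mul_const (b - zd))
  refine ((((hDd.mul hF).sub (hN.pow 2)).const_mul (Real.pi * r₁ ^ 2)).div hDd
    (by positivity)).congr_deriv ?_
  simp only [Pi.add_apply, Pi.sub_apply, Pi.mul_apply, Pi.pow_apply]
  generalize (c 0).E₂ + M₂ * r₂ / r₁ ^ 4 = D at *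
  field_simp
  ring

/-- The denominator involves only `E₃`, so it is constant in `ε` and appears to the first power. -/
theorem hasDerivAt_J₃Op {r₁ g q zd M₃ : ℝ} (hD : (c 0).E₃ + M₃ / r₁ ≠ 0) :
    HasDerivAt (fun ε => J₃Op (c ε) r₁ g q zd M₃)
      (Real.pi * r₁ ^ 2 * (c'.E₁ * g ^ 2 * r₁ ^ 4 + c'.E₂ * q ^ 2 * r₁ ^ 2 +
          c'.E₄ * g * q * r₁ ^ 3 - c'.E₅ * g * r₁ ^ 2 * zd - c'.E₆ * q * r₁ * zd -
        (-2 * (c 0).E₃ * zd + (c 0).E₅ * g * r₁ ^ 2 + (c 0).E₆ * q * r₁) *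
          (c'.E₅ * g * r₁ ^ 2 + c'.E₆ * q * r₁) / (2 * ((c 0).E₃ + M₃ / r₁)))) 0 := by
  simp only [J₃Op, h.E₃]
  have hN := ((h.E₅.mul_const g).mul_const (r₁ ^ 2)).const_add (-2 * (c 0).E₃ * zd) |>.add
    ((h.E₆.mul_const q).mul_const r₁)
  have hF := ((((((h.E₁.mul_const (g ^ 2)).mul_const (r₁ ^ 4)).add
    ((h.E₂.mul_const (q ^ 2)).mul_const (r₁ ^ 2))).add_const ((c 0).E₃ * zd ^ 2)).add
    (((h.E₄.mul_const g).mul_const q).mul_const (r₁ ^ 3))).sub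
    (((h.E₅.mul_const g).mul_const (r₁ ^ 2)).mul_const zd)).sub
    (((h.E₆.mul_const q).mul_const r₁).mul_const zd)
  refine (((hF.const_mul (4 * ((c 0).E₃ + M₃ / r₁))).sub (hN.pow 2)).mul_const
    (Real.pi * r₁ ^ 2 / (4 * ((c 0).E₃ + M₃ / r₁)))).congr_deriv ?_
  simp only [Pi.add_apply]
  generalize (c 0).E₃ + M₃ / r₁ = D at *
  field_simp
  ring

theorem hasDerivAt_den₄ (r₁ r₂ M₄ M₅ : ℝ) :
    HasDerivAt (fun ε => den₄ (c ε) r₁ r₂ M₄ M₅)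
      (4 * c'.E₁ * ((c 0).E₂ + M₅ * r₂ / r₁ ^ 4) +
        4 * ((c 0).E₁ + (c 0).E₃ * (M₄ / r₁ ^ 4)) * c'.E₂ - 2 * (c 0).E₄ * c'.E₄) 0 := by
  simp only [den₄, h.E₃]
  refine ((((h.E₁.add_const ((c 0).E₃ * (M₄ / r₁ ^ 4))).const_mul 4).mul
    (h.E₂.add_const (M₅ * r₂ / r₁ ^ 4))).sub (h.E₄.pow 2)).congr_deriv ?_
  simp

theorem hasDerivAt_delta₂ {r₁ r₂ M₄ M₅ : ℝ} (hden : den₄ (c 0) r₁ r₂ M₄ M₅ ≠ 0) :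
    HasDerivAt (fun ε => delta₂ (c ε) r₁ r₂ M₄ M₅)
      (((c'.E₄ * (c 0).E₆ + (c 0).E₄ * c'.E₆ - (2 * c'.E₅ * ((c 0).E₂ + M₅ * r₂ / r₁ ^ 4) +
          2 * (c 0).E₅ * c'.E₂)) * den₄ (c 0) r₁ r₂ M₄ M₅ -
        ((c 0).E₄ * (c 0).E₆ - 2 * (c 0).E₅ * ((c 0).E₂ + M₅ * r₂ / r₁ ^ 4)) *
          (4 * c'.E₁ * ((c 0).E₂ + M₅ * r₂ / r₁ ^ 4) +
          4 * ((c 0).E₁ + (c 0).E₃ * (M₄ / r₁ ^ 4)) * c'.E₂ - 2 * (c 0).E₄ * c'.E₄)) /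
        den₄ (c 0) r₁ r₂ M₄ M₅ ^ 2) 0 := by
  simp only [delta₂]
  exact ((h.E₄.mul h.E₆).sub ((h.E₅.const_mul 2).mul
    (h.E₂.add_const (M₅ * r₂ / r₁ ^ 4)))).div (hasDerivAt_den₄ h r₁ r₂ M₄ M₅) hden

theorem hasDerivAt_pi₂ {r₁ r₂ M₄ M₅ : ℝ} (hden : den₄ (c 0) r₁ r₂ M₄ M₅ ≠ 0) :
    HasDerivAt (fun ε => pi₂ (c ε) r₁ r₂ M₄ M₅)
      (((c'.E₄ * (c 0).E₅ + (c 0).E₄ * c'.E₅ -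
          (2 * c'.E₆ * ((c 0).E₁ + (c 0).E₃ * (M₄ / r₁ ^ 4)) +
          2 * (c 0).E₆ * c'.E₁)) * den₄ (c 0) r₁ r₂ M₄ M₅ -
        ((c 0).E₄ * (c 0).E₅ - 2 * (c 0).E₆ * ((c 0).E₁ + (c 0).E₃ * (M₄ / r₁ ^ 4))) *
          (4 * c'.E₁ * ((c 0).E₂ + M₅ * r₂ / r₁ ^ 4) +
          4 * ((c 0).E₁ + (c 0).E₃ * (M₄ / r₁ ^ 4)) * c'.E₂ - 2 * (c 0).E₄ * c'.E₄)) /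
        den₄ (c 0) r₁ r₂ M₄ M₅ ^ 2) 0 := by
  have := hasDerivAt_den₄ h r₁ r₂ M₄ M₅
  simp only [pi₂, h.E₃]
  exact ((h.E₄.mul h.E₅).sub ((h.E₆.const_mul 2).mul
    (h.E₁.add_const ((c 0).E₃ * (M₄ / r₁ ^ 4))))).div this hden

/-- The derivative of the optimal value is the derivative of the form at the optimal control. -/
theorem hasDerivAt_J₄Op {r₁ r₂ b zd M₄ M₅ nD nP : ℝ} (hden : den₄ (c 0) r₁ r₂ M₄ M₅ ≠ 0)
    (hn : nD = (c 0).E₄ * (c 0).E₆ - 2 * (c 0).E₅ * ((c 0).E₂ + M₅ * r₂ / r₁ ^ 4))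
    (hP : nP = (c 0).E₄ * (c 0).E₅ - 2 * (c 0).E₆ * ((c 0).E₁ + (c 0).E₃ * (M₄ / r₁ ^ 4))) :
    HasDerivAt (fun ε => J₄Op (c ε) r₁ r₂ b zd M₄ M₅)
      ((b - zd) ^ 2 * (Real.pi * r₁ ^ 2 * (c'.E₁ * nD ^ 2 + c'.E₂ * nP ^ 2 + c'.E₄ * nD * nP +
        (c'.E₅ * nD + c'.E₆ * nP) * den₄ (c 0) r₁ r₂ M₄ M₅) /
        den₄ (c 0) r₁ r₂ M₄ M₅ ^ 2)) 0 := by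
  have h0 := hasDerivAt_den₄ h r₁ r₂ M₄ M₅
  have hA := h.E₁.add_const ((c 0).E₃ * (M₄ / r₁ ^ 4))
  have hB := h.E₂.add_const (M₅ * r₂ / r₁ ^ 4)
  simp only [J₄Op, h.E₃]
  refine (((hasDerivAt_const (0 : ℝ) (Real.pi * r₁ ^ 2 * (b - zd) ^ 2)).div h0 hden).mul
    ((((((hA.const_mul (4 * (c 0).E₃)).mul hB).sub ((h.E₆.pow 2).mul hA)).sub
      ((h.E₅.pow 2).mul hB)).sub ((h.E₄.pow 2).const_mul (c 0).E₃)).add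
      ((h.E₄.mul h.E₅).mul h.E₆))).congr_deriv ?_
  simp only [Pi.add_apply, Pi.sub_apply, Pi.mul_apply, Pi.pow_apply, Pi.div_apply, hn, hP]
  -- The formula is an identity only modulo the relation `D = 4AB - E₄²`, which is kept while `A`,
  -- `B`, `D` become symbols.
  have hd : den₄ (c 0) r₁ r₂ M₄ M₅ = 4 * ((c 0).E₁ + (c 0).E₃ * (M₄ / r₁ ^ 4)) *
    ((c 0).E₂ + M₅ * r₂ / r₁ ^ 4) - (c 0).E₄ ^ 2 := rfl
  generalize den₄ (c 0) r₁ r₂ M₄ M₅ = D at hden hd ⊢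
  generalize (c 0).E₂ + M₅ * r₂ / r₁ ^ 4 = B at hd ⊢
  generalize (c 0).E₁ + (c 0).E₃ * (M₄ / r₁ ^ 4) = A at hd ⊢
  field_simp
  rw [hd]
  ring

end

/-! ## The limit constants -/

/-- The derivative of the form at `ε = 0` is a product of two linear forms. -/
theorem coeffsDeriv_form_eq (r₁ r₂ x y d : ℝ) :
    (coeffsDeriv r₁ r₂).E₁ * x ^ 2 + (coeffsDeriv r₁ r₂).E₂ * y ^ 2 +
      (coeffsDeriv r₁ r₂).E₄ * x * y +
      ((coeffsDeriv r₁ r₂).E₅ * x + (coeffsDeriv r₁ r₂).E₆ * y) * d =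
    1 / r₁ * ((((r₂ / r₁) ^ 2 - 1) / 2 * x - r₂ / r₁ * y) *
      ((-(3 / 2) * (r₂ / r₁) ^ 4 + 2 * (r₂ / r₁) ^ 2 - 1 / 2 +
          2 * Real.log (r₂ / r₁) * (r₂ / r₁) ^ 4) / 4 * x -
        (2 * (r₂ / r₁) + (r₂ / r₁) ^ 3 * (4 * Real.log (r₂ / r₁) - 2)) / 4 * y +
        ((r₂ / r₁) ^ 2 - 1) * d)) := by
  simp only [coeffsDeriv]
  ring

section

variable {r₁ r₂ : ℝ} (hr₁ : 0 < r₁) (hr₂ : r₁ < r₂)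
include hr₁

/-- The displayed denominators are `r₁` times squares of the optimal-control denominators at `ε =
0`; the monomial factor clears fractions. -/
theorem denG_eq (r₂ M₁ : ℝ) : denG r₁ r₂ M₁ = r₁ * (-192 * r₁ ^ 6 *
    ((coeffs r₁ r₂ 0).E₁ + (coeffs r₁ r₂ 0).E₃ * (M₁ / r₁ ^ 4))) ^ 2 := by
  simp only [denG, coeffs]
  congr 2
  generalize Real.log (r₂ / r₁) = L
  field_simp
  ring

/-- Stated for the base of the square because `limQ` and `limJ2` carry different prefactors. -/
theorem denQ_base_eq {r₂ : ℝ} (hr₂ : r₂ ≠ 0) (M₂ : ℝ) :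
    4 * M₂ - r₁ ^ 2 * r₂ + 2 * r₂ ^ 3 * Real.log (r₂ / r₁) ^ 2 -
      2 * r₂ ^ 3 * Real.log (r₂ / r₁) + r₂ ^ 3 =
    4 * r₁ ^ 4 / r₂ * ((coeffs r₁ r₂ 0).E₂ + M₂ * r₂ / r₁ ^ 4) := by
  simp only [coeffs]
  generalize Real.log (r₂ / r₁) = L
  field_simp
  ring

theorem denP_eq {r₂ : ℝ} (hr₂ : r₂ ≠ 0) (M₄ M₅ : ℝ) : denP r₁ r₂ M₄ M₅ =
    r₁ * (-3072 * r₁ ^ 10 / r₂ * den₄ (coeffs r₁ r₂ 0) r₁ r₂ M₄ M₅) ^ 2 := by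
  simp only [denP, den₄, coeffs]
  congr 2
  generalize Real.log (r₂ / r₁) = L
  field_simp
  ring

/-- The same square as `denP`, displayed in expanded form. -/
theorem denJ4_eq {r₂ : ℝ} (hr₂ : r₂ ≠ 0) (M₄ M₅ : ℝ) : denJ4 r₁ r₂ M₄ M₅ =
    r₁ * (-3072 * r₁ ^ 10 / r₂ * den₄ (coeffs r₁ r₂ 0) r₁ r₂ M₄ M₅) ^ 2 := by
  simp only [denJ4, den₄, coeffs]
  congr 2
  generalize Real.log (r₂ / r₁) = L
  field_simp
  ring

include hr₂

theorem convergesWithRate_gOp {M₁ : ℝ} (hM₁ : 0 < M₁) (q b zd : ℝ) :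
    ConvergesWithRate (fun α => gOp (Eα r₁ r₂ α) r₁ q b zd M₁)
      (gOp (E r₁ r₂) r₁ q b zd M₁) (limG r₁ r₂ q b zd M₁) := by
  have hD := (coeffs_E₁_add_pos hr₁ hr₂ 0 hM₁).ne'
  refine convergesWithRate_of_hasDerivAt (hasDerivAt_gOp (hasCoeffsDeriv_coeffs r₁ r₂) hr₁.ne' hD)
    (fun α _ => by rw [Eα_eq_coeffs]) (by rw [E_eq_coeffs]) ?_
  simp only [limG, denG_eq hr₁]
  refine abs_div_sq_eq hD hr₁ (by simp [hr₁.ne']) (by norm_num) (Or.inl ?_)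
  simp only [coeffs, coeffsDeriv]
  generalize Real.log (r₂ / r₁) = L
  field_simp
  ring

theorem convergesWithRate_qOp {M₂ : ℝ} (hM₂ : 0 < M₂) (g b zd : ℝ) :
    ConvergesWithRate (fun α => qOp (Eα r₁ r₂ α) r₁ r₂ g b zd M₂)
      (qOp (E r₁ r₂) r₁ r₂ g b zd M₂) (limQ r₁ r₂ g b zd M₂) := by
  have hr₂' := hr₁.trans hr₂
  have hD := (coeffs_E₂_add_pos hr₁ hr₂ 0 hM₂).ne'
  refine convergesWithRate_of_hasDerivAt (hasDerivAt_qOp (hasCoeffsDeriv_coeffs r₁ r₂) hr₁.ne' hD)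
    (fun α _ => by rw [Eα_eq_coeffs]) (by rw [E_eq_coeffs]) ?_
  simp only [limQ, denQ, denQ_base_eq hr₁ hr₂'.ne']
  refine abs_div_sq_eq hD (by positivity) (by positivity) (by norm_num) (Or.inr ?_)
  simp only [coeffs, coeffsDeriv]
  generalize Real.log (r₂ / r₁) = L
  field_simp
  ring

/-- The denominator is constant in `ε`, and `E₅`, `E₆` are affine in it. Hence the optimal `b` is
affine in `1/α`, and the rate is an exact equality. -/
theorem bOp_coeffs_sub {M₃ : ℝ} (hM₃ : 0 < M₃) (g q zd ε : ℝ) :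
    bOp (coeffs r₁ r₂ ε) r₁ g q zd M₃ - bOp (coeffs r₁ r₂ 0) r₁ g q zd M₃ =
      ε * ((r₁ ^ 2 - r₂ ^ 2) * (g * (r₁ ^ 2 - r₂ ^ 2) + 2 * q * r₂) /
        (2 * r₁ * (-2 * M₃ * r₁ + r₁ ^ 2 - r₂ ^ 2))) := by
  -- The quantity is negative, being `-2 M₃ r₁ - (r₂² - r₁²)`.
  have h1 : -2 * M₃ * r₁ + r₁ ^ 2 - r₂ ^ 2 ≠ 0 := by
    have : 0 < M₃ * r₁ := by positivity
    nlinarith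
  have h2 : (r₂ ^ 2 - r₁ ^ 2) / (2 * r₁ ^ 2) + M₃ / r₁ =
      -(-2 * M₃ * r₁ + r₁ ^ 2 - r₂ ^ 2) / (2 * r₁ ^ 2) := by
    field_simp
    ring
  simp only [bOp, coeffs_E₃ hr₁, h2]
  generalize -2 * M₃ * r₁ + r₁ ^ 2 - r₂ ^ 2 = D at h1 ⊢
  simp only [coeffs]
  generalize Real.log (r₂ / r₁) = L
  field_simp
  ring

theorem abs_bOp_sub {M₃ : ℝ} (hM₃ : 0 < M₃) (g q zd : ℝ) {α : ℝ} (hα : 0 < α) :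
    |bOp (Eα r₁ r₂ α) r₁ g q zd M₃ - bOp (E r₁ r₂) r₁ g q zd M₃| =
      1 / α * limB r₁ r₂ g q M₃ := by
  rw [Eα_eq_coeffs, E_eq_coeffs, bOp_coeffs_sub hr₁ hr₂ hM₃, abs_mul,
    abs_of_pos (one_div_pos.2 hα), limB]

theorem convergesWithRate_bOp {M₃ : ℝ} (hM₃ : 0 < M₃) (g q zd : ℝ) :
    ConvergesWithRate (fun α => bOp (Eα r₁ r₂ α) r₁ g q zd M₃)
      (bOp (E r₁ r₂) r₁ g q zd M₃) (limB r₁ r₂ g q M₃) := by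
  have hd : HasDerivAt (fun ε => bOp (coeffs r₁ r₂ ε) r₁ g q zd M₃)
      ((r₁ ^ 2 - r₂ ^ 2) * (g * (r₁ ^ 2 - r₂ ^ 2) + 2 * q * r₂) /
        (2 * r₁ * (-2 * M₃ * r₁ + r₁ ^ 2 - r₂ ^ 2))) 0 := by
    have h : (fun ε => bOp (coeffs r₁ r₂ ε) r₁ g q zd M₃) = fun ε =>
        ε * ((r₁ ^ 2 - r₂ ^ 2) * (g * (r₁ ^ 2 - r₂ ^ 2) + 2 * q * r₂) /
          (2 * r₁ * (-2 * M₃ * r₁ + r₁ ^ 2 - r₂ ^ 2))) + bOp (coeffs r₁ r₂ 0) r₁ g q zd M₃ := by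
      ext ε
      rw [← bOp_coeffs_sub hr₁ hr₂ hM₃, sub_add_cancel]
    rw [h]
    exact (((hasDerivAt_id' (0 : ℝ)).mul_const _).add_const _).congr_deriv (one_mul _)
  exact convergesWithRate_of_hasDerivAt hd (fun α _ => by rw [Eα_eq_coeffs])
    (by rw [E_eq_coeffs]) rfl

theorem convergesWithRate_gqOp_fst {M₄ M₅ : ℝ} (hM₄ : 0 < M₄) (hM₅ : 0 < M₅) (b zd : ℝ) :
    ConvergesWithRate (fun α => (gqOp (Eα r₁ r₂ α) r₁ r₂ b zd M₄ M₅).1)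
      (gqOp (E r₁ r₂) r₁ r₂ b zd M₄ M₅).1 (limG4 r₁ r₂ b zd M₄ M₅) := by
  have hr₂' := hr₁.trans hr₂
  have hD := (den₄_coeffs_pos hr₁ hr₂ 0 hM₄ hM₅).ne'
  refine convergesWithRate_of_hasDerivAt
    ((hasDerivAt_delta₂ (hasCoeffsDeriv_coeffs r₁ r₂) hD).const_mul ((b - zd) / r₁ ^ 2))
    (fun α _ => by rw [Eα_eq_coeffs, gqOp]) (by rw [E_eq_coeffs, gqOp]) ?_
  simp only [limG4, denP_eq hr₁ hr₂'.ne']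
  refine abs_mul_div_sq_eq hD hr₁ (by simp [hr₁.ne', hr₂'.ne']) (by norm_num) (Or.inl ?_)
  simp only [den₄, coeffs, coeffsDeriv]
  generalize Real.log (r₂ / r₁) = L
  field_simp
  ring

theorem convergesWithRate_gqOp_snd {M₄ M₅ : ℝ} (hM₄ : 0 < M₄) (hM₅ : 0 < M₅) (b zd : ℝ) :
    ConvergesWithRate (fun α => (gqOp (Eα r₁ r₂ α) r₁ r₂ b zd M₄ M₅).2)
      (gqOp (E r₁ r₂) r₁ r₂ b zd M₄ M₅).2 (limQ4 r₁ r₂ b zd M₄ M₅) := by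
  have hr₂' := hr₁.trans hr₂
  have hD := (den₄_coeffs_pos hr₁ hr₂ 0 hM₄ hM₅).ne'
  refine convergesWithRate_of_hasDerivAt
    ((hasDerivAt_pi₂ (hasCoeffsDeriv_coeffs r₁ r₂) hD).const_mul ((b - zd) / r₁))
    (fun α _ => by rw [Eα_eq_coeffs, gqOp]) (by rw [E_eq_coeffs, gqOp]) ?_
  simp only [limQ4, denP_eq hr₁ hr₂'.ne']
  refine abs_mul_div_sq_eq hD hr₁ (by simp [hr₁.ne', hr₂'.ne']) (by norm_num) (Or.inr ?_)
  simp only [den₄, coeffs, coeffsDeriv]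
  generalize Real.log (r₂ / r₁) = L
  field_simp
  ring

/-- The curve `x` is left abstract because the minimal value of the functional equals the closed
formula only for `α > 0`. -/
theorem convergesWithRate_J₁Op {M₁ : ℝ} (hM₁ : 0 < M₁) (q b zd : ℝ) {x : ℝ → ℝ} {l : ℝ}
    (hx : ∀ α > 0, x α = J₁Op (Eα r₁ r₂ α) r₁ q b zd M₁)
    (hl : l = J₁Op (E r₁ r₂) r₁ q b zd M₁) :
    ConvergesWithRate x l (limJ1 r₁ r₂ q b zd M₁) := by
  have hD := (coeffs_E₁_add_pos hr₁ hr₂ 0 hM₁).ne'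
  refine convergesWithRate_of_hasDerivAt (hasDerivAt_J₁Op (hasCoeffsDeriv_coeffs r₁ r₂) hD)
    (fun α hα => by rw [hx α hα, Eα_eq_coeffs]) (by rw [hl, E_eq_coeffs]) ?_
  simp only [limJ1, denG_eq hr₁]
  rw [← mul_assoc (16 : ℝ)]
  refine abs_div_sq_eq hD (by positivity) (by simp [hr₁.ne']) Real.pi_nonneg (Or.inr ?_)
  simp only [coeffs, coeffsDeriv]
  generalize Real.log (r₂ / r₁) = L
  field_simp
  ring

theorem convergesWithRate_J₂Op {M₂ : ℝ} (hM₂ : 0 < M₂) (g b zd : ℝ) {x : ℝ → ℝ} {l : ℝ}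
    (hx : ∀ α > 0, x α = J₂Op (Eα r₁ r₂ α) r₁ r₂ g b zd M₂)
    (hl : l = J₂Op (E r₁ r₂) r₁ r₂ g b zd M₂) :
    ConvergesWithRate x l (limJ2 r₁ r₂ g b zd M₂) := by
  have hr₂' := hr₁.trans hr₂
  have hD := (coeffs_E₂_add_pos hr₁ hr₂ 0 hM₂).ne'
  refine convergesWithRate_of_hasDerivAt (hasDerivAt_J₂Op (hasCoeffsDeriv_coeffs r₁ r₂) hD)
    (fun α hα => by rw [hx α hα, Eα_eq_coeffs]) (by rw [hl, E_eq_coeffs]) ?_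
  simp only [limJ2, denQ_base_eq hr₁ hr₂'.ne']
  refine abs_div_sq_eq hD (by positivity) (by positivity) Real.pi_nonneg (Or.inl ?_)
  simp only [coeffs, coeffsDeriv]
  generalize Real.log (r₂ / r₁) = L
  field_simp
  ring

theorem convergesWithRate_J₃Op {M₃ : ℝ} (hM₃ : 0 < M₃) (g q zd : ℝ) {x : ℝ → ℝ} {l : ℝ}
    (hx : ∀ α > 0, x α = J₃Op (Eα r₁ r₂ α) r₁ g q zd M₃)
    (hl : l = J₃Op (E r₁ r₂) r₁ g q zd M₃) :
    ConvergesWithRate x l (limJ3 r₁ r₂ g q zd M₃) := by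
  have hD := (coeffs_E₃_add_pos hr₁ hr₂ 0 hM₃).ne'
  refine convergesWithRate_of_hasDerivAt (hasDerivAt_J₃Op (hasCoeffsDeriv_coeffs r₁ r₂) hD)
    (fun α hα => by rw [hx α hα, Eα_eq_coeffs]) (by rw [hl, E_eq_coeffs]) ?_
  have h1 : -2 * M₃ * r₁ + r₁ ^ 2 - r₂ ^ 2 ≠ 0 := by
    have : 0 < M₃ * r₁ := by positivity
    nlinarith
  have h2 : (r₂ ^ 2 - r₁ ^ 2) / (2 * r₁ ^ 2) + M₃ / r₁ =
      -(-2 * M₃ * r₁ + r₁ ^ 2 - r₂ ^ 2) / (2 * r₁ ^ 2) := by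
    field_simp
    ring
  simp only [limJ3]
  -- The separate absolute values are merged into one and the sign is flipped, so that the arguments
  -- can be compared directly.
  rw [← abs_of_pos Real.pi_pos, ← abs_mul, ← abs_div, ← abs_mul, ← abs_neg,
    abs_of_pos Real.pi_pos]
  congr 1
  simp only [coeffs_E₃ hr₁, h2]
  -- Expressing `M₃` through the denominator `D` lets `D` be treated as an independent nonzero
  -- symbol.
  have hM : M₃ = -((-2 * M₃ * r₁ + r₁ ^ 2 - r₂ ^ 2) - r₁ ^ 2 + r₂ ^ 2) / (2 * r₁) := by
    field_simp
    ring
  generalize hDdef : -2 * M₃ * r₁ + r₁ ^ 2 - r₂ ^ 2 = D at h1 hM ⊢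
  simp only [coeffs, coeffsDeriv, hM]
  generalize Real.log (r₂ / r₁) = L
  field_simp
  ring

theorem convergesWithRate_J₄Op {M₄ M₅ : ℝ} (hM₄ : 0 < M₄) (hM₅ : 0 < M₅) (b zd : ℝ)
    {x : ℝ → ℝ} {l : ℝ} (hx : ∀ α > 0, x α = J₄Op (Eα r₁ r₂ α) r₁ r₂ b zd M₄ M₅)
    (hl : l = J₄Op (E r₁ r₂) r₁ r₂ b zd M₄ M₅) :
    ConvergesWithRate x l (limJ4 r₁ r₂ b zd M₄ M₅) := by
  have hr₂' := hr₁.trans hr₂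
  have hD := (den₄_coeffs_pos hr₁ hr₂ 0 hM₄ hM₅).ne'
  refine convergesWithRate_of_hasDerivAt (hasDerivAt_J₄Op (hasCoeffsDeriv_coeffs r₁ r₂) hD rfl rfl)
    (fun α hα => by rw [hx α hα, Eα_eq_coeffs]) (by rw [hl, E_eq_coeffs]) ?_
  simp only [limJ4, denJ4_eq hr₁ hr₂'.ne', coeffsDeriv_form_eq]
  rw [abs_mul, abs_of_nonneg (sq_nonneg (b - zd)), mul_comm (4 * Real.pi),
    mul_div_assoc ((b - zd) ^ 2), mul_assoc ((b - zd) ^ 2)]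
  congr 1
  -- Here `a₁` and `a₂` are the two linear forms of `coeffsDeriv_form_eq` at the optimal control,
  -- with denominators cleared. The scales `κ₁`, `κ₂` turn them into the two displayed polynomial
  -- factors.
  refine abs_div_sq_eq hD hr₁ (by simp [hr₁.ne', hr₂'.ne']) (by positivity)
    (Or.inr (eq_neg_mul_of_factors (κ₁ := -768 * r₁ ^ 10 / r₂) (κ₂ := 3072 * r₁ ^ 12 / r₂)
      (a₁ := ((r₂ / r₁) ^ 2 - 1) / 2 * ((coeffs r₁ r₂ 0).E₄ * (coeffs r₁ r₂ 0).E₆ -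
        2 * (coeffs r₁ r₂ 0).E₅ * ((coeffs r₁ r₂ 0).E₂ + M₅ * r₂ / r₁ ^ 4)) -
        r₂ / r₁ * ((coeffs r₁ r₂ 0).E₄ * (coeffs r₁ r₂ 0).E₅ - 2 * (coeffs r₁ r₂ 0).E₆ *
          ((coeffs r₁ r₂ 0).E₁ + (coeffs r₁ r₂ 0).E₃ * (M₄ / r₁ ^ 4))))
      (a₂ := (-(3 / 2) * (r₂ / r₁) ^ 4 + 2 * (r₂ / r₁) ^ 2 - 1 / 2 +
          2 * Real.log (r₂ / r₁) * (r₂ / r₁) ^ 4) / 4 *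
          ((coeffs r₁ r₂ 0).E₄ * (coeffs r₁ r₂ 0).E₆ -
        2 * (coeffs r₁ r₂ 0).E₅ * ((coeffs r₁ r₂ 0).E₂ + M₅ * r₂ / r₁ ^ 4)) -
        (2 * (r₂ / r₁) + (r₂ / r₁) ^ 3 * (4 * Real.log (r₂ / r₁) - 2)) / 4 *
          ((coeffs r₁ r₂ 0).E₄ * (coeffs r₁ r₂ 0).E₅ - 2 * (coeffs r₁ r₂ 0).E₆ *
          ((coeffs r₁ r₂ 0).E₁ + (coeffs r₁ r₂ 0).E₃ * (M₄ / r₁ ^ 4))) +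
        ((r₂ / r₁) ^ 2 - 1) * den₄ (coeffs r₁ r₂ 0) r₁ r₂ M₄ M₅) ?_ ?_ ?_))
  · simp only [coeffs]
    generalize Real.log (r₂ / r₁) = L
    field_simp
    ring
  · simp only [den₄, coeffs]
    generalize Real.log (r₂ / r₁) = L
    field_simp
    ring
  · field_simp
    ring

end

/-! ### Minimizers and optimal values of the eight functionals -/

section

variable {r₁ r₂ : ℝ} (hr₁ : 0 < r₁) (hr₂ : r₁ < r₂)
include hr₁ hr₂

theorem half_normSqH_stateS (g q b z : ℝ) :
    1 / 2 * normSqH r₁ r₂ (fun x => stateS r₁ r₂ g q b x - z) =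
      Real.pi * r₁ ^ 2 * (coeffs r₁ r₂ 0).form r₁ g q (b - z) := by
  rw [normSqH_congr (eqOn_stateS hr₁ hr₂ g q b), half_normSqH_radialState hr₁ hr₂]

theorem half_normSqH_stateSα {α : ℝ} (hα : 0 < α) (g q b z : ℝ) :
    1 / 2 * normSqH r₁ r₂ (fun x => stateSα r₁ r₂ α g q b x - z) =
      Real.pi * r₁ ^ 2 * (coeffs r₁ r₂ (1 / α)).form r₁ g q (b - z) := by
  rw [normSqH_congr (eqOn_stateSα hr₁ hr₂ g q b hα), half_normSqH_radialState hr₁ hr₂]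

theorem isUniqueMin_J₁ {M₁ : ℝ} (hM₁ : 0 < M₁) (q b zd : ℝ) :
    IsUniqueMin (J₁ r₁ r₂ q b zd M₁) (gOp (E r₁ r₂) r₁ q b zd M₁) ∧
      J₁ r₁ r₂ q b zd M₁ (gOp (E r₁ r₂) r₁ q b zd M₁) = J₁Op (E r₁ r₂) r₁ q b zd M₁ := by
  rw [E_eq_coeffs]
  exact isUniqueMin_gOp hr₁ hr₂ 0 hM₁ fun g => by
    rw [J₁, half_normSqH_stateS hr₁ hr₂, normSqH_const hr₁ hr₂]

theorem isUniqueMin_J₁α {M₁ : ℝ} (hM₁ : 0 < M₁) (q b zd : ℝ) {α : ℝ} (hα : 0 < α) :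
    IsUniqueMin (J₁α r₁ r₂ q b zd M₁ α) (gOp (Eα r₁ r₂ α) r₁ q b zd M₁) ∧
      J₁α r₁ r₂ q b zd M₁ α (gOp (Eα r₁ r₂ α) r₁ q b zd M₁) =
        J₁Op (Eα r₁ r₂ α) r₁ q b zd M₁ := by
  rw [Eα_eq_coeffs]
  exact isUniqueMin_gOp hr₁ hr₂ (1 / α) hM₁ fun g => by
    rw [J₁α, half_normSqH_stateSα hr₁ hr₂ hα, normSqH_const hr₁ hr₂]

theorem isUniqueMin_J₂ {M₂ : ℝ} (hM₂ : 0 < M₂) (g b zd : ℝ) :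
    IsUniqueMin (J₂ r₁ r₂ g b zd M₂) (qOp (E r₁ r₂) r₁ r₂ g b zd M₂) ∧
      J₂ r₁ r₂ g b zd M₂ (qOp (E r₁ r₂) r₁ r₂ g b zd M₂) = J₂Op (E r₁ r₂) r₁ r₂ g b zd M₂ := by
  rw [E_eq_coeffs]
  exact isUniqueMin_qOp hr₁ hr₂ 0 hM₂ fun q => by
    rw [J₂, half_normSqH_stateS hr₁ hr₂, normSqCircle_const]

theorem isUniqueMin_J₂α {M₂ : ℝ} (hM₂ : 0 < M₂) (g b zd : ℝ) {α : ℝ} (hα : 0 < α) :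
    IsUniqueMin (J₂α r₁ r₂ g b zd M₂ α) (qOp (Eα r₁ r₂ α) r₁ r₂ g b zd M₂) ∧
      J₂α r₁ r₂ g b zd M₂ α (qOp (Eα r₁ r₂ α) r₁ r₂ g b zd M₂) =
        J₂Op (Eα r₁ r₂ α) r₁ r₂ g b zd M₂ := by
  rw [Eα_eq_coeffs]
  exact isUniqueMin_qOp hr₁ hr₂ (1 / α) hM₂ fun q => by
    rw [J₂α, half_normSqH_stateSα hr₁ hr₂ hα, normSqCircle_const]

theorem isUniqueMin_J₃ {M₃ : ℝ} (hM₃ : 0 < M₃) (g q zd : ℝ) :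
    IsUniqueMin (J₃ r₁ r₂ g q zd M₃) (bOp (E r₁ r₂) r₁ g q zd M₃) ∧
      J₃ r₁ r₂ g q zd M₃ (bOp (E r₁ r₂) r₁ g q zd M₃) = J₃Op (E r₁ r₂) r₁ g q zd M₃ := by
  rw [E_eq_coeffs]
  exact isUniqueMin_bOp hr₁ hr₂ 0 hM₃ fun b => by
    rw [J₃, half_normSqH_stateS hr₁ hr₂, normSqCircle_const]

theorem isUniqueMin_J₃α {M₃ : ℝ} (hM₃ : 0 < M₃) (g q zd : ℝ) {α : ℝ} (hα : 0 < α) :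
    IsUniqueMin (J₃α r₁ r₂ g q zd M₃ α) (bOp (Eα r₁ r₂ α) r₁ g q zd M₃) ∧
      J₃α r₁ r₂ g q zd M₃ α (bOp (Eα r₁ r₂ α) r₁ g q zd M₃) =
        J₃Op (Eα r₁ r₂ α) r₁ g q zd M₃ := by
  rw [Eα_eq_coeffs]
  exact isUniqueMin_bOp hr₁ hr₂ (1 / α) hM₃ fun b => by
    rw [J₃α, half_normSqH_stateSα hr₁ hr₂ hα, normSqCircle_const]

theorem isUniqueMin_J₄ {M₄ M₅ : ℝ} (hM₄ : 0 < M₄) (hM₅ : 0 < M₅) (b zd : ℝ) :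
    IsUniqueMin (J₄ r₁ r₂ b zd M₄ M₅) (gqOp (E r₁ r₂) r₁ r₂ b zd M₄ M₅) ∧
      J₄ r₁ r₂ b zd M₄ M₅ (gqOp (E r₁ r₂) r₁ r₂ b zd M₄ M₅) =
        J₄Op (E r₁ r₂) r₁ r₂ b zd M₄ M₅ := by
  rw [E_eq_coeffs]
  exact isUniqueMin_gqOp hr₁ hr₂ 0 hM₄ hM₅ fun x => by
    rw [J₄, half_normSqH_stateS hr₁ hr₂, normSqH_const hr₁ hr₂, normSqCircle_const]

theorem isUniqueMin_J₄α {M₄ M₅ : ℝ} (hM₄ : 0 < M₄) (hM₅ : 0 < M₅) (b zd : ℝ) {α : ℝ}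
    (hα : 0 < α) :
    IsUniqueMin (J₄α r₁ r₂ b zd M₄ M₅ α) (gqOp (Eα r₁ r₂ α) r₁ r₂ b zd M₄ M₅) ∧
      J₄α r₁ r₂ b zd M₄ M₅ α (gqOp (Eα r₁ r₂ α) r₁ r₂ b zd M₄ M₅) =
        J₄Op (Eα r₁ r₂ α) r₁ r₂ b zd M₄ M₅ := by
  rw [Eα_eq_coeffs]
  exact isUniqueMin_gqOp hr₁ hr₂ (1 / α) hM₄ hM₅ fun x => by
    rw [J₄α, half_normSqH_stateSα hr₁ hr₂ hα, normSqH_const hr₁ hr₂, normSqCircle_const]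

end

end AnnulusControl

/-! ### Assembly of the theorem -/

theorem mainTheorem2 (r₁ r₂ : ℝ) (hr₁ : 0 < r₁) (hr₂ : r₁ < r₂)
    (M₁ M₂ M₃ M₄ M₅ : ℝ) (hM₁ : 0 < M₁) (hM₂ : 0 < M₂) (hM₃ : 0 < M₃) (hM₄ : 0 < M₄)
    (hM₅ : 0 < M₅) :
    -- the states exist and are unique
    (∀ g q b : ℝ, ∃ u, IsStateS r₁ r₂ g q b u ∧
      ∀ v, IsStateS r₁ r₂ g q b v → Set.EqOn v u (closedAnnulus r₁ r₂)) ∧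
    (∀ α : ℝ, 0 < α → ∀ g q b : ℝ, ∃ u, IsStateSα r₁ r₂ α g q b u ∧
      ∀ v, IsStateSα r₁ r₂ α g q b v → Set.EqOn v u (closedAnnulus r₁ r₂)) ∧
    -- i) distributed control
    (∀ q b zd : ℝ,
      (IsUniqueMin (J₁ r₁ r₂ q b zd M₁) (gOp (E r₁ r₂) r₁ q b zd M₁) ∧
        J₁ r₁ r₂ q b zd M₁ (gOp (E r₁ r₂) r₁ q b zd M₁) = J₁Op (E r₁ r₂) r₁ q b zd M₁) ∧
      ∀ α : ℝ, 0 < α →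
        IsUniqueMin (J₁α r₁ r₂ q b zd M₁ α) (gOp (Eα r₁ r₂ α) r₁ q b zd M₁) ∧
        J₁α r₁ r₂ q b zd M₁ α (gOp (Eα r₁ r₂ α) r₁ q b zd M₁) =
          J₁Op (Eα r₁ r₂ α) r₁ q b zd M₁) ∧
    -- ii) boundary control by the flux
    (∀ g b zd : ℝ,
      (IsUniqueMin (J₂ r₁ r₂ g b zd M₂) (qOp (E r₁ r₂) r₁ r₂ g b zd M₂) ∧
        J₂ r₁ r₂ g b zd M₂ (qOp (E r₁ r₂) r₁ r₂ g b zd M₂) =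
          J₂Op (E r₁ r₂) r₁ r₂ g b zd M₂) ∧
      ∀ α : ℝ, 0 < α →
        IsUniqueMin (J₂α r₁ r₂ g b zd M₂ α) (qOp (Eα r₁ r₂ α) r₁ r₂ g b zd M₂) ∧
        J₂α r₁ r₂ g b zd M₂ α (qOp (Eα r₁ r₂ α) r₁ r₂ g b zd M₂) =
          J₂Op (Eα r₁ r₂ α) r₁ r₂ g b zd M₂) ∧
    -- iii) boundary control by the (external) temperature
    (∀ g q zd : ℝ,
      (IsUniqueMin (J₃ r₁ r₂ g q zd M₃) (bOp (E r₁ r₂) r₁ g q zd M₃) ∧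
        J₃ r₁ r₂ g q zd M₃ (bOp (E r₁ r₂) r₁ g q zd M₃) = J₃Op (E r₁ r₂) r₁ g q zd M₃) ∧
      ∀ α : ℝ, 0 < α →
        IsUniqueMin (J₃α r₁ r₂ g q zd M₃ α) (bOp (Eα r₁ r₂ α) r₁ g q zd M₃) ∧
        J₃α r₁ r₂ g q zd M₃ α (bOp (Eα r₁ r₂ α) r₁ g q zd M₃) =
          J₃Op (Eα r₁ r₂ α) r₁ g q zd M₃) ∧
    -- iv) simultaneous distributed-boundary control
    (∀ b zd : ℝ,
      (IsUniqueMin (J₄ r₁ r₂ b zd M₄ M₅) (gqOp (E r₁ r₂) r₁ r₂ b zd M₄ M₅) ∧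
        J₄ r₁ r₂ b zd M₄ M₅ (gqOp (E r₁ r₂) r₁ r₂ b zd M₄ M₅) =
          J₄Op (E r₁ r₂) r₁ r₂ b zd M₄ M₅) ∧
      ∀ α : ℝ, 0 < α →
        IsUniqueMin (J₄α r₁ r₂ b zd M₄ M₅ α) (gqOp (Eα r₁ r₂ α) r₁ r₂ b zd M₄ M₅) ∧
        J₄α r₁ r₂ b zd M₄ M₅ α (gqOp (Eα r₁ r₂ α) r₁ r₂ b zd M₄ M₅) =
          J₄Op (Eα r₁ r₂ α) r₁ r₂ b zd M₄ M₅) ∧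
    -- v) convergence of the optimal controls as `α → ∞`, rates and limit constants
    (∀ q b zd : ℝ, ConvergesWithRate (fun α => gOp (Eα r₁ r₂ α) r₁ q b zd M₁)
      (gOp (E r₁ r₂) r₁ q b zd M₁) (limG r₁ r₂ q b zd M₁)) ∧
    (∀ g b zd : ℝ, ConvergesWithRate (fun α => qOp (Eα r₁ r₂ α) r₁ r₂ g b zd M₂)
      (qOp (E r₁ r₂) r₁ r₂ g b zd M₂) (limQ r₁ r₂ g b zd M₂)) ∧
    (∀ g q zd : ℝ, ConvergesWithRate (fun α => bOp (Eα r₁ r₂ α) r₁ g q zd M₃)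
      (bOp (E r₁ r₂) r₁ g q zd M₃) (limB r₁ r₂ g q M₃) ∧
      ∀ α : ℝ, 0 < α → |bOp (Eα r₁ r₂ α) r₁ g q zd M₃ - bOp (E r₁ r₂) r₁ g q zd M₃| =
        1 / α * limB r₁ r₂ g q M₃) ∧
    (∀ b zd : ℝ,
      Tendsto (fun α => gqOp (Eα r₁ r₂ α) r₁ r₂ b zd M₄ M₅) atTop
        (𝓝 (gqOp (E r₁ r₂) r₁ r₂ b zd M₄ M₅)) ∧
      ConvergesWithRate (fun α => (gqOp (Eα r₁ r₂ α) r₁ r₂ b zd M₄ M₅).1)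
        (gqOp (E r₁ r₂) r₁ r₂ b zd M₄ M₅).1 (limG4 r₁ r₂ b zd M₄ M₅) ∧
      ConvergesWithRate (fun α => (gqOp (Eα r₁ r₂ α) r₁ r₂ b zd M₄ M₅).2)
        (gqOp (E r₁ r₂) r₁ r₂ b zd M₄ M₅).2 (limQ4 r₁ r₂ b zd M₄ M₅)) ∧
    -- convergence of the optimal values
    (∀ q b zd : ℝ, ConvergesWithRate
      (fun α => J₁α r₁ r₂ q b zd M₁ α (gOp (Eα r₁ r₂ α) r₁ q b zd M₁))
      (J₁ r₁ r₂ q b zd M₁ (gOp (E r₁ r₂) r₁ q b zd M₁)) (limJ1 r₁ r₂ q b zd M₁)) ∧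
    (∀ g b zd : ℝ, ConvergesWithRate
      (fun α => J₂α r₁ r₂ g b zd M₂ α (qOp (Eα r₁ r₂ α) r₁ r₂ g b zd M₂))
      (J₂ r₁ r₂ g b zd M₂ (qOp (E r₁ r₂) r₁ r₂ g b zd M₂)) (limJ2 r₁ r₂ g b zd M₂)) ∧
    (∀ g q zd : ℝ, ConvergesWithRate
      (fun α => J₃α r₁ r₂ g q zd M₃ α (bOp (Eα r₁ r₂ α) r₁ g q zd M₃))
      (J₃ r₁ r₂ g q zd M₃ (bOp (E r₁ r₂) r₁ g q zd M₃)) (limJ3 r₁ r₂ g q zd M₃)) ∧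
    (∀ b zd : ℝ, ConvergesWithRate
      (fun α => J₄α r₁ r₂ b zd M₄ M₅ α (gqOp (Eα r₁ r₂ α) r₁ r₂ b zd M₄ M₅))
      (J₄ r₁ r₂ b zd M₄ M₅ (gqOp (E r₁ r₂) r₁ r₂ b zd M₄ M₅)) (limJ4 r₁ r₂ b zd M₄ M₅)) := by
  refine ⟨fun g q b => ⟨_, isStateS_radialState hr₁ hr₂ g q b,
      fun v hv => eqOn_radialState_of_isStateS hr₁ hr₂ g q b hv⟩,
    fun α hα g q b => ⟨_, isStateSα_radialState hr₁ hr₂ g q b hα,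
      fun v hv => eqOn_radialState_of_isStateSα hr₁ hr₂ g q b hα hv⟩,
    fun q b zd => ⟨isUniqueMin_J₁ hr₁ hr₂ hM₁ q b zd,
      fun α hα => isUniqueMin_J₁α hr₁ hr₂ hM₁ q b zd hα⟩,
    fun g b zd => ⟨isUniqueMin_J₂ hr₁ hr₂ hM₂ g b zd,
      fun α hα => isUniqueMin_J₂α hr₁ hr₂ hM₂ g b zd hα⟩,
    fun g q zd => ⟨isUniqueMin_J₃ hr₁ hr₂ hM₃ g q zd,
      fun α hα => isUniqueMin_J₃α hr₁ hr₂ hM₃ g q zd hα⟩,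
    fun b zd => ⟨isUniqueMin_J₄ hr₁ hr₂ hM₄ hM₅ b zd,
      fun α hα => isUniqueMin_J₄α hr₁ hr₂ hM₄ hM₅ b zd hα⟩,
    convergesWithRate_gOp hr₁ hr₂ hM₁,
    convergesWithRate_qOp hr₁ hr₂ hM₂,
    fun g q zd => ⟨convergesWithRate_bOp hr₁ hr₂ hM₃ g q zd,
      fun α hα => abs_bOp_sub hr₁ hr₂ hM₃ g q zd hα⟩,
    fun b zd => ?_,
    fun q b zd => convergesWithRate_J₁Op hr₁ hr₂ hM₁ q b zd
      (fun α hα => (isUniqueMin_J₁α hr₁ hr₂ hM₁ q b zd hα).2)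
      (isUniqueMin_J₁ hr₁ hr₂ hM₁ q b zd).2,
    fun g b zd => convergesWithRate_J₂Op hr₁ hr₂ hM₂ g b zd
      (fun α hα => (isUniqueMin_J₂α hr₁ hr₂ hM₂ g b zd hα).2)
      (isUniqueMin_J₂ hr₁ hr₂ hM₂ g b zd).2,
    fun g q zd => convergesWithRate_J₃Op hr₁ hr₂ hM₃ g q zd
      (fun α hα => (isUniqueMin_J₃α hr₁ hr₂ hM₃ g q zd hα).2)
      (isUniqueMin_J₃ hr₁ hr₂ hM₃ g q zd).2,
    fun b zd => convergesWithRate_J₄Op hr₁ hr₂ hM₄ hM₅ b zd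
      (fun α hα => (isUniqueMin_J₄α hr₁ hr₂ hM₄ hM₅ b zd hα).2)
      (isUniqueMin_J₄ hr₁ hr₂ hM₄ hM₅ b zd).2⟩
  have h₁ := convergesWithRate_gqOp_fst hr₁ hr₂ hM₄ hM₅ b zd
  have h₂ := convergesWithRate_gqOp_snd hr₁ hr₂ hM₄ hM₅ b zd
  exact ⟨h₁.1.prodMk_nhds h₂.1, h₁, h₂⟩
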